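/- **Theorem 4.1.** Let $1<\beta<2$, $\alpha=\beta-1$, $L,T>0$, $\omega_\gamma(x)=x^{\gamma-1}/\Gamma(\gamma)$. Let $U(x,y,t)$ be a smooth solution, $L$-periodic in $x$ and in $y$, of $$\int_0^t\omega_{2-\beta}(t-s)\,\partial_{ss}U(x,y,s)\,ds=\Delta U+f\quad(0<t\le T),\qquad U(\cdot,0)=\varphi_1,\quad \partial_tU(\cdot,0)=\varphi_2 ;$$ it suffices that $U$ is of class $C^4$ on $\mathbb R^2\times[0,T]$. *Mesh.* Let $0=t_0<\dots<t_N=T$, $\tau_n=t_n-t_{n-1}$, with $\tau_{n-1}\le\tau_n$ for $2\le n\le N$. For a sequence $w^n$ put $w^{n-1/2}=\frac12(w^n+w^{n-1})$ for $n\ge1$, and $w^{-1/2}=w^0$; likewise $t_{n-1/2}=\frac12(t_n+t_{n-1})$, $t_{-1/2}=t_0$. For $1\le k\le n$ let $$a^{(n)}_{n-k}=\frac1{t_{k-1/2}-t_{k-3/2}}\int_{t_{k-3/2}}^{t_{k-1/2}}\omega_{1-\alpha}(t_{n-1/2}-s)\,ds,\qquad \mathcal D_\tau^\alpha w^{n-1/2}=\sum_{k=1}^na^{(n)}_{n-k}\,(w^{k-1/2}-w^{k-3/2}),$$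 $$p^{(n)}_0=\frac1{a^{(n)}_0},\qquad p^{(n)}_{n-k}=\frac1{a^{(k)}_0}\sum_{j=k+1}^n\big(a^{(j)}_{j-k-1}-a^{(j)}_{j-k}\big)p^{(n)}_{n-j}\quad(1\le k<n).$$ *Scheme.* Let $M\ge1$, $h=L/M$, let $\Delta_h$ be the five-point Laplacian on the grid of nodes $(ih,jh)$, and for grid functions $w$ of period $M$ in each index let $\|w\|=\big(h^2\sum_{i,j=1}^Mw_{ij}^2\big)^{1/2}$. Let the $M$-periodic grid functions $u^n,v^n$ $(0\le n\le N)$ satisfy at all nodes $$\mathcal D_\tau^\alpha v^{n-1/2}=\Delta_hu^{n-1/2}+f(\cdot,t_{n-1/2}),\qquad v^{n-1/2}=\frac{u^n-u^{n-1}}{\tau_n}\quad(1\le n\le N),\qquad u^0=\varphi_1,\quad v^0=\varphi_2 .$$ Let $e^n=U(\cdot,t_n)-u^n$ at the nodes and, for $m\in\{2,3\}$, $$E_m^n=\max_{1\le k\le n}\sum_{j=1}^kp^{(k)}_{k-j}a^{(j)}_0\int_{t_{j-3/2}}^{t_{j-1/2}}(t-t_{j-3/2})\,\|\partial_t^mU(\cdot,t)\|\,dt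 .$$ 1. There is a constant $c$, depending only on $\beta,L,T$ and the problem with its solution $U$, such that for all $M$, $N$, all such meshes and all solutions of the scheme $$\|e^n\|\le c\,\big(E_3^n+t_{n-1/2}^{\beta-1}h^2+t_n\tau_n^2\big),\qquad 1\le n\le N .$$ In particular, no relation between the time steps and $h$ is required. 2. The last term can be dropped where it is dominated by the first: for $m\in\{2,3\}$ and $\kappa>0$ there is a constant $c$, depending in addition only on $m$ and $\kappa$, such that $$\|e^n\|\le c\,\big(E_m^n+t_{n-1/2}^{\beta-1}h^2\big),\qquad 1\le n\le N,$$ for all $M$, $N$, such meshes and solutions of the scheme for which $\|\partial_t^mU(\cdot,t)\|\ge\kappa$ on $[0,T]$. -/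

import Mathlib

namespace DiffusionWave

/-- `ω_γ(x) = x^(γ-1) / Γ(γ)`. -/
noncomputable def omega (γ x : ℝ) : ℝ := x ^ (γ - 1) / Real.Gamma γ

/-! ### The continuous problem -/

/-- The partial derivative `∂_t^m U (x, y, t)` on the closed time interval `[0, T]`
(one-sided at its two ends). -/
noncomputable def timeDeriv (T : ℝ) (m : ℕ) (U : ℝ → ℝ → ℝ → ℝ) (x y t : ℝ) : ℝ :=
  iteratedDerivWithin m (fun s => U x y s) (Set.Icc 0 T) t

/-- The Caputo derivative of order `β ∈ (1, 2)`:
`∫_0^t ω_{2-β}(t - s) ∂_s^2 U(x, y, s) ds`. -/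
noncomputable def caputo (T β : ℝ) (U : ℝ → ℝ → ℝ → ℝ) (x y t : ℝ) : ℝ :=
  ∫ s in (0 : ℝ)..t, omega (2 - β) (t - s) * timeDeriv T 2 U x y s

/-- The spatial Laplacian `U_xx + U_yy`. -/
noncomputable def spaceLaplacian (U : ℝ → ℝ → ℝ → ℝ) (x y t : ℝ) : ℝ :=
  iteratedDeriv 2 (fun x' => U x' y t) x + iteratedDeriv 2 (fun y' => U x y' t) y

/-- `U` is a smooth solution, `L`-periodic in `x` and in `y`, of the diffusion-wave problem
`D_t^β U = ΔU + f` for `0 < t ≤ T`, with `U = φ₁` and `U_t = φ₂` at `t = 0`.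
Smooth means here: of class `C^4` up to the boundary of the time interval `[0, T]`. -/
structure IsSmoothSolution (β L T : ℝ) (f : ℝ → ℝ → ℝ → ℝ) (φ₁ φ₂ : ℝ → ℝ → ℝ)
    (U : ℝ → ℝ → ℝ → ℝ) : Prop where
  smooth : ContDiffOn ℝ 4 (fun p : ℝ × ℝ × ℝ => U p.1 p.2.1 p.2.2)
    (Set.univ ×ˢ (Set.univ ×ˢ Set.Icc 0 T))
  periodic_x : ∀ x y, ∀ t ∈ Set.Icc 0 T, U (x + L) y t = U x y t
  periodic_y : ∀ x y, ∀ t ∈ Set.Icc 0 T, U x (y + L) t = U x y t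
  equation : ∀ x y, ∀ t ∈ Set.Ioc 0 T, caputo T β U x y t = spaceLaplacian U x y t + f x y t
  initial : ∀ x y, U x y 0 = φ₁ x y
  initial_velocity : ∀ x y, timeDeriv T 1 U x y 0 = φ₂ x y

/-! ### Time levels and half levels -/

/-- The step size `τ_n = t_n - t_{n-1}` (used for `n ≥ 1`). -/
def step (t : ℕ → ℝ) (n : ℕ) : ℝ := t n - t (n - 1)

/-- `half w n` is `w^{n-1/2} = (w^n + w^{n-1}) / 2` for `n ≥ 1`, with the convention
`w^{-1/2} = w^0`. Applied to the time levels themselves it gives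
`t_{n-1/2} = t_{n-1} + τ_n / 2` and `t_{-1/2} = t_0`. -/
noncomputable def half (w : ℕ → ℝ) : ℕ → ℝ
  | 0 => w 0
  | n + 1 => (w (n + 1) + w n) / 2

/-- Time levels `0 = t_0 < t_1 < ⋯ < t_N = T` with nondecreasing step sizes. -/
structure IsTimeMesh (T : ℝ) (N : ℕ) (t : ℕ → ℝ) : Prop where
  zero : t 0 = 0
  final : t N = T
  lt : ∀ n, n < N → t n < t (n + 1)
  step_le : ∀ n, 2 ≤ n → n ≤ N → step t (n - 1) ≤ step t n

/-! ### The L1-type kernels and their complementary kernels -/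

/-- `kerA α t n k` is the coefficient `a^{(n)}_{n-k}`, `1 ≤ k ≤ n`: the mean value of
`s ↦ ω_{1-α}(t_{n-1/2} - s)` over `[t_{k-3/2}, t_{k-1/2}]`. The length
`t_{k-1/2} - t_{k-3/2}` of this interval is `τ_{k-1/2}`, that is `(τ_k + τ_{k-1}) / 2` for
`k ≥ 2` and `τ_1 / 2` for `k = 1`. -/
noncomputable def kerA (α : ℝ) (t : ℕ → ℝ) (n k : ℕ) : ℝ :=
  1 / (half t k - half t (k - 1)) *
    ∫ s in (half t (k - 1))..(half t k), omega (1 - α) (half t n - s)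

/-- `kerP α t n k` is the discrete complementary convolution kernel `p^{(n)}_{n-k}`,
`1 ≤ k ≤ n`, defined recursively by `p^{(n)}_0 = 1 / a^{(n)}_0` and
`p^{(n)}_{n-k} = (1 / a^{(k)}_0) ∑_{j=k+1}^n (a^{(j)}_{j-k-1} - a^{(j)}_{j-k}) p^{(n)}_{n-j}`. -/
noncomputable def kerP (α : ℝ) (t : ℕ → ℝ) (n k : ℕ) : ℝ :=
  if n ≤ k then 1 / kerA α t n n
  else 1 / kerA α t k k *
    ∑ j ∈ (Finset.Icc (k + 1) n).attach,
      (kerA α t j.1 (k + 1) - kerA α t j.1 k) * kerP α t n j.1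
termination_by n - k
decreasing_by
  have h := Finset.mem_Icc.1 j.2
  omega

theorem kerP_self (α : ℝ) (t : ℕ → ℝ) (n : ℕ) : kerP α t n n = 1 / kerA α t n n := by
  rw [kerP, if_pos le_rfl]

theorem kerP_of_lt (α : ℝ) (t : ℕ → ℝ) (n k : ℕ) (h : k < n) :
    kerP α t n k = 1 / kerA α t k k *
      ∑ j ∈ Finset.Icc (k + 1) n, (kerA α t j (k + 1) - kerA α t j k) * kerP α t n j := by
  rw [kerP, if_neg (not_le.2 h)]
  congr 1
  exact Finset.sum_attach (Finset.Icc (k + 1) n)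
    (fun j => (kerA α t j (k + 1) - kerA α t j k) * kerP α t n j)

/-- The L1-type formula
`𝒟_τ^α w^{n-1/2} = ∑_{k=1}^n a^{(n)}_{n-k} (w^{k-1/2} - w^{k-3/2})`. -/
noncomputable def discreteCaputo (α : ℝ) (t : ℕ → ℝ) (w : ℕ → ℝ) (n : ℕ) : ℝ :=
  ∑ k ∈ Finset.Icc 1 n, kerA α t n k * (half w k - half w (k - 1))

/-! ### The spatial grid -/

/-- The five-point Laplacian `δ_x^2 + δ_y^2` with mesh width `h`. -/
noncomputable def gridLaplacian (h : ℝ) (w : ℤ → ℤ → ℝ) (i j : ℤ) : ℝ :=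
  ((w (i + 1) j - w i j) / h - (w i j - w (i - 1) j) / h) / h +
    ((w i (j + 1) - w i j) / h - (w i j - w i (j - 1)) / h) / h

/-- A grid function with period `M` in each index. -/
def IsPeriodicGrid (M : ℕ) (w : ℤ → ℤ → ℝ) : Prop :=
  (∀ i j, w (i + M) j = w i j) ∧ ∀ i j, w i (j + M) = w i j

/-- The discrete `L²` norm over one period of the grid of mesh width `h`. -/
noncomputable def gridNorm (M : ℕ) (h : ℝ) (w : ℤ → ℤ → ℝ) : ℝ :=
  Real.sqrt (h ^ 2 * ∑ i ∈ Finset.Icc (1 : ℤ) M, ∑ j ∈ Finset.Icc (1 : ℤ) M, w i j ^ 2)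

/-- The values at the nodes `(i h, j h)` of a function on the plane. -/
def onGrid (h : ℝ) (g : ℝ → ℝ → ℝ) (i j : ℤ) : ℝ := g (i * h) (j * h)

/-! ### The difference scheme -/

/-- `u n i j` and `v n i j` (time level `n ≤ N`, node `(i h, j h)`, `h = L / M`) solve the
order-reduction scheme of the diffusion-wave problem of order `β`, where `α = β - 1`. -/
structure IsSchemeSolution (β L : ℝ) (f : ℝ → ℝ → ℝ → ℝ) (φ₁ φ₂ : ℝ → ℝ → ℝ)
    (M N : ℕ) (t : ℕ → ℝ) (u v : ℕ → ℤ → ℤ → ℝ) : Prop where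
  periodic_u : ∀ n, n ≤ N → IsPeriodicGrid M (u n)
  periodic_v : ∀ n, n ≤ N → IsPeriodicGrid M (v n)
  scheme : ∀ n, 1 ≤ n → n ≤ N → ∀ i j : ℤ,
    discreteCaputo (β - 1) t (fun k => v k i j) n =
      gridLaplacian (L / M) (fun i' j' => half (fun k => u k i' j') n) i j +
        onGrid (L / M) (fun x y => f x y (half t n)) i j
  velocity : ∀ n, 1 ≤ n → n ≤ N → ∀ i j : ℤ,
    half (fun k => v k i j) n = (u n i j - u (n - 1) i j) / step t n
  initial_u : ∀ i j : ℤ, u 0 i j = onGrid (L / M) φ₁ i j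
  initial_v : ∀ i j : ℤ, v 0 i j = onGrid (L / M) φ₂ i j

/-- The error `e^n = U^n - u^n` at the nodes. -/
noncomputable def gridError (L : ℝ) (M : ℕ) (t : ℕ → ℝ) (U : ℝ → ℝ → ℝ → ℝ)
    (u : ℕ → ℤ → ℤ → ℝ) (n : ℕ) (i j : ℤ) : ℝ :=
  onGrid (L / M) (fun x y => U x y (t n)) i j - u n i j

/-! ### The error bound -/

/-- The discrete `L²` norm `‖∂_t^m U(·, s)‖` of the time derivative at time `s`. -/
noncomputable def timeDerivNorm (L T : ℝ) (M m : ℕ) (U : ℝ → ℝ → ℝ → ℝ) (s : ℝ) : ℝ :=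
  gridNorm M (L / M) (onGrid (L / M) (fun x y => timeDeriv T m U x y s))

/-- `∑_{j=1}^k p^{(k)}_{k-j} a^{(j)}_0
  ∫_{t_{j-3/2}}^{t_{j-1/2}} (s - t_{j-3/2}) ‖∂_t^m U(·, s)‖ ds`, with kernels for `α = β - 1`. -/
noncomputable def consistencySum (β L T : ℝ) (M m : ℕ) (t : ℕ → ℝ) (U : ℝ → ℝ → ℝ → ℝ)
    (k : ℕ) : ℝ :=
  ∑ j ∈ Finset.Icc 1 k, kerP (β - 1) t k j * kerA (β - 1) t j j *
    ∫ s in (half t (j - 1))..(half t j), (s - half t (j - 1)) * timeDerivNorm L T M m U s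

/-- The maximum of `consistencySum` over `1 ≤ k ≤ n`. -/
noncomputable def consistencyMax (β L T : ℝ) (M m : ℕ) (t : ℕ → ℝ) (U : ℝ → ℝ → ℝ → ℝ)
    (n : ℕ) (hn : 1 ≤ n) : ℝ :=
  (Finset.Icc 1 n).sup' (Finset.nonempty_Icc.2 hn) (consistencySum β L T M m t U)

end DiffusionWave

/-! Put `γ = 1 - α = 2 - β`. The errors obey a perturbed scheme: `e^n - e^{n-1}` is `τ_n` times the
velocity error minus a quotient error, and the L1 operator, applied to the velocity error minus an
averaging error, equals `Δ_h e^{n-1/2}` plus a consistency error `R^n`. Inverting the L1 operator on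
`R` with the complementary kernels moves `R` into the first equation at the cost `∑ p ‖R‖`.
Everything thus rests on a bound `‖e^N‖ ≤ C ∑ τ_n ‖ρ^n‖` with `C` independent of the mesh and of `h`
(`exists_error_stability`, `exists_operator_stability`).

Since `Δ_h` is symmetric and nonpositive, this splits into scalar modes of frequency `μ ≥ 0`, and
for `μ > 0` rescaling time gives `μ = 1`. The remaining `exists_mode_stability` holds for all
nondecreasing steps `d n`, however small or large compared with 1; hence no relation between steps
and `h` is needed. The energy identity contains the form `∑ d n * y (n+1) * lconv γ σ y (n+1)`.
Without the weights `d n` it is nonnegative, because the kernel is monotone; with them it is not,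
and the monotone steps are cut into three consecutive blocks. For steps below a small `δ`, the
velocity is bounded by the error through a maximum principle (`abs_velocity_le`), and the negative
part of the form is a multiple of the squared error that vanishes with `δ` (`sq_le_small`). Between
`δ` and a large `Λ`, dividing by `d n` removes the weight at the cost of a constant
(`sq_le_middle`). Above `Λ`, Abel summation over tails, whose dependence on the past is controlled
by `tail_ge`, leaves a defect of order `Λ ^ (γ - 1)` (`sq_le_large`). In each block the estimate is
closed at the maximum of `|e|`.

For consistency, concavity of `x ^ γ` bounds the L1 error by kernel differences times local
integrals, which is exactly the shape that the recursion for `p` collapses to `E_3`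
(`kerA_consistency_norm`, `sum_kerP_mul_le`). The averages and the five-point Laplacian contribute
`τ²` and `h²`, weighted by `∑ p ≤ Γ(1-α) t_{n-1/2}^α`. For the second claim, the last summand of
`E_m` alone is at least `κ τ_n² / 8`. -/

namespace DiffusionWave

open Finset

/-! ### Convexity inequalities for powers `x ^ γ`, `0 < γ < 1`. -/

section

/-- Both chords are compared with the chord over `[a, d]`. The intervals may overlap, which the
kernel comparisons need. -/
theorem slope_antitone_of_concaveOn {f : ℝ → ℝ} (hf : ConcaveOn ℝ (Set.Ici 0) f) {a b c d : ℝ}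
    (ha : 0 ≤ a) (hab : a < b) (hcd : c < d) (hac : a ≤ c) (hbd : b ≤ d) :
    (f d - f c) / (d - c) ≤ (f b - f a) / (b - a) := by
  have hn := hf.neg
  have h1 : (f d - f a) / (d - a) ≤ (f b - f a) / (b - a) := by
    have := hn.secant_mono (a := a) (x := b) (y := d) ha (by simp; linarith) (by simp; linarith)
      (by linarith) (by linarith) hbd
    simp only [Pi.neg_apply] at this
    rw [show -f b - -f a = -(f b - f a) by ring, show -f d - -f a = -(f d - f a) by ring,
      neg_div, neg_div] at this
    linarith
  have h2 : (f d - f c) / (d - c) ≤ (f d - f a) / (d - a) := by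
    have := hn.secant_mono (a := d) (x := a) (y := c) (by simp; linarith) ha (by simp; linarith)
      (by linarith) (by linarith) hac
    simp only [Pi.neg_apply] at this
    rw [show (-f a - -f d) = (f d - f a) by ring, show -f c - -f d = (f d - f c) by ring,
      show a - d = -(d - a) by ring, show c - d = -(d - c) by ring, div_neg, div_neg] at this
    linarith
  exact h2.trans h1

section Power

variable {γ : ℝ}

theorem rpow_concave (h0 : 0 < γ) (h1 : γ < 1) : ConcaveOn ℝ (Set.Ici 0) fun x : ℝ => x ^ γ :=
  Real.concaveOn_rpow h0.le h1.le

theorem hasDerivAt_rpow_pos (p : ℝ) {x : ℝ} (hx : 0 < x) :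
    HasDerivAt (fun y : ℝ => y ^ p) (p * x ^ (p - 1)) x :=
  Real.hasDerivAt_rpow_const (Or.inl hx.ne')

theorem rpow_le_tangent (h0 : 0 < γ) (h1 : γ < 1) {x y : ℝ} (hx : 0 < x) (hy : 0 ≤ y) :
    y ^ γ ≤ x ^ γ + γ * x ^ (γ - 1) * (y - x) := by
  have hc := (rpow_concave h0 h1).neg
  have hd := (hasDerivAt_rpow_pos γ hx).neg
  rcases lt_trichotomy x y with h | h | h
  · have := hc.le_slope_of_hasDerivAt (x := x) (y := y) hx.le hy h hd
    rw [slope_def_field, le_div_iff₀ (by linarith)] at this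
    simp only [Pi.neg_apply] at this
    linarith
  · subst h; simp
  · have := hc.slope_le_of_hasDerivAt (x := y) (y := x) hy hx.le h hd
    rw [slope_def_field, div_le_iff₀ (by linarith)] at this
    simp only [Pi.neg_apply] at this
    linarith

/-- Decreasing functions `x ↦ x ^ (γ - 1)`. -/
theorem rpow_sub_one_antitone (h1 : γ < 1) {x y : ℝ} (hx : 0 < x) (hxy : x ≤ y) :
    y ^ (γ - 1) ≤ x ^ (γ - 1) :=
  Real.rpow_le_rpow_of_nonpos hx hxy (by linarith)

theorem rpow_neg_convex {p : ℝ} (hp : p < 0) : ConvexOn ℝ (Set.Ioi 0) fun x : ℝ => x ^ p := by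
  refine MonotoneOn.convexOn_of_deriv (convex_Ioi 0) ?_ ?_ ?_
  · exact fun x hx => (hasDerivAt_rpow_pos p hx).continuousAt.continuousWithinAt
  · rw [interior_Ioi]
    exact fun x hx => (hasDerivAt_rpow_pos p hx).differentiableAt.differentiableWithinAt
  · rw [interior_Ioi]
    intro x hx y hy hxy
    rw [(hasDerivAt_rpow_pos p hx).deriv, (hasDerivAt_rpow_pos p hy).deriv]
    have := Real.rpow_le_rpow_of_nonpos hx hxy (show p - 1 ≤ 0 by linarith)
    nlinarith

theorem rpow_neg_sub_le {p : ℝ} (hp : p < 0) {x y : ℝ} (hx : 0 < x) (hxy : x ≤ y) :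
    -p * y ^ (p - 1) * (y - x) ≤ x ^ p - y ^ p := by
  rcases hxy.eq_or_lt with rfl | h
  · simp
  have hy : 0 < y := hx.trans h
  have := (rpow_neg_convex hp).slope_le_of_hasDerivAt (x := x) (y := y) hx hy h
    (hasDerivAt_rpow_pos p hy)
  rw [slope_def_field, div_le_iff₀ (by linarith)] at this
  linarith

/-- The trapezoidal rule overestimates the integral of the derivative of `x ^ γ`. -/
theorem rpow_trapezoid (h0 : 0 < γ) (h1 : γ < 1) {x y : ℝ} (hx : 0 < x) (hxy : x ≤ y) :
    2 * (y ^ γ - x ^ γ) ≤ (y - x) * (γ * x ^ (γ - 1) + γ * y ^ (γ - 1)) := by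
  -- The excess of the trapezoidal rule as a function of the right end; it vanishes at `x`, and its
  -- derivative is nonnegative because the convex function `x ^ (γ - 1)` lies above its tangent.
  let F : ℝ → ℝ := fun y => (y - x) * (γ * x ^ (γ - 1) + γ * y ^ (γ - 1)) - 2 * (y ^ γ - x ^ γ)
  have hd : ∀ z, 0 < z → HasDerivAt F (γ * x ^ (γ - 1) + γ * z ^ (γ - 1) +
      (z - x) * (γ * ((γ - 1) * z ^ (γ - 1 - 1))) - 2 * (γ * z ^ (γ - 1))) z := by
    intro z hz
    have a1 := (hasDerivAt_rpow_pos γ hz)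
    have a2 := (hasDerivAt_rpow_pos (γ - 1) hz)
    have := (((hasDerivAt_id z).sub_const x).fun_mul
      ((a2.const_mul γ).const_add (γ * x ^ (γ - 1)))).fun_sub
      ((a1.sub_const (x ^ γ)).const_mul 2)
    exact this.congr_deriv (by simp)
  have hmono : MonotoneOn F (Set.Ici x) := by
    refine monotoneOn_of_deriv_nonneg (convex_Ici x) ?_ ?_ ?_
    · exact fun z hz => (hd z (hx.trans_le hz)).continuousAt.continuousWithinAt
    · rw [interior_Ici]
      exact fun z hz => (hd z (hx.trans hz)).differentiableAt.differentiableWithinAt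
    · rw [interior_Ici]
      intro z hz
      have hz' : x < z := hz
      rw [(hd z (hx.trans hz)).deriv]
      have := rpow_neg_sub_le (show γ - 1 < 0 by linarith) hx hz'.le
      nlinarith
  have := hmono (Set.mem_Ici.2 le_rfl) (Set.mem_Ici.2 hxy) hxy
  simp only [F] at this
  simp at this
  linarith

/-- Difference of the secant slopes of `x ^ γ` over two adjacent intervals is decreasing. -/
theorem slope_sub_slope_antitone (h0 : 0 < γ) (h1 : γ < 1) {η h : ℝ} (hη : 0 < η) (hh : 0 < h) :
    AntitoneOn (fun d : ℝ => (d ^ γ - (d - η) ^ γ) / η - ((d + h) ^ γ - d ^ γ) / h)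
      (Set.Ici η) := by
  have hd : ∀ d, η < d → HasDerivAt
      (fun d : ℝ => (d ^ γ - (d - η) ^ γ) / η - ((d + h) ^ γ - d ^ γ) / h)
      ((γ * d ^ (γ - 1) - γ * (d - η) ^ (γ - 1)) / η -
        (γ * (d + h) ^ (γ - 1) - γ * d ^ (γ - 1)) / h) d := by
    intro d hd
    have a1 := hasDerivAt_rpow_pos γ (hη.trans hd)
    have a2 := (hasDerivAt_rpow_pos γ (sub_pos.2 hd)).comp d ((hasDerivAt_id d).sub_const η)
    have a3 := (hasDerivAt_rpow_pos γ (show 0 < d + h by linarith)).comp d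
      ((hasDerivAt_id d).add_const h)
    have := ((a1.fun_sub a2).div_const η).fun_sub ((a3.fun_sub a1).div_const h)
    simpa [Function.comp_def] using this
  refine antitoneOn_of_deriv_nonpos (convex_Ici η) ?_ ?_ ?_
  · have : Continuous fun x : ℝ => x ^ γ := Real.continuous_rpow_const h0.le
    apply Continuous.continuousOn
    exact ((this.sub (this.comp (continuous_id.sub continuous_const))).div_const _).sub
      (((this.comp (continuous_id.add continuous_const)).sub this).div_const _)
  · rw [interior_Ici]
    exact fun d hx => (hd d hx).differentiableAt.differentiableWithinAt
  · rw [interior_Ici]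
    intro d hx
    have hx' : η < d := hx
    rw [(hd d hx).deriv]
    -- Up to the factor `γ`, the derivative compares the slopes of the convex function `x ^ (γ - 1)`
    -- on the two intervals adjacent to `d`.
    have := (rpow_neg_convex (show γ - 1 < 0 by linarith)).slope_mono_adjacent
      (x := d - η) (y := d) (z := d + h) (sub_pos.2 hx') (show (0 : ℝ) < d + h by linarith)
      (by linarith) (by linarith)
    rw [show d - (d - η) = η by ring, show d + h - d = h by ring] at this
    rw [← mul_sub, ← mul_sub, mul_div_assoc, mul_div_assoc, ← mul_sub]
    exact mul_nonpos_of_nonneg_of_nonpos h0.le (by linarith)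

/-- The second derivative is `γ (γ - 1)` times the increment of `x ^ (γ - 2)`, a product of two
nonpositive factors. This convexity makes step-weighted second differences telescope. -/
theorem rpow_increment_convex (h0 : 0 < γ) (h1 : γ < 1) {η : ℝ} (hη : 0 < η) :
    ConvexOn ℝ (Set.Ici 0) fun x : ℝ => (x + η) ^ γ - x ^ γ := by
  have hd : ∀ x : ℝ, 0 < x → HasDerivAt (fun x : ℝ => (x + η) ^ γ - x ^ γ)
      (γ * (x + η) ^ (γ - 1) - γ * x ^ (γ - 1)) x := by
    intro x hx
    have a3 := (hasDerivAt_rpow_pos γ (show 0 < x + η by linarith)).comp x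
      ((hasDerivAt_id x).add_const η)
    simpa [Function.comp_def] using a3.fun_sub (hasDerivAt_rpow_pos γ hx)
  have hd2 : ∀ x : ℝ, 0 < x → HasDerivAt (fun x : ℝ => γ * (x + η) ^ (γ - 1) - γ * x ^ (γ - 1))
      (γ * ((γ - 1) * (x + η) ^ (γ - 1 - 1)) - γ * ((γ - 1) * x ^ (γ - 1 - 1))) x := by
    intro x hx
    have a3 := (hasDerivAt_rpow_pos (γ - 1) (show 0 < x + η by linarith)).comp x
      ((hasDerivAt_id x).add_const η)
    simpa [Function.comp_def] using
      (a3.const_mul γ).fun_sub ((hasDerivAt_rpow_pos (γ - 1) hx).const_mul γ)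
  refine MonotoneOn.convexOn_of_deriv (convex_Ici 0) ?_ ?_ ?_
  · have : Continuous fun x : ℝ => x ^ γ := Real.continuous_rpow_const h0.le
    exact ((this.comp (continuous_id.add continuous_const)).sub this).continuousOn
  · rw [interior_Ici]
    exact fun d hx => (hd d hx).differentiableAt.differentiableWithinAt
  · rw [interior_Ici]
    have : MonotoneOn (fun x : ℝ => γ * (x + η) ^ (γ - 1) - γ * x ^ (γ - 1)) (Set.Ioi 0) := by
      refine monotoneOn_of_deriv_nonneg (convex_Ioi 0) ?_ ?_ ?_
      · exact fun x hx => (hd2 x hx).continuousAt.continuousWithinAt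
      · rw [interior_Ioi]
        exact fun x hx => (hd2 x hx).differentiableAt.differentiableWithinAt
      · rw [interior_Ioi]
        intro x hx
        have hx' : 0 < x := hx
        rw [(hd2 x hx).deriv]
        have := Real.rpow_le_rpow_of_nonpos hx' (show x ≤ x + η by linarith)
          (show γ - 1 - 1 ≤ 0 by linarith)
        have h3 : 0 ≤ γ * (1 - γ) := mul_nonneg h0.le (by linarith)
        nlinarith
    intro x hx y hy hxy
    rw [(hd x hx).deriv, (hd y hy).deriv]
    exact this hx hy hxy

/-- Second differences of `x ^ γ` with increment `η`, weighted with a larger step `h`. -/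
theorem second_difference_le_telescope (h0 : 0 < γ) (h1 : γ < 1) {η h d : ℝ} (hη : 0 < η)
    (hh : η ≤ h) (hd : h ≤ d) :
    h * ((d ^ γ - (d - η) ^ γ) / η - ((d + η) ^ γ - d ^ γ) / η) ≤
      ((d - h + η) ^ γ - (d - h) ^ γ) - ((d + η) ^ γ - d ^ γ) := by
  have hh0 : 0 < h := hη.trans_le hh
  have hc := (rpow_increment_convex h0 h1 hη).2
  -- The point `d - η` is the convex combination of `d - h` and `d` with weights `η / h` and `1 - η
  -- / h`.
  have := hc (Set.mem_Ici.2 (sub_nonneg.2 hd)) (Set.mem_Ici.2 (hh0.le.trans hd))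
    (show 0 ≤ η / h by positivity) (show 0 ≤ 1 - η / h by rw [sub_nonneg, div_le_one hh0]; exact hh)
    (by ring)
  simp only [smul_eq_mul] at this
  rw [show η / h * (d - h) + (1 - η / h) * d = d - η by field_simp; ring,
    show d - η + η = d by ring] at this
  have e : h * ((d ^ γ - (d - η) ^ γ) / η - ((d + η) ^ γ - d ^ γ) / η) =
      h / η * ((d ^ γ - (d - η) ^ γ) - ((d + η) ^ γ - d ^ γ)) := by ring
  rw [e, div_mul_eq_mul_div, div_le_iff₀ hη]
  have := mul_le_mul_of_nonneg_left this hh0.le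
  have e2 : h * (η / h * ((d - h + η) ^ γ - (d - h) ^ γ) + (1 - η / h) * ((d + η) ^ γ - d ^ γ)) =
      η * ((d - h + η) ^ γ - (d - h) ^ γ) + (h - η) * ((d + η) ^ γ - d ^ γ) := by
    field_simp
  rw [e2] at this
  nlinarith

end Power

end

/-! ### Half-level meshes, and monotonicity and positivity of the kernel. -/

section

/-- Nondecreasing steps `d n` together with the half levels `σ` of the mesh they generate. -/
structure StepMesh (d σ : ℕ → ℝ) : Prop where
  pos : ∀ n, 0 < d n
  mono : ∀ n, d n ≤ d (n + 1)
  zero : σ 0 = 0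
  succ : ∀ n, σ (n + 1) = ∑ k ∈ range n, d k + d n / 2

/-- The mean value of the derivative of `x ^ γ` at distance `σ n - s`, for
`σ k ≤ s ≤ σ (k + 1)`. -/
noncomputable def lker (γ : ℝ) (σ : ℕ → ℝ) (n k : ℕ) : ℝ :=
  ((σ n - σ k) ^ γ - (σ n - σ (k + 1)) ^ γ) / (σ (k + 1) - σ k)

/-- Difference of neighbouring kernel values in a row. -/
noncomputable def lkerDiff (γ : ℝ) (σ : ℕ → ℝ) (n k : ℕ) : ℝ := lker γ σ n (k + 1) - lker γ σ n k

/-- The discrete convolution of the kernel with the differences of `y`. -/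
noncomputable def lconv (γ : ℝ) (σ y : ℕ → ℝ) (n : ℕ) : ℝ :=
  ∑ k ∈ range n, lker γ σ n k * (y (k + 1) - y k)

namespace StepMesh

variable {d σ : ℕ → ℝ} {γ : ℝ}

theorem width_zero (hm : StepMesh d σ) : σ 1 - σ 0 = d 0 / 2 := by
  rw [hm.zero, hm.succ 0]; simp

theorem width_succ (hm : StepMesh d σ) (k : ℕ) : σ (k + 2) - σ (k + 1) = (d k + d (k + 1)) / 2 := by
  rw [hm.succ (k + 1), hm.succ k, sum_range_succ]; ring

theorem le_two_width (hm : StepMesh d σ) (k : ℕ) : d k ≤ 2 * (σ (k + 1) - σ k) := by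
  cases k with
  | zero => rw [hm.width_zero]; linarith
  | succ k => rw [hm.width_succ]; linarith [hm.pos k]

theorem width_le (hm : StepMesh d σ) (k : ℕ) : σ (k + 1) - σ k ≤ d k := by
  cases k with
  | zero => rw [hm.width_zero]; linarith [hm.pos 0]
  | succ k => rw [hm.width_succ]; linarith [hm.mono k]

theorem le_width_succ (hm : StepMesh d σ) (k : ℕ) : d k ≤ σ (k + 2) - σ (k + 1) := by
  rw [hm.width_succ]; linarith [hm.mono k]

theorem width_pos (hm : StepMesh d σ) (k : ℕ) : 0 < σ (k + 1) - σ k := by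
  linarith [hm.le_two_width k, hm.pos k]

theorem width_mono (hm : StepMesh d σ) (k : ℕ) : σ (k + 1) - σ k ≤ σ (k + 2) - σ (k + 1) :=
  (hm.width_le k).trans (hm.le_width_succ k)

theorem monotone_step (hm : StepMesh d σ) : Monotone d := monotone_nat_of_le_succ hm.mono

theorem strictMono (hm : StepMesh d σ) : StrictMono σ :=
  strictMono_nat_of_lt_succ fun k => sub_pos.1 (hm.width_pos k)

theorem le_level (hm : StepMesh d σ) {k n : ℕ} (h : k ≤ n) : σ k ≤ σ n := hm.strictMono.monotone h

theorem lker_pos (hm : StepMesh d σ) (h0 : 0 < γ) {n k : ℕ} (h : k < n) : 0 < lker γ σ n k := by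
  have h1 := hm.width_pos k
  have h2 := hm.le_level (show k + 1 ≤ n from h)
  refine div_pos (sub_pos.2 (Real.rpow_lt_rpow (by linarith) (by linarith) h0)) h1

theorem lker_le_succ (hm : StepMesh d σ) (h0 : 0 < γ) (h1 : γ < 1) {n k : ℕ} (h : k + 1 < n) :
    lker γ σ n k ≤ lker γ σ n (k + 1) := by
  have a1 := hm.width_pos k
  have a2 := hm.width_pos (k + 1)
  have a3 := hm.le_level (show k + 2 ≤ n from h)
  have := slope_antitone_of_concaveOn (rpow_concave h0 h1) (a := σ n - σ (k + 2))
    (b := σ n - σ (k + 1)) (c := σ n - σ (k + 1)) (d := σ n - σ k) (by linarith) (by linarith)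
    (by linarith) (by linarith) (by linarith)
  simpa [lker] using this

theorem lkerDiff_nonneg (hm : StepMesh d σ) (h0 : 0 < γ) (h1 : γ < 1) {n k : ℕ} (h : k + 1 < n) :
    0 ≤ lkerDiff γ σ n k := sub_nonneg.2 (hm.lker_le_succ h0 h1 h)

theorem lker_first_le (hm : StepMesh d σ) (h0 : 0 < γ) (h1 : γ < 1) {n k : ℕ} (h : k < n) :
    lker γ σ n 0 ≤ lker γ σ n k := by
  induction k with
  | zero => exact le_rfl
  | succ k ih => exact (ih (by lia)).trans (hm.lker_le_succ h0 h1 h)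

/-- Both ends of the chord move away from zero, because the cell widths are nondecreasing. This
makes column sums of kernel differences telescope. -/
theorem lker_shift_le (hm : StepMesh d σ) (h0 : 0 < γ) (h1 : γ < 1) {n k : ℕ} (h : k < n) :
    lker γ σ (n + 1) (k + 1) ≤ lker γ σ n k := by
  have a1 := hm.width_pos k
  have a2 := hm.width_pos (k + 1)
  have a3 := hm.le_level (show k + 1 ≤ n from h)
  have a5 : σ (k + 2) - σ (k + 1) ≤ σ (n + 1) - σ n := by
    have : Monotone fun k => σ (k + 1) - σ k := monotone_nat_of_le_succ hm.width_mono
    exact this (show k + 1 ≤ n from h)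
  have a6 := hm.width_mono k
  have := slope_antitone_of_concaveOn (rpow_concave h0 h1) (a := σ n - σ (k + 1))
    (b := σ n - σ k) (c := σ (n + 1) - σ (k + 2)) (d := σ (n + 1) - σ (k + 1)) (by linarith)
    (by linarith) (by linarith) (by linarith) (by linarith)
  simpa [lker] using this

/-- The cells stay fixed and only their distance to the current level grows. This supplies the
monotone weight for Abel summation in `tail_ge`. -/
theorem lkerDiff_succ_le (hm : StepMesh d σ) (h0 : 0 < γ) (h1 : γ < 1) {n k : ℕ} (h : k + 1 < n) :
    lkerDiff γ σ (n + 1) k ≤ lkerDiff γ σ n k := by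
  have a1 := hm.width_pos k
  have a2 := hm.width_pos (k + 1)
  have a3 := hm.le_level (show k + 2 ≤ n from h)
  have a4 := hm.width_pos n
  have key := slope_sub_slope_antitone h0 h1 a2 a1
    (show σ n - σ (k + 1) ∈ Set.Ici _ from Set.mem_Ici.2 (by linarith))
    (show σ (n + 1) - σ (k + 1) ∈ Set.Ici _ from Set.mem_Ici.2 (by linarith)) (by linarith)
  have e : ∀ m, lkerDiff γ σ m k =
      ((σ m - σ (k + 1)) ^ γ - (σ m - σ (k + 1) - (σ (k + 1 + 1) - σ (k + 1))) ^ γ) /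
        (σ (k + 1 + 1) - σ (k + 1)) -
      ((σ m - σ (k + 1) + (σ (k + 1) - σ k)) ^ γ - (σ m - σ (k + 1)) ^ γ) / (σ (k + 1) - σ k) := by
    intro m
    rw [show σ m - σ (k + 1) - (σ (k + 1 + 1) - σ (k + 1)) = σ m - σ (k + 1 + 1) by ring,
      show σ m - σ (k + 1) + (σ (k + 1) - σ k) = σ m - σ k by ring]
    rfl
  rw [e, e]
  exact key

theorem lker_last (hm : StepMesh d σ) (h0 : 0 < γ) (n : ℕ) :
    lker γ σ (n + 1) n = (σ (n + 1) - σ n) ^ (γ - 1) := by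
  rw [lker, sub_self, Real.zero_rpow h0.ne', sub_zero, Real.rpow_sub_one (hm.width_pos n).ne']

theorem width_mul_lker_last (hm : StepMesh d σ) (h0 : 0 < γ) (n : ℕ) :
    (σ (n + 1) - σ n) * lker γ σ (n + 1) n = (σ (n + 1) - σ n) ^ γ := by
  rw [lker, sub_self, Real.zero_rpow h0.ne', sub_zero, mul_div_cancel₀ _ (hm.width_pos n).ne']

theorem lker_lower (hm : StepMesh d σ) (h0 : 0 < γ) (h1 : γ < 1) {n k : ℕ} (h : k < n) :
    γ * (σ n - σ k) ^ (γ - 1) ≤ lker γ σ n k := by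
  have a1 := hm.width_pos k
  have a3 := hm.le_level (show k + 1 ≤ n from h)
  rw [lker, le_div_iff₀ a1]
  have := rpow_le_tangent h0 h1 (x := σ n - σ k) (y := σ n - σ (k + 1)) (by linarith) (by linarith)
  linarith

/-- The upper deviation of a kernel value is controlled by the next difference. -/
theorem lker_sub_le_lkerDiff (hm : StepMesh d σ) (h0 : 0 < γ) (h1 : γ < 1) {n k : ℕ}
    (h : k + 1 < n) : lker γ σ n k - γ * (σ n - σ k) ^ (γ - 1) ≤ lkerDiff γ σ n k := by
  have a1 := hm.width_pos k
  have a2 := hm.width_pos (k + 1)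
  have a3 := hm.le_level (show k + 2 ≤ n from h)
  have t := rpow_trapezoid h0 h1 (x := σ n - σ (k + 1)) (y := σ n - σ k) (by linarith) (by linarith)
  -- The index is read off from `h`, so this bounds the next kernel value, the one at `k + 1`.
  have l := hm.lker_lower h0 h1 h
  have e : lker γ σ n k * (σ (k + 1) - σ k) = (σ n - σ k) ^ γ - (σ n - σ (k + 1)) ^ γ :=
    div_mul_cancel₀ _ a1.ne'
  rw [← e, show σ n - σ k - (σ n - σ (k + 1)) = σ (k + 1) - σ k by ring] at t
  -- The kernel value is at most the mean of the derivatives at the two ends of its cell, so it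
  -- exceeds the far one by no more than it falls short of the near one.
  have : 2 * lker γ σ n k ≤
      γ * (σ n - σ (k + 1)) ^ (γ - 1) + γ * (σ n - σ k) ^ (γ - 1) := by
    by_contra hc
    push Not at hc
    nlinarith
  rw [lkerDiff]
  linarith

/-- A kernel difference is at least half the drop of the derivative across cell `k`, hence at least
half the width times `γ (1 - γ)` times the power at the far end. A further factor `1 / 2` comes from
`d k ≤ 2 * width`. -/
theorem lkerDiff_lower (hm : StepMesh d σ) (h0 : 0 < γ) (h1 : γ < 1) {n k : ℕ} (h : k + 1 < n) :
    γ * (1 - γ) / 4 * d k * (σ n - σ k) ^ (γ - 2) ≤ lkerDiff γ σ n k := by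
  have a1 := hm.width_pos k
  have a2 := hm.width_pos (k + 1)
  have a3 := hm.le_level (show k + 2 ≤ n from h)
  have t := rpow_trapezoid h0 h1 (x := σ n - σ (k + 1)) (y := σ n - σ k) (by linarith) (by linarith)
  have l := hm.lker_lower h0 h1 h
  have e : lker γ σ n k * (σ (k + 1) - σ k) = (σ n - σ k) ^ γ - (σ n - σ (k + 1)) ^ γ :=
    div_mul_cancel₀ _ a1.ne'
  rw [← e, show σ n - σ k - (σ n - σ (k + 1)) = σ (k + 1) - σ k by ring] at t
  have ht : 2 * lker γ σ n k ≤
      γ * (σ n - σ (k + 1)) ^ (γ - 1) + γ * (σ n - σ k) ^ (γ - 1) := by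
    by_contra hc
    push Not at hc
    nlinarith
  have s := rpow_neg_sub_le (show γ - 1 < 0 by linarith) (x := σ n - σ (k + 1)) (y := σ n - σ k)
    (by linarith) (by linarith)
  rw [show γ - 1 - 1 = γ - 2 by ring,
    show σ n - σ k - (σ n - σ (k + 1)) = σ (k + 1) - σ k by ring] at s
  have p : 0 ≤ (σ n - σ k) ^ (γ - 2) := Real.rpow_nonneg (by linarith) _
  have q := hm.le_two_width k
  have r : γ * (1 - γ) / 4 * d k * (σ n - σ k) ^ (γ - 2) ≤
      γ * (1 - γ) / 4 * (2 * (σ (k + 1) - σ k)) * (σ n - σ k) ^ (γ - 2) := by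
    have : 0 ≤ γ * (1 - γ) / 4 := by
      have := mul_nonneg h0.le (sub_nonneg.2 h1.le); linarith
    gcongr
  have s' := mul_le_mul_of_nonneg_left s h0.le
  rw [lkerDiff]
  linarith

/-- By `lker_shift_le` each summand is at most `lker γ σ n k - lker γ σ (n + 1) k`. Column sums are
thus dominated by the diagonal, which gives positivity of the unweighted form. -/
theorem sum_lkerDiff_le (hm : StepMesh d σ) (h0 : 0 < γ) (h1 : γ < 1) {k N : ℕ} (h : k < N) :
    ∑ n ∈ Ico (k + 1) N, lkerDiff γ σ (n + 1) k ≤ lker γ σ (k + 1) k - lker γ σ N k := by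
  induction N, (show k + 1 ≤ N from h) using Nat.le_induction with
  | base => simp
  | succ N hN ih =>
    rw [sum_Ico_succ_top hN]
    have := ih hN
    have := hm.lker_shift_le h0 h1 (n := N) (k := k) hN
    rw [lkerDiff] at *
    linarith

/-- With growing weights a column sum can exceed its diagonal entry `(σ (k + 1) - σ k) ^ γ`, but
only up to the same power of the next width, and these excesses telescope over `k`. -/
theorem sum_width_mul_lkerDiff_le (hm : StepMesh d σ) (h0 : 0 < γ) (h1 : γ < 1) {k N : ℕ}
    (h : k < N) :
    ∑ n ∈ Ico (k + 1) N, (σ (n + 1) - σ n) * lkerDiff γ σ (n + 1) k ≤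
      (σ (k + 2) - σ (k + 1)) ^ γ -
        ((σ N - σ (k + 1) + (σ (k + 2) - σ (k + 1))) ^ γ - (σ N - σ (k + 1)) ^ γ) := by
  induction N, (show k + 1 ≤ N from h) using Nat.le_induction with
  | base => simp [Real.zero_rpow h0.ne']
  | succ N hN ih =>
    rw [sum_Ico_succ_top hN]
    have ih := ih hN
    have a1 := hm.width_pos k
    have a2 := hm.width_pos (k + 1)
    have a3 := hm.le_level hN
    have a4 := hm.width_mono k
    have a5 : σ (k + 2) - σ (k + 1) ≤ σ (N + 1) - σ N := by
      have : Monotone fun k => σ (k + 1) - σ k := monotone_nat_of_le_succ hm.width_mono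
      exact this hN
    have key := second_difference_le_telescope h0 h1 (η := σ (k + 2) - σ (k + 1))
      (h := σ (N + 1) - σ N) (d := σ (N + 1) - σ (k + 1)) a2 a5 (by linarith)
    rw [show σ (N + 1) - σ (k + 1) - (σ (N + 1) - σ N) = σ N - σ (k + 1) by ring] at key
    -- Replacing the width of cell `k` by the larger width of cell `k + 1` lowers the subtracted
    -- slope and leaves a second difference with equal increments.
    have c : lkerDiff γ σ (N + 1) k ≤
        ((σ (N + 1) - σ (k + 1)) ^ γ - (σ (N + 1) - σ (k + 1) - (σ (k + 2) - σ (k + 1))) ^ γ) /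
          (σ (k + 2) - σ (k + 1)) -
        ((σ (N + 1) - σ (k + 1) + (σ (k + 2) - σ (k + 1))) ^ γ - (σ (N + 1) - σ (k + 1)) ^ γ) /
          (σ (k + 2) - σ (k + 1)) := by
      rw [lkerDiff, lker, lker, show σ (N + 1) - σ (k + 1) - (σ (k + 2) - σ (k + 1)) =
        σ (N + 1) - σ (k + 1 + 1) by ring]
      have a6 := hm.width_pos N
      have := slope_antitone_of_concaveOn (rpow_concave h0 h1) (a := σ (N + 1) - σ (k + 1))
        (b := σ (N + 1) - σ k) (c := σ (N + 1) - σ (k + 1))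
        (d := σ (N + 1) - σ (k + 1) + (σ (k + 2) - σ (k + 1))) (by linarith)
        (by linarith) (by linarith) (by linarith) (by linarith)
      rw [add_sub_cancel_left,
        show σ (N + 1) - σ k - (σ (N + 1) - σ (k + 1)) = σ (k + 1) - σ k by ring] at this
      exact sub_le_sub_left this _
    have c' := mul_le_mul_of_nonneg_left c (hm.width_pos N).le
    linarith

end StepMesh

/-- Summation by parts pivoted at the last value: it exposes the differences `y (n + 1) - y (k +
1)`, which have a sign at a maximum and suit the quadratic form. -/
theorem sum_mul_sub_eq (a y : ℕ → ℝ) (n : ℕ) :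
    ∑ k ∈ range (n + 1), a k * (y (k + 1) - y k) =
      a 0 * (y (n + 1) - y 0) + ∑ k ∈ range n, (a (k + 1) - a k) * (y (n + 1) - y (k + 1)) := by
  induction n with
  | zero => simp
  | succ n ih =>
    have : ∑ k ∈ range (n + 1), (a (k + 1) - a k) * (y (n + 2) - y (k + 1)) =
        ∑ k ∈ range (n + 1), (a (k + 1) - a k) * (y (n + 1) - y (k + 1)) +
        (a (n + 1) - a 0) * (y (n + 2) - y (n + 1)) := by
      rw [← sum_range_sub, sum_mul, ← sum_add_distrib]
      exact sum_congr rfl fun k _ => by ring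
    rw [sum_range_succ, ih, this, sum_range_succ]
    ring

theorem lconv_succ (γ : ℝ) (σ y : ℕ → ℝ) (n : ℕ) :
    lconv γ σ y (n + 1) = lker γ σ (n + 1) 0 * (y (n + 1) - y 0) +
      ∑ k ∈ range n, lkerDiff γ σ (n + 1) k * (y (n + 1) - y (k + 1)) :=
  sum_mul_sub_eq _ _ _

theorem lker_first_add_sum (γ : ℝ) (σ : ℕ → ℝ) (n : ℕ) :
    lker γ σ (n + 1) 0 + ∑ k ∈ range n, lkerDiff γ σ (n + 1) k = lker γ σ (n + 1) n := by
  have := sum_range_sub (fun k => lker γ σ (n + 1) k) n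
  simp only [lkerDiff]
  rw [this]; ring

namespace StepMesh

variable {d σ : ℕ → ℝ} {γ : ℝ}

/-- Termwise `2 a (a - b) ≥ a ^ 2 - b ^ 2`, with the nonnegative kernel differences as weights. -/
theorem mul_lconv_ge (hm : StepMesh d σ) (h0 : 0 < γ) (h1 : γ < 1) {y : ℕ → ℝ} (hy : y 0 = 0)
    (n : ℕ) :
    (lker γ σ (n + 1) n * y (n + 1) ^ 2 -
      ∑ k ∈ range n, lkerDiff γ σ (n + 1) k * y (k + 1) ^ 2) / 2 ≤
      y (n + 1) * lconv γ σ y (n + 1) := by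
  rw [lconv_succ, ← lker_first_add_sum, hy, mul_add, mul_sum]
  have a := hm.lker_pos h0 (Nat.succ_pos n)
  have : ∑ k ∈ range n, (lkerDiff γ σ (n + 1) k * y (n + 1) ^ 2 -
      lkerDiff γ σ (n + 1) k * y (k + 1) ^ 2) / 2 ≤
      ∑ k ∈ range n, y (n + 1) * (lkerDiff γ σ (n + 1) k * (y (n + 1) - y (k + 1))) := by
    refine sum_le_sum fun k hk => ?_
    have := hm.lkerDiff_nonneg h0 h1 (n := n + 1) (k := k) (by simpa using hk)
    nlinarith [mul_nonneg this (sq_nonneg (y (n + 1) - y (k + 1)))]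
  rw [← sum_div, sum_sub_distrib, ← sum_mul] at this
  nlinarith [mul_nonneg a.le (sq_nonneg (y (n + 1)))]

/-- Positivity of the quadratic form of the kernel with weights `c`, up to the defects `s`. -/
theorem sum_weight_mul_lconv_ge (hm : StepMesh d σ) (h0 : 0 < γ) (h1 : γ < 1) {y : ℕ → ℝ}
    (hy : y 0 = 0) {c s : ℕ → ℝ} (hc : ∀ n, 0 ≤ c n) {N : ℕ}
    (hs : ∀ k < N, ∑ n ∈ Ico (k + 1) N, c n * lkerDiff γ σ (n + 1) k ≤
      c k * lker γ σ (k + 1) k + s k) :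
    -(∑ k ∈ range N, s k * y (k + 1) ^ 2) / 2 ≤
      ∑ n ∈ range N, c n * (y (n + 1) * lconv γ σ y (n + 1)) := by
  have e1 : ∑ n ∈ range N, ∑ k ∈ range n, c n * lkerDiff γ σ (n + 1) k * y (k + 1) ^ 2 =
      ∑ k ∈ range N, (∑ n ∈ Ico (k + 1) N, c n * lkerDiff γ σ (n + 1) k) * y (k + 1) ^ 2 := by
    simp_rw [sum_mul]
    refine sum_comm' fun n k => ?_
    simp only [mem_range, mem_Ico]
    lia
  calc _ ≤ ∑ n ∈ range N, c n * ((lker γ σ (n + 1) n * y (n + 1) ^ 2 -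
      ∑ k ∈ range n, lkerDiff γ σ (n + 1) k * y (k + 1) ^ 2) / 2) := by
        have e2 : ∑ n ∈ range N, c n * ((lker γ σ (n + 1) n * y (n + 1) ^ 2 -
            ∑ k ∈ range n, lkerDiff γ σ (n + 1) k * y (k + 1) ^ 2) / 2) =
            (∑ n ∈ range N, c n * lker γ σ (n + 1) n * y (n + 1) ^ 2 -
              ∑ n ∈ range N, ∑ k ∈ range n, c n * lkerDiff γ σ (n + 1) k * y (k + 1) ^ 2) / 2 := by
          rw [← sum_sub_distrib, sum_div]
          refine sum_congr rfl fun n _ => ?_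
          simp_rw [mul_assoc (c n), ← mul_sum]
          ring
        rw [e2, e1, ← sum_sub_distrib, ← sum_neg_distrib]
        gcongr with k hk
        have := mul_le_mul_of_nonneg_right (hs k (mem_range.1 hk)) (sq_nonneg (y (k + 1)))
        linarith
    _ ≤ _ := sum_le_sum fun n _ => mul_le_mul_of_nonneg_left (hm.mul_lconv_ge h0 h1 hy n) (hc n)

theorem sum_mul_lconv_nonneg (hm : StepMesh d σ) (h0 : 0 < γ) (h1 : γ < 1) {y : ℕ → ℝ}
    (hy : y 0 = 0) (N : ℕ) : 0 ≤ ∑ n ∈ range N, y (n + 1) * lconv γ σ y (n + 1) := by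
  have := hm.sum_weight_mul_lconv_ge h0 h1 hy (c := fun _ => 1) (s := fun _ => 0) (N := N)
    (fun _ => zero_le_one) (fun k hk => by
      have a := hm.sum_lkerDiff_le h0 h1 hk
      have b := hm.lker_pos h0 hk
      simpa using a.trans (by linarith))
  simpa using this

/-- With the widths as weights positivity fails, but the defect involves only the last width; it is
small for small steps, however long the time interval. -/
theorem sum_width_mul_lconv_ge (hm : StepMesh d σ) (h0 : 0 < γ) (h1 : γ < 1) {y : ℕ → ℝ}
    (hy : y 0 = 0) {N : ℕ} {Y : ℝ} (hY : ∀ n ≤ N, |y n| ≤ Y) :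
    -(Y ^ 2 * (σ (N + 1) - σ N) ^ γ) / 2 ≤
      ∑ n ∈ range (N + 1), (σ (n + 1) - σ n) * (y (n + 1) * lconv γ σ y (n + 1)) := by
  -- The excess of the column bound over the diagonal entry. The last column has no entries below
  -- the diagonal, so its defect is zero.
  let s : ℕ → ℝ := fun k => if k < N then (σ (k + 2) - σ (k + 1)) ^ γ - (σ (k + 1) - σ k) ^ γ else 0
  have key := hm.sum_weight_mul_lconv_ge h0 h1 hy (c := fun n => σ (n + 1) - σ n) (s := s)
    (N := N + 1) (fun n => (hm.width_pos n).le) (fun k hk => by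
      rw [hm.width_mul_lker_last h0]
      by_cases h : k < N
      · have a := hm.sum_width_mul_lkerDiff_le h0 h1 hk
        have b : (σ (N + 1) - σ (k + 1)) ^ γ ≤
            (σ (N + 1) - σ (k + 1) + (σ (k + 2) - σ (k + 1))) ^ γ := by
          have := hm.width_pos (k + 1)
          have := hm.le_level hk
          exact Real.rpow_le_rpow (by linarith) (by linarith) h0.le
        simp only [s, if_pos h]
        linarith
      · obtain rfl : k = N := by lia
        have := Real.rpow_nonneg (hm.width_pos k).le γ
        simpa [s] using this)
  refine le_trans ?_ key
  have : ∑ k ∈ range (N + 1), s k * y (k + 1) ^ 2 ≤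
      Y ^ 2 * ((σ (N + 1) - σ N) ^ γ - (σ 1 - σ 0) ^ γ) := by
    rw [sum_range_succ, ← sum_range_sub (fun k => (σ (k + 1) - σ k) ^ γ), mul_sum]
    have z : s N = 0 := by simp [s]
    rw [z, zero_mul, add_zero]
    refine sum_le_sum fun k hk => ?_
    have hk' := mem_range.1 hk
    simp only [s, if_pos hk']
    have : (σ (k + 1) - σ k) ^ γ ≤ (σ (k + 2) - σ (k + 1)) ^ γ :=
      Real.rpow_le_rpow (hm.width_pos k).le (hm.width_mono k) h0.le
    rw [mul_comm]
    exact mul_le_mul_of_nonneg_right (sq_le_sq' (by linarith [neg_abs_le (y (k + 1)), hY (k + 1) hk'])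
      ((le_abs_self _).trans (hY _ hk'))) (by linarith)
  have p : 0 ≤ Y ^ 2 * (σ 1 - σ 0) ^ γ :=
    mul_nonneg (sq_nonneg _) (Real.rpow_nonneg (hm.width_pos 0).le _)
  linarith

end StepMesh

end

/-! ### Stability of a single mode, uniformly over all meshes with nondecreasing steps. -/

section

/-- One mode of the order-reduction scheme, normalised to frequency one, with forcing `ρ` of total
size at most `F`, up to the level `N`. -/
structure ModeScheme (γ : ℝ) (d σ e y ρ : ℕ → ℝ) (N : ℕ) (F : ℝ) : Prop where
  e_zero : e 0 = 0
  y_zero : y 0 = 0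
  step : ∀ n < N, e (n + 1) - e n = d n * (y (n + 1) + ρ n)
  conv : ∀ n < N, lconv γ σ y (n + 1) = -((e (n + 1) + e n) / 2)
  forcing : ∑ n ∈ range N, d n * |ρ n| ≤ F

theorem lconv_neg (γ : ℝ) (σ y : ℕ → ℝ) (n : ℕ) : lconv γ σ (-y) n = -lconv γ σ y n := by
  simp only [lconv, ← sum_neg_distrib, Pi.neg_apply]
  exact sum_congr rfl fun k _ => by ring

/-- A bound on the velocity in terms of a bound on the error. -/
noncomputable def velocityConst (γ : ℝ) : ℝ := 28 + 1 / γ + 16 / (γ * (1 - γ))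

theorem velocityConst_pos {γ : ℝ} (h0 : 0 < γ) (h1 : γ < 1) : 0 < velocityConst γ := by
  have : 0 < γ * (1 - γ) := mul_pos h0 (sub_pos.2 h1)
  unfold velocityConst; positivity

/-- Absorption of a quadratic term at the maximum of a finite sequence. -/
theorem abs_le_of_sq_le_absorb {e : ℕ → ℝ} {p N : ℕ} {B₀ a : ℝ} (ha : 0 ≤ a) (hB₀ : 0 ≤ B₀)
    (h0 : ∀ k ≤ p, |e k| ≤ B₀)
    (h : ∀ m, p < m → m ≤ N → ∀ B, B₀ ≤ B → (∀ k ≤ m, |e k| ≤ B) →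
      e m ^ 2 ≤ a * B₀ * B + B ^ 2 / 2) :
    ∀ k ≤ N, |e k| ≤ (2 * a + 1) * B₀ := by
  obtain ⟨m, hm, hmax⟩ := exists_max_image (range (N + 1)) (fun k => |e k|) ⟨0, by simp⟩
  have hm' : m ≤ N := by simpa [Nat.lt_succ_iff] using hm
  have hmax' : ∀ k ≤ N, |e k| ≤ |e m| := fun k hk => hmax k (by simpa [Nat.lt_succ_iff] using hk)
  have haB : 0 ≤ a * B₀ := mul_nonneg ha hB₀
  have key : |e m| ≤ (2 * a + 1) * B₀ := by
    rcases le_or_gt m p with hp | hp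
    · linarith [h0 m hp]
    rcases le_or_gt |e m| B₀ with hb | hb
    · linarith
    -- At the maximiser `B = |e m|` is admissible; half of the square is absorbed on the left and
    -- one factor `|e m|` cancels.
    have := h m hp hm' |e m| hb.le fun k hk => hmax' k (hk.trans hm')
    rw [← sq_abs] at this
    nlinarith
  exact fun k hk => (hmax' k hk).trans key

/-- Summation by parts against a nonincreasing weight. -/
theorem sum_sub_mul_le {e b : ℕ → ℝ} {p N : ℕ} {B : ℝ} (hpN : p ≤ N)
    (he : ∀ k, p ≤ k → k ≤ N → |e k| ≤ B) (hb0 : ∀ m, p ≤ m → 0 ≤ b m)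
    (hb : ∀ m, p ≤ m → b (m + 1) ≤ b m) :
    ∑ m ∈ Ico p N, (e (m + 1) - e m) * b m ≤ 2 * B * b p := by
  have key : ∀ M, p ≤ M → M ≤ N → ∑ m ∈ Ico p M, (e (m + 1) - e m) * b m ≤
      (e M + B) * b M + 2 * B * (b p - b M) := by
    intro M hM
    induction M, hM using Nat.le_induction with
    | base =>
      intro h
      have := neg_le_of_abs_le (he p le_rfl h)
      have := mul_nonneg (show 0 ≤ e p + B by linarith) (hb0 p le_rfl)
      simpa using this
    | succ M hM ih =>
      intro h
      rw [sum_Ico_succ_top hM]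
      have := ih (by lia)
      have a1 := le_of_abs_le (he (M + 1) (by lia) h)
      nlinarith [mul_nonneg (show 0 ≤ B - e (M + 1) by linarith) (sub_nonneg.2 (hb M hM))]
  have a := key N hpN le_rfl
  have a1 := le_of_abs_le (he N hpN le_rfl)
  nlinarith [mul_nonneg (show 0 ≤ B - e N by linarith) (hb0 N hpN)]

theorem abs_sum_sub_mul_le {e b : ℕ → ℝ} {p N : ℕ} {B : ℝ} (hpN : p ≤ N)
    (he : ∀ k, p ≤ k → k ≤ N → |e k| ≤ B) (hb0 : ∀ m, p ≤ m → 0 ≤ b m)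
    (hb : ∀ m, p ≤ m → b (m + 1) ≤ b m) :
    |∑ m ∈ Ico p N, (e (m + 1) - e m) * b m| ≤ 2 * B * b p := by
  refine abs_le.2 ⟨?_, sum_sub_mul_le hpN he hb0 hb⟩
  have := sum_sub_mul_le (e := -e) hpN (fun k h1 h2 => by simpa using he k h1 h2) hb0 hb
  have e1 : ∑ m ∈ Ico p N, ((-e) (m + 1) - (-e) m) * b m =
      -∑ m ∈ Ico p N, (e (m + 1) - e m) * b m := by
    rw [← sum_neg_distrib]
    exact sum_congr rfl fun k _ => by simp; ring
  linarith

/-- Summation by parts against the reciprocals of nondecreasing steps. -/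
theorem le_sum_sub_div {u d : ℕ → ℝ} {p M : ℕ} (hpM : p ≤ M) (hu : ∀ k, 0 ≤ u k)
    (hd0 : ∀ k, 0 < d k) (hd : ∀ k, d k ≤ d (k + 1)) :
    u (M + 1) / d M - u p / d p ≤ ∑ n ∈ Ico p (M + 1), (u (n + 1) - u n) / d n := by
  have key : ∀ M, p ≤ M → u M / d M - u p / d p ≤ ∑ n ∈ Ico p M, (u (n + 1) - u n) / d n := by
    intro M hM
    induction M, hM using Nat.le_induction with
    | base => simp
    | succ M hM ih =>
      rw [sum_Ico_succ_top hM, sub_div]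
      have := div_le_div_of_nonneg_left (hu (M + 1)) (hd0 M) (hd M)
      linarith
  rw [sum_Ico_succ_top hpM, sub_div]
  linarith [key M hpM]

/-- Weighted sums of a sequence whose tail sums are bounded below. -/
theorem sum_step_mul_ge {x d : ℕ → ℝ} {γ K : ℝ} (h1 : γ < 1) (hK : 0 ≤ K) (hd0 : ∀ k, 0 < d k)
    (hd : ∀ k, d k ≤ d (k + 1)) {m p : ℕ} (hpm : p ≤ m)
    (hT : ∀ n, p ≤ n → n < m → -(K * d n ^ (γ - 2)) ≤ ∑ k ∈ Ico n m, x k) :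
    -(K * (1 + 1 / (1 - γ)) * d p ^ (γ - 1)) ≤ ∑ n ∈ Ico p m, d n * x n := by
  have hT' : ∀ n, p ≤ n → n ≤ m → -(K * d n ^ (γ - 2)) ≤ ∑ k ∈ Ico n m, x k := by
    intro n h2 h3
    rcases h3.lt_or_eq with h | rfl
    · exact hT n h2 h
    · have := mul_nonneg hK (Real.rpow_nonneg (hd0 n).le (γ - 2))
      simpa using this
  -- Backward induction for Abel summation: the bracket changes by `d (n + 1) - d n` times the tail
  -- from `n + 1`, and convexity bounds `(d (n + 1) - d n) * d (n + 1) ^ (γ - 2)` by a telescoping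
  -- difference of `d ^ (γ - 1) / (1 - γ)`.
  have key : ∀ j n, n + j = m → p ≤ n → -(K / (1 - γ) * d n ^ (γ - 1)) ≤
      ∑ k ∈ Ico n m, d k * x k - d n * ∑ k ∈ Ico n m, x k := by
    intro j
    induction j with
    | zero =>
      intro n hn _
      obtain rfl : n = m := by lia
      have := mul_nonneg (div_nonneg hK (sub_pos.2 h1).le) (Real.rpow_nonneg (hd0 n).le (γ - 1))
      simpa using this
    | succ j ih =>
      intro n hn hpn
      have a := ih (n + 1) (by lia) (by lia)
      have t := hT' (n + 1) (by lia) (by lia)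
      rw [sum_eq_sum_Ico_succ_bot (show n < m by lia), sum_eq_sum_Ico_succ_bot (show n < m by lia)]
      have c := rpow_neg_sub_le (show γ - 1 < 0 by linarith) (hd0 n) (hd n)
      rw [show γ - 1 - 1 = γ - 2 by ring] at c
      have t' := mul_le_mul_of_nonneg_left t (sub_nonneg.2 (hd n))
      have c' := mul_le_mul_of_nonneg_left c (div_nonneg hK (sub_pos.2 h1).le)
      have e : K / (1 - γ) * (-(γ - 1) * d (n + 1) ^ (γ - 2) * (d (n + 1) - d n)) =
          K * d (n + 1) ^ (γ - 2) * (d (n + 1) - d n) := by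
        have : 1 - γ ≠ 0 := (sub_pos.2 h1).ne'
        field_simp
        ring
      rw [e] at c'
      linarith
  have a := key (m - p) p (by lia) le_rfl
  have t := mul_le_mul_of_nonneg_left (hT' p le_rfl hpm) (hd0 p).le
  have e : d p * d p ^ (γ - 2) = d p ^ (γ - 1) := by
    rw [show γ - 1 = 1 + (γ - 2) by ring, Real.rpow_add (hd0 p), Real.rpow_one]
  have e2 : d p * -(K * d p ^ (γ - 2)) = -(K * d p ^ (γ - 1)) := by rw [← e]; ring
  rw [e2] at t
  have e3 : K * (1 + 1 / (1 - γ)) * d p ^ (γ - 1) =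
      K * d p ^ (γ - 1) + K / (1 - γ) * d p ^ (γ - 1) := by ring
  linarith

/-- The steps below a threshold form an initial segment. -/
theorem exists_threshold {d : ℕ → ℝ} (hd : Monotone d) (δ : ℝ) (N : ℕ) :
    ∃ p ≤ N, (∀ n < p, d n ≤ δ) ∧ ∀ n, p ≤ n → n < N → δ < d n := by
  classical
  by_cases h : ∃ n, n < N ∧ δ < d n
  · refine ⟨Nat.find h, (Nat.find_spec h).1.le, fun n hn => ?_, fun n hn _ => ?_⟩
    · have := Nat.find_min h hn
      push Not at this
      exact this (hn.trans (Nat.find_spec h).1)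
    · exact (Nat.find_spec h).2.trans_le (hd hn)
  · push Not at h
    exact ⟨N, le_rfl, h, fun n h1 h2 => absurd h2 (by lia)⟩

namespace ModeScheme

variable {γ : ℝ} {d σ e y ρ : ℕ → ℝ} {N : ℕ} {F B : ℝ}

theorem neg (hs : ModeScheme γ d σ e y ρ N F) : ModeScheme γ d σ (-e) (-y) (-ρ) N F where
  e_zero := by simp [hs.e_zero]
  y_zero := by simp [hs.y_zero]
  step n hn := by have := hs.step n hn; simp; linarith
  conv n hn := by rw [lconv_neg, hs.conv n hn]; simp; ring
  forcing := by simpa using hs.forcing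

theorem restrict (hm : StepMesh d σ) (hs : ModeScheme γ d σ e y ρ N F) {m : ℕ} (hmN : m ≤ N) :
    ModeScheme γ d σ e y ρ m F where
  e_zero := hs.e_zero
  y_zero := hs.y_zero
  step n hn := hs.step n (by lia)
  conv n hn := hs.conv n (by lia)
  forcing := le_trans (sum_le_sum_of_subset_of_nonneg (range_mono hmN)
    fun i _ _ => mul_nonneg (hm.pos i).le (abs_nonneg _)) hs.forcing

theorem forcing_nonneg (hm : StepMesh d σ) (hs : ModeScheme γ d σ e y ρ N F) : 0 ≤ F :=
  (sum_nonneg fun i _ => mul_nonneg (hm.pos i).le (abs_nonneg _)).trans hs.forcing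

theorem sum_forcing_le (hm : StepMesh d σ) (hs : ModeScheme γ d σ e y ρ N F) (p : ℕ) :
    ∑ n ∈ Ico p N, d n * |ρ n| ≤ F :=
  (sum_le_sum_of_subset_of_nonneg (fun i hi => by simp at hi ⊢; lia)
    fun i _ _ => mul_nonneg (hm.pos i).le (abs_nonneg _)).trans hs.forcing

theorem step_mul_forcing_le (hm : StepMesh d σ) (hs : ModeScheme γ d σ e y ρ N F) {n : ℕ}
    (hn : n < N) : d n * |ρ n| ≤ F :=
  (single_le_sum (f := fun n => d n * |ρ n|)
    (fun i _ => mul_nonneg (hm.pos i).le (abs_nonneg _)) (mem_range.2 hn)).trans hs.forcing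

theorem abs_velocity_le_div (hm : StepMesh d σ) (hs : ModeScheme γ d σ e y ρ N F) {n : ℕ}
    (hn : n < N) (hF : F ≤ B) (he : ∀ k ≤ n + 1, |e k| ≤ B) : d n * |y (n + 1)| ≤ 3 * B := by
  have h1 := hs.step n hn
  have h2 := hs.step_mul_forcing_le hm hn
  have a1 := he (n + 1) le_rfl
  have a2 := he n (by lia)
  have hd := hm.pos n
  rw [← abs_of_pos hd, ← abs_mul] at h2 ⊢
  rw [show d n * y (n + 1) = e (n + 1) - e n - d n * ρ n by linarith]
  rw [abs_le] at *
  constructor <;> linarith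

/-- The sum is an increment of `e` minus forcing: two values of `e` and one `F` give the factor 3.
-/
theorem abs_sum_velocity_le (hm : StepMesh d σ) (hs : ModeScheme γ d σ e y ρ N F) {l n : ℕ}
    (hl : l ≤ n) (hn : n ≤ N) (hF : F ≤ B) (he : ∀ k ≤ n, |e k| ≤ B) :
    |∑ k ∈ Ico l n, d k * y (k + 1)| ≤ 3 * B := by
  have e1 : ∑ k ∈ Ico l n, d k * y (k + 1) = e n - e l - ∑ k ∈ Ico l n, d k * ρ k := by
    rw [← sum_Ico_sub e hl, ← sum_sub_distrib]
    refine sum_congr rfl fun k hk => ?_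
    rw [mem_Ico] at hk
    have := hs.step k (by lia)
    linarith
  have a : |∑ k ∈ Ico l n, d k * ρ k| ≤ F := by
    refine (abs_sum_le_sum_abs _ _).trans ?_
    simp_rw [abs_mul, abs_of_pos (hm.pos _)]
    exact (hs.restrict hm hn).sum_forcing_le hm l
  have a1 := he n le_rfl
  have a2 := he l hl
  rw [e1]
  rw [abs_le] at *
  constructor <;> linarith

/-- A discrete maximum principle. At a maximum of `y` all terms of `lconv` are nonnegative while the
total is at most `B`. If the step is not small, the difference quotient already bounds `y`; if
little time has passed, the first kernel value is bounded below; otherwise the kernel differences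
over a unit window compare `y (n + 1)` with a mean of the velocity, which is an increment of `e` up
to forcing. -/
theorem velocity_le_of_max (hm : StepMesh d σ) (h0 : 0 < γ) (h1 : γ < 1)
    (hs : ModeScheme γ d σ e y ρ N F) {n : ℕ} (hn : n < N) (hF : F ≤ B)
    (he : ∀ k ≤ n + 1, |e k| ≤ B) (hy0 : 0 ≤ y (n + 1)) (hy : ∀ k ≤ n + 1, y k ≤ y (n + 1)) :
    y (n + 1) ≤ velocityConst γ * B := by
  have hB : 0 ≤ B := (hs.forcing_nonneg hm).trans hF
  have hg : 0 < γ * (1 - γ) := mul_pos h0 (sub_pos.2 h1)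
  have hsplit : velocityConst γ * B = 28 * B + B / γ + 16 * B / (γ * (1 - γ)) := by
    unfold velocityConst; ring
  have p1 : 0 ≤ B / γ := by positivity
  have p2 : 0 ≤ 16 * B / (γ * (1 - γ)) := by positivity
  rw [hsplit]
  -- For `d n > 1 / 8` the bound `d n * |y| ≤ 3 * B` gives `y ≤ 24 * B`.
  rcases le_or_gt (d n) (1 / 8) with hd | hd
  swap
  · have := hs.abs_velocity_le_div hm hn hF he
    rw [abs_of_nonneg hy0] at this
    nlinarith
  have hc : lconv γ σ y (n + 1) ≤ B := by
    rw [hs.conv n hn]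
    have a1 := he (n + 1) le_rfl
    have a2 := he n (by lia)
    rw [abs_le] at a1 a2
    linarith
  rw [lconv_succ, hs.y_zero, sub_zero] at hc
  have hterm : ∀ k ∈ range n, 0 ≤ lkerDiff γ σ (n + 1) k * (y (n + 1) - y (k + 1)) := by
    intro k hk
    rw [mem_range] at hk
    exact mul_nonneg (hm.lkerDiff_nonneg h0 h1 (by lia)) (sub_nonneg.2 (hy _ (by lia)))
  rcases le_or_gt (σ (n + 1)) 1 with hσ | hσ
  · have a1 := hm.lker_lower h0 h1 (Nat.succ_pos n)
    have a2 : (1 : ℝ) ≤ (σ (n + 1) - σ 0) ^ (γ - 1) := by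
      have := hm.strictMono (Nat.succ_pos n)
      refine Real.one_le_rpow_of_pos_of_le_one_of_nonpos (by linarith) ?_ (by linarith)
      rw [hm.zero]; linarith
    have a3 := sum_nonneg hterm
    have a4 : γ * y (n + 1) ≤ lker γ σ (n + 1) 0 * y (n + 1) :=
      mul_le_mul_of_nonneg_right (by nlinarith) hy0
    have : y (n + 1) ≤ B / γ := by rw [le_div_iff₀ h0]; linarith
    linarith
  · classical
    -- The first half level within unit distance of the current one opens the window on which
    -- `lkerDiff` is at least a constant times `d k`.
    have hex : ∃ l, σ (n + 1) - σ l ≤ 1 := ⟨n + 1, by simp⟩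
    obtain ⟨l', hl'⟩ : ∃ l', Nat.find hex = l' + 1 := by
      refine Nat.exists_eq_succ_of_ne_zero fun h => ?_
      have := Nat.find_spec hex
      rw [h, hm.zero] at this
      linarith
    have s1 : σ (n + 1) - σ (l' + 1) ≤ 1 := hl' ▸ Nat.find_spec hex
    have s2 : 1 < σ (n + 1) - σ l' := not_le.1 (Nat.find_min hex (by lia))
    have hl'n : l' < n := by
      by_contra hc
      have := hm.le_level (not_lt.1 hc)
      have := hm.width_le n
      linarith
    have hdl : d l' ≤ 1 / 8 := (hm.monotone_step hl'n.le).trans hd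
    -- The window loses at most `1 / 8` to the cell that crosses unit distance, and half a step of
    -- at most `1 / 8` at each end in passing from half levels to sums of steps.
    have hlen : 3 / 4 ≤ ∑ k ∈ Ico (l' + 1) n, d k := by
      have b1 := hm.succ n
      have b2 := hm.succ l'
      have b3 := sum_range_add_sum_Ico d (show l' + 1 ≤ n from hl'n)
      rw [sum_range_succ] at b3
      have b4 := hm.width_le l'
      linarith
    set c := γ * (1 - γ) / 4 with hcdef
    have hcpos : 0 < c := by positivity
    have hw : ∑ k ∈ Ico (l' + 1) n, c * (d k * (y (n + 1) - y (k + 1))) ≤ B := by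
      have h2 : ∑ k ∈ Ico (l' + 1) n, c * (d k * (y (n + 1) - y (k + 1))) ≤
          ∑ k ∈ Ico (l' + 1) n, lkerDiff γ σ (n + 1) k * (y (n + 1) - y (k + 1)) := by
        refine sum_le_sum fun k hk => ?_
        rw [mem_Ico] at hk
        rw [← mul_assoc]
        refine mul_le_mul_of_nonneg_right ?_ (sub_nonneg.2 (hy _ (by lia)))
        have b1 := hm.lkerDiff_lower h0 h1 (n := n + 1) (k := k) (by lia)
        have b2 : (1 : ℝ) ≤ (σ (n + 1) - σ k) ^ (γ - 2) := by
          have := hm.strictMono (show k < n + 1 by lia)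
          refine Real.one_le_rpow_of_pos_of_le_one_of_nonpos (by linarith) ?_ (by linarith)
          linarith [hm.le_level hk.1]
        exact (le_mul_of_one_le_right (mul_nonneg hcpos.le (hm.pos k).le) b2).trans b1
      have h3 : ∑ k ∈ Ico (l' + 1) n, lkerDiff γ σ (n + 1) k * (y (n + 1) - y (k + 1)) ≤
          ∑ k ∈ range n, lkerDiff γ σ (n + 1) k * (y (n + 1) - y (k + 1)) :=
        sum_le_sum_of_subset_of_nonneg (fun i hi => by simp at hi ⊢; lia)
          fun i hi _ => hterm i hi
      have h4 := mul_nonneg (hm.lker_pos h0 (Nat.succ_pos n)).le hy0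
      linarith
    have hv := le_of_abs_le (hs.abs_sum_velocity_le hm (show l' + 1 ≤ n from hl'n) hn.le hF
      fun k hk => he k (by lia))
    have e1 : ∑ k ∈ Ico (l' + 1) n, c * (d k * (y (n + 1) - y (k + 1))) =
        c * (y (n + 1) * ∑ k ∈ Ico (l' + 1) n, d k - ∑ k ∈ Ico (l' + 1) n, d k * y (k + 1)) := by
      rw [← mul_sum, mul_sum _ _ (y (n + 1)), ← sum_sub_distrib]
      congr 1
      exact sum_congr rfl fun k _ => by ring
    rw [e1] at hw
    have f1 := mul_le_mul_of_nonneg_left hlen hy0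
    have f2 : c * (y (n + 1) * (3 / 4) - 3 * B) ≤ B := by
      refine le_trans (mul_le_mul_of_nonneg_left ?_ hcpos.le) hw
      linarith
    have f3 : y (n + 1) * (3 / 4) - 3 * B ≤ B / c := by
      rw [le_div_iff₀ hcpos]; linarith
    have f4 : B / c = 4 * B / (γ * (1 - γ)) := by
      rw [hcdef]; field_simp
    have f5 : 16 * B / (γ * (1 - γ)) = 4 * (4 * B / (γ * (1 - γ))) := by ring
    have f6 : 0 ≤ 4 * B / (γ * (1 - γ)) := by positivity
    linarith

theorem abs_velocity_le (hm : StepMesh d σ) (h0 : 0 < γ) (h1 : γ < 1)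
    (hs : ModeScheme γ d σ e y ρ N F) {m : ℕ} (hmN : m ≤ N) (hF : F ≤ B)
    (he : ∀ k ≤ m, |e k| ≤ B) : ∀ k ≤ m, |y k| ≤ velocityConst γ * B := by
  have hB : 0 ≤ B := (hs.forcing_nonneg hm).trans hF
  obtain ⟨n, hn, hmax⟩ := exists_max_image (range (m + 1)) (fun k => |y k|) ⟨0, by simp⟩
  have hn' : n ≤ m := by simpa [Nat.lt_succ_iff] using hn
  have hmax' : ∀ k ≤ m, |y k| ≤ |y n| := fun k hk => hmax k (by simpa [Nat.lt_succ_iff] using hk)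
  suffices |y n| ≤ velocityConst γ * B from fun k hk => (hmax' k hk).trans this
  cases n with
  | zero =>
    rw [hs.y_zero, abs_zero]
    exact mul_nonneg (velocityConst_pos h0 h1).le hB
  | succ n =>
    rcases le_total 0 (y (n + 1)) with h | h
    · have := hs.velocity_le_of_max hm h0 h1 (n := n) (by lia) hF (fun k hk => he k (by lia)) h
        fun k hk => (le_abs_self _).trans ((hmax' k (by lia)).trans (abs_of_nonneg h).le)
      rwa [abs_of_nonneg h]
    · have := hs.neg.velocity_le_of_max hm h0 h1 (n := n) (by lia) hF
        (fun k hk => by simpa using he k (by lia)) (by simpa using h)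
        fun k hk => (neg_le_abs _).trans ((hmax' k (by lia)).trans (abs_of_nonpos h).le)
      rwa [abs_of_nonpos h]

/-- The energy identity over a block of steps. -/
theorem sq_sub_sq (hs : ModeScheme γ d σ e y ρ N F) {p m : ℕ} (hp : p ≤ m) (hmN : m ≤ N) :
    e m ^ 2 - e p ^ 2 = 2 * ∑ n ∈ Ico p m, d n * (ρ n * ((e (n + 1) + e n) / 2)) -
      2 * ∑ n ∈ Ico p m, d n * (y (n + 1) * lconv γ σ y (n + 1)) := by
  rw [← sum_Ico_sub (fun n => e n ^ 2) hp, ← mul_sub, ← sum_sub_distrib, mul_sum]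
  refine sum_congr rfl fun n hn => ?_
  rw [mem_Ico] at hn
  rw [hs.conv n (by lia)]
  have := hs.step n (by lia)
  linear_combination (e (n + 1) + e n) * this

theorem abs_mid_le {n : ℕ} (a1 : |e (n + 1)| ≤ B) (a2 : |e n| ≤ B) :
    |(e (n + 1) + e n) / 2| ≤ B := by
  rw [abs_le] at *
  constructor <;> linarith

theorem sum_forcing_mul_le (hm : StepMesh d σ) (hs : ModeScheme γ d σ e y ρ N F) {p : ℕ}
    (hF : F ≤ B) (he : ∀ k ≤ N, |e k| ≤ B) :
    ∑ n ∈ Ico p N, d n * (ρ n * ((e (n + 1) + e n) / 2)) ≤ F * B := by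
  have hB : 0 ≤ B := (hs.forcing_nonneg hm).trans hF
  refine le_trans ?_ (mul_le_mul_of_nonneg_right (hs.sum_forcing_le hm p) hB)
  rw [sum_mul]
  refine sum_le_sum fun n hn => ?_
  rw [mem_Ico] at hn
  have a := abs_mid_le (he (n + 1) (by lia)) (he n (by lia))
  rw [mul_assoc]
  refine mul_le_mul_of_nonneg_left ?_ (hm.pos n).le
  refine (le_abs_self _).trans ?_
  rw [abs_mul]
  exact mul_le_mul_of_nonneg_left a (abs_nonneg _)

/-- Small steps: the defect of positivity is small. -/
theorem sq_le_small (hm : StepMesh d σ) (h0 : 0 < γ) (h1 : γ < 1) {M : ℕ}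
    (hs : ModeScheme γ d σ e y ρ (M + 1) F) {δ : ℝ} (hd : d M ≤ δ) (hF : F ≤ B)
    (he : ∀ k ≤ M + 1, |e k| ≤ B) :
    e (M + 1) ^ 2 ≤ 2 * F * B +
      (velocityConst γ * δ + velocityConst γ ^ 2 * δ ^ γ) * B ^ 2 := by
  have hB : 0 ≤ B := (hs.forcing_nonneg hm).trans hF
  have hC := (velocityConst_pos h0 h1).le
  have hY := hs.abs_velocity_le hm h0 h1 le_rfl hF he
  have en := hs.sq_sub_sq (Nat.zero_le _) le_rfl
  rw [hs.e_zero, Nat.Ico_zero_eq_range] at en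
  have f := hs.sum_forcing_mul_le hm (p := 0) hF he
  rw [Nat.Ico_zero_eq_range] at f
  have w := hm.sum_width_mul_lconv_ge h0 h1 hs.y_zero (N := M) (Y := velocityConst γ * B)
    fun n hn => hY n (by lia)
  -- The energy identity carries the weights `d n`, the positivity estimate the widths. They differ
  -- by `(d n - d (n - 1)) / 2`, or by `d 0 / 2` in the first cell, so the total is half the last
  -- step.
  have tel : ∀ m, ∑ n ∈ range (m + 1), (d n - (σ (n + 1) - σ n)) = d m / 2 := by
    intro m
    induction m with
    | zero => simp [hm.width_zero]; ring
    | succ m ih => rw [sum_range_succ, ih, hm.width_succ]; ring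
  have r : -(velocityConst γ * B * B * (d M / 2)) ≤
      ∑ n ∈ range (M + 1), (d n - (σ (n + 1) - σ n)) * (y (n + 1) * lconv γ σ y (n + 1)) := by
    rw [← tel M, mul_sum, ← sum_neg_distrib]
    refine sum_le_sum fun n hn => ?_
    rw [mem_range] at hn
    have h2 : |y (n + 1) * lconv γ σ y (n + 1)| ≤ velocityConst γ * B * B := by
      rw [abs_mul, hs.conv n hn, abs_neg]
      exact mul_le_mul (hY _ (by lia)) (abs_mid_le (he (n + 1) (by lia)) (he n (by lia)))
        (abs_nonneg _) (mul_nonneg hC hB)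
    have h3 := sub_nonneg.2 (hm.width_le n)
    have := mul_le_mul_of_nonneg_left (neg_le_of_abs_le h2) h3
    linarith
  have split : ∑ n ∈ range (M + 1), d n * (y (n + 1) * lconv γ σ y (n + 1)) =
      ∑ n ∈ range (M + 1), (σ (n + 1) - σ n) * (y (n + 1) * lconv γ σ y (n + 1)) +
      ∑ n ∈ range (M + 1), (d n - (σ (n + 1) - σ n)) * (y (n + 1) * lconv γ σ y (n + 1)) := by
    rw [← sum_add_distrib]
    exact sum_congr rfl fun n _ => by ring
  have g1 : (σ (M + 1) - σ M) ^ γ ≤ δ ^ γ :=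
    Real.rpow_le_rpow (hm.width_pos M).le ((hm.width_le M).trans hd) h0.le
  have g2 := mul_le_mul_of_nonneg_left g1 (sq_nonneg (velocityConst γ * B))
  have g3 := mul_le_mul_of_nonneg_left hd (mul_nonneg (mul_nonneg hC hB) hB)
  rw [split] at en
  nlinarith

/-- The history before level `p` acts on later steps like a bounded perturbation. -/
theorem tail_ge (hm : StepMesh d σ) (h0 : 0 < γ) (h1 : γ < 1)
    (hs : ModeScheme γ d σ e y ρ N F) {p : ℕ} (hp : p < N) (hF : F ≤ B)
    (he : ∀ k ≤ N, |e k| ≤ B) {Y : ℝ} (hY : ∀ k ≤ p, |y k| ≤ Y) :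
    -(6 * B * Y * d p ^ (γ - 2)) ≤ ∑ m ∈ Ico p N, y (m + 1) * lconv γ σ y (m + 1) := by
  have hB : 0 ≤ B := (hs.forcing_nonneg hm).trans hF
  have hY0 : 0 ≤ Y := (abs_nonneg _).trans (hY 0 (Nat.zero_le _))
  -- The velocity with its history erased. The unweighted form is nonnegative on it, and the erased
  -- part enters only through the kernel differences of the first `p` columns.
  let yl : ℕ → ℝ := fun k => if k ≤ p then 0 else y k
  have hdec : ∀ m ∈ Ico p N, y (m + 1) * lconv γ σ y (m + 1) =
      yl (m + 1) * lconv γ σ yl (m + 1) -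
        ∑ k ∈ range p, y (k + 1) * (y (m + 1) * lkerDiff γ σ (m + 1) k) := by
    intro m hmem
    rw [mem_Ico] at hmem
    have e0 : yl (m + 1) = y (m + 1) := by simp only [yl]; rw [if_neg (by lia)]
    have e1 : yl 0 = 0 := by simp [yl]
    have e2 : ∑ k ∈ range m, lkerDiff γ σ (m + 1) k * (y (m + 1) - y (k + 1)) =
        ∑ k ∈ range m, lkerDiff γ σ (m + 1) k * (y (m + 1) - yl (k + 1)) -
          ∑ k ∈ range p, lkerDiff γ σ (m + 1) k * y (k + 1) := by
      have e3 : ∑ k ∈ range p, lkerDiff γ σ (m + 1) k * y (k + 1) =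
          ∑ k ∈ range m, lkerDiff γ σ (m + 1) k * (if k < p then y (k + 1) else 0) := by
        rw [← sum_subset (range_mono hmem.1)]
        · exact sum_congr rfl fun k hk => by rw [if_pos (mem_range.1 hk)]
        · intro k _ hk
          rw [if_neg (by simpa using hk), mul_zero]
      rw [e3, ← sum_sub_distrib]
      refine sum_congr rfl fun k _ => ?_
      by_cases hk : k < p
      · simp [yl, hk, Nat.succ_le_of_lt hk]; ring
      · simp [yl, hk, show ¬ k + 1 ≤ p by lia]
    rw [lconv_succ, lconv_succ, e0, e1, hs.y_zero, e2]
    simp_rw [mul_left_comm (y (_ + 1)) (y (m + 1)), ← mul_sum, mul_comm (y (_ + 1))]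
    ring
  rw [sum_congr rfl hdec, sum_sub_distrib]
  have hloc : 0 ≤ ∑ m ∈ Ico p N, yl (m + 1) * lconv γ σ yl (m + 1) := by
    have := hm.sum_mul_lconv_nonneg h0 h1 (y := yl) (by simp [yl]) N
    rw [← sum_range_add_sum_Ico _ hp.le] at this
    have z : ∑ m ∈ range p, yl (m + 1) * lconv γ σ yl (m + 1) = 0 := by
      refine sum_eq_zero fun m hmem => ?_
      rw [mem_range] at hmem
      simp [yl, Nat.succ_le_of_lt hmem]
    linarith
  have hinner : ∀ k ∈ range p, |∑ m ∈ Ico p N, y (m + 1) * lkerDiff γ σ (m + 1) k| ≤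
      3 * B * (lkerDiff γ σ (p + 1) k / d p) := by
    intro k hk
    rw [mem_range] at hk
    -- Since `y (m + 1)` is `(e (m + 1) - e m) / d m - ρ m`, summing it against `lkerDiff` is Abel
    -- summation against this weight, nonincreasing because `lkerDiff` decreases in `m` and the
    -- steps grow.
    let b : ℕ → ℝ := fun m => lkerDiff γ σ (m + 1) k / d m
    have hb0 : ∀ m, p ≤ m → 0 ≤ b m := fun m hpm =>
      div_nonneg (hm.lkerDiff_nonneg h0 h1 (by lia)) (hm.pos m).le
    have hb : ∀ m, p ≤ m → b (m + 1) ≤ b m := fun m hpm =>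
      div_le_div₀ (hm.lkerDiff_nonneg h0 h1 (by lia)) (hm.lkerDiff_succ_le h0 h1 (by lia))
        (hm.pos m) (hm.mono m)
    have hbp : ∀ m, p ≤ m → b m ≤ b p := by
      intro m hpm
      induction m, hpm using Nat.le_induction with
      | base => exact le_rfl
      | succ m hpm ih => exact (hb m hpm).trans ih
    have e1 : ∑ m ∈ Ico p N, y (m + 1) * lkerDiff γ σ (m + 1) k =
        ∑ m ∈ Ico p N, (e (m + 1) - e m) * b m - ∑ m ∈ Ico p N, d m * ρ m * b m := by
      rw [← sum_sub_distrib]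
      refine sum_congr rfl fun m hmem => ?_
      rw [mem_Ico] at hmem
      rw [hs.step m hmem.2]
      have := (hm.pos m).ne'
      simp only [b]
      field_simp
      ring
    have a1 := abs_sum_sub_mul_le hp.le (fun k _ hk => he k hk) hb0 hb
    have a2 : |∑ m ∈ Ico p N, d m * ρ m * b m| ≤ B * b p := by
      refine (abs_sum_le_sum_abs _ _).trans ?_
      refine le_trans ?_ (mul_le_mul_of_nonneg_right ((hs.sum_forcing_le hm p).trans hF)
        (hb0 p le_rfl))
      rw [sum_mul]
      refine sum_le_sum fun m hmem => ?_
      rw [mem_Ico] at hmem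
      rw [abs_mul, abs_mul, abs_of_pos (hm.pos m), abs_of_nonneg (hb0 m hmem.1)]
      exact mul_le_mul_of_nonneg_left (hbp m hmem.1)
        (mul_nonneg (hm.pos m).le (abs_nonneg _))
    rw [e1]
    have := abs_sub (∑ m ∈ Ico p N, (e (m + 1) - e m) * b m) (∑ m ∈ Ico p N, d m * ρ m * b m)
    simp only [b] at *
    linarith
  have hpast : ∑ m ∈ Ico p N, ∑ k ∈ range p, y (k + 1) * (y (m + 1) * lkerDiff γ σ (m + 1) k) ≤
      6 * B * Y * d p ^ (γ - 2) := by
    rw [sum_comm]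
    have hd := hm.pos p
    have s1 : ∑ k ∈ range p, ∑ m ∈ Ico p N, y (k + 1) * (y (m + 1) * lkerDiff γ σ (m + 1) k) ≤
        ∑ k ∈ range p, Y * (3 * B * (lkerDiff γ σ (p + 1) k / d p)) := by
      refine sum_le_sum fun k hk => ?_
      rw [← mul_sum]
      refine (le_abs_self _).trans ?_
      rw [abs_mul]
      exact mul_le_mul (hY _ (by simpa using hk)) (hinner k hk) (abs_nonneg _) hY0
    refine s1.trans ?_
    rw [← mul_sum, ← mul_sum, ← sum_div]
    -- The differences of row `p + 1` sum to at most its diagonal value, the power `γ - 1` of a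
    -- width that is at least `d p / 2`.
    have s2 : ∑ k ∈ range p, lkerDiff γ σ (p + 1) k ≤ 2 * d p ^ (γ - 1) := by
      have a := lker_first_add_sum γ σ p
      have b := hm.lker_pos h0 (Nat.succ_pos p)
      rw [hm.lker_last h0] at a
      have c : (σ (p + 1) - σ p) ^ (γ - 1) ≤ (d p / 2) ^ (γ - 1) :=
        rpow_sub_one_antitone h1 (by positivity) (by linarith [hm.le_two_width p])
      have e1 : (d p / 2) ^ (γ - 1) = d p ^ (γ - 1) * 2 ^ (1 - γ) := by
        rw [Real.div_rpow hd.le (by norm_num), show 1 - γ = -(γ - 1) by ring,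
          Real.rpow_neg (by norm_num), div_eq_mul_inv]
      have e2 : (2 : ℝ) ^ (1 - γ) ≤ 2 := by
        calc (2 : ℝ) ^ (1 - γ) ≤ 2 ^ (1 : ℝ) :=
          Real.rpow_le_rpow_of_exponent_le (by norm_num) (by linarith)
          _ = 2 := Real.rpow_one 2
      have e3 := mul_le_mul_of_nonneg_left e2 (Real.rpow_nonneg hd.le (γ - 1))
      linarith
    have e4 : d p ^ (γ - 1) / d p = d p ^ (γ - 2) := by
      rw [← Real.rpow_sub_one hd.ne']; ring_nf
    calc Y * (3 * B * ((∑ k ∈ range p, lkerDiff γ σ (p + 1) k) / d p))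
        ≤ Y * (3 * B * (2 * d p ^ (γ - 1) / d p)) := by gcongr
      _ = 6 * B * Y * (d p ^ (γ - 1) / d p) := by ring
      _ = _ := by rw [e4]
  linarith

/-- Steps of intermediate size. -/
theorem sq_le_middle (hm : StepMesh d σ) (h0 : 0 < γ) (h1 : γ < 1) {M : ℕ}
    (hs : ModeScheme γ d σ e y ρ (M + 1) F) {p : ℕ} (hp : p ≤ M) {δ Λ B₀ : ℝ} (hδ : 0 < δ)
    (hdp : δ ≤ d p) (hdM : d M ≤ Λ) (hF : F ≤ B₀) (hB₀ : B₀ ≤ B) (he₀ : ∀ k ≤ p, |e k| ≤ B₀)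
    (he : ∀ k ≤ M + 1, |e k| ≤ B) :
    e (M + 1) ^ 2 ≤ Λ * (3 / δ + 12 * velocityConst γ * δ ^ (γ - 2)) * B₀ * B := by
  have hF0 := hs.forcing_nonneg hm
  have hB0 : 0 ≤ B₀ := hF0.trans hF
  have hB : 0 ≤ B := hB0.trans hB₀
  have hC := (velocityConst_pos h0 h1).le
  have hY := hs.abs_velocity_le hm h0 h1 (m := p) (by lia) hF he₀
  have T := hs.tail_ge hm h0 h1 (p := p) (by lia) (hF.trans hB₀) he hY
  have A := le_sum_sub_div hp (fun k => sq_nonneg (e k)) hm.pos hm.mono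
  have hd := hm.pos p
  -- Dividing the energy identity by `d n` removes the weight from the quadratic form, so `tail_ge`
  -- applies directly; monotonicity of the steps keeps the left side under control.
  have e1 : ∑ n ∈ Ico p (M + 1), (e (n + 1) ^ 2 - e n ^ 2) / d n =
      2 * ∑ n ∈ Ico p (M + 1), ρ n * ((e (n + 1) + e n) / 2) -
        2 * ∑ m ∈ Ico p (M + 1), y (m + 1) * lconv γ σ y (m + 1) := by
    rw [← mul_sub, ← sum_sub_distrib, mul_sum]
    refine sum_congr rfl fun n hn => ?_
    rw [mem_Ico] at hn
    rw [hs.conv n hn.2, div_eq_iff (hm.pos n).ne']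
    linear_combination (e (n + 1) + e n) * hs.step n hn.2
  have f : ∑ n ∈ Ico p (M + 1), ρ n * ((e (n + 1) + e n) / 2) ≤ B₀ * B / δ := by
    have g : ∑ n ∈ Ico p (M + 1), ρ n * ((e (n + 1) + e n) / 2) ≤
        (∑ n ∈ Ico p (M + 1), d n * |ρ n|) * (B / δ) := by
      rw [sum_mul]
      refine sum_le_sum fun n hn => ?_
      rw [mem_Ico] at hn
      have a := abs_mid_le (he (n + 1) (by lia)) (he n (by lia))
      refine (le_abs_self _).trans ?_
      rw [abs_mul, mul_comm (d n), mul_assoc]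
      refine mul_le_mul_of_nonneg_left (a.trans ?_) (abs_nonneg _)
      rw [← mul_div_assoc, le_div_iff₀ hδ, mul_comm]
      exact mul_le_mul_of_nonneg_right (hdp.trans (hm.monotone_step hn.1)) hB
    refine g.trans ?_
    rw [mul_div_assoc]
    exact mul_le_mul_of_nonneg_right ((hs.sum_forcing_le hm p).trans hF) (by positivity)
  have g1 : d p ^ (γ - 2) ≤ δ ^ (γ - 2) := Real.rpow_le_rpow_of_nonpos hδ hdp (by linarith)
  have g2 : e p ^ 2 / d p ≤ B₀ * B / δ := by
    have : e p ^ 2 ≤ B₀ * B := by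
      rw [← sq_abs]
      have := he₀ p le_rfl
      nlinarith [abs_nonneg (e p)]
    exact div_le_div₀ (mul_nonneg hB0 hB) this hδ hdp
  have g3 : e (M + 1) ^ 2 / d M ≤ (3 / δ + 12 * velocityConst γ * δ ^ (γ - 2)) * B₀ * B := by
    have g4 := mul_le_mul_of_nonneg_left g1
      (show 0 ≤ 6 * B * (velocityConst γ * B₀) by positivity)
    have g5 : (3 / δ + 12 * velocityConst γ * δ ^ (γ - 2)) * B₀ * B =
      3 * (B₀ * B / δ) + 2 * (6 * B * (velocityConst γ * B₀) * δ ^ (γ - 2)) := by ring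
    rw [e1] at A
    linarith
  rw [div_le_iff₀ (hm.pos M)] at g3
  refine g3.trans ?_
  have : 0 ≤ (3 / δ + 12 * velocityConst γ * δ ^ (γ - 2)) * B₀ * B := by
    have := Real.rpow_nonneg hδ.le (γ - 2)
    positivity
  have := mul_le_mul_of_nonneg_left hdM this
  linarith

/-- Large steps. -/
theorem sq_le_large (hm : StepMesh d σ) (h0 : 0 < γ) (h1 : γ < 1)
    (hs : ModeScheme γ d σ e y ρ N F) {p : ℕ} (hp : p < N) {Λ B₀ : ℝ} (hΛ : 0 < Λ)
    (hdp : Λ ≤ d p) (hF : F ≤ B₀) (hB₀ : B₀ ≤ B) (he₀ : ∀ k ≤ p, |e k| ≤ B₀)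
    (he : ∀ k ≤ N, |e k| ≤ B) :
    e N ^ 2 ≤ 3 * B₀ * B +
      12 * velocityConst γ * (1 + 1 / (1 - γ)) * Λ ^ (γ - 1) * B ^ 2 := by
  have hF0 := hs.forcing_nonneg hm
  have hB0 : 0 ≤ B₀ := hF0.trans hF
  have hB : 0 ≤ B := hB0.trans hB₀
  have hC := (velocityConst_pos h0 h1).le
  have hg : 0 < 1 - γ := sub_pos.2 h1
  have hY := hs.abs_velocity_le hm h0 h1 le_rfl (hF.trans hB₀) he
  -- Every tail is bounded by `tail_ge` with history up to its own start, so the weighted sum loses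
  -- only a multiple of `d p ^ (γ - 1)`, small for large steps since `γ < 1`.
  have S := sum_step_mul_ge (x := fun n => y (n + 1) * lconv γ σ y (n + 1)) (d := d) h1
    (show 0 ≤ 6 * B * (velocityConst γ * B) by positivity) hm.pos hm.mono hp.le fun n _ hn =>
      hs.tail_ge hm h0 h1 hn (hF.trans hB₀) he fun k hk => hY k (by lia)
  have en := hs.sq_sub_sq hp.le le_rfl
  have f := hs.sum_forcing_mul_le hm (p := p) (hF.trans hB₀) he
  have g1 : d p ^ (γ - 1) ≤ Λ ^ (γ - 1) := rpow_sub_one_antitone h1 hΛ hdp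
  have g2 := mul_le_mul_of_nonneg_left g1
    (show 0 ≤ 6 * B * (velocityConst γ * B) * (1 + 1 / (1 - γ)) by positivity)
  have g3 : e p ^ 2 ≤ B₀ * B := by
    rw [← sq_abs]
    have := he₀ p le_rfl
    nlinarith [abs_nonneg (e p)]
  have g4 := mul_le_mul_of_nonneg_right hF hB
  have g5 : 12 * velocityConst γ * (1 + 1 / (1 - γ)) * Λ ^ (γ - 1) * B ^ 2 =
    2 * (6 * B * (velocityConst γ * B) * (1 + 1 / (1 - γ)) * Λ ^ (γ - 1)) := by ring
  linarith

end ModeScheme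

/-- Stability of one mode, uniformly in the mesh. -/
theorem exists_mode_stability {γ : ℝ} (h0 : 0 < γ) (h1 : γ < 1) :
    ∃ C : ℝ, 0 < C ∧ ∀ (d σ e y ρ : ℕ → ℝ) (N : ℕ) (F : ℝ), StepMesh d σ →
      ModeScheme γ d σ e y ρ N F → |e N| ≤ C * F := by
  -- This is the coefficient of `B ^ 2` in `sq_le_small`, and that in `sq_le_large` for `Λ` below;
  -- half of the square is what the absorption at the maximum tolerates.
  obtain ⟨δ, hδ, hδ'⟩ : ∃ δ : ℝ, 0 < δ ∧
      velocityConst γ * δ + velocityConst γ ^ 2 * δ ^ γ ≤ 1 / 2 := by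
    have hc : Continuous fun δ : ℝ => velocityConst γ * δ + velocityConst γ ^ 2 * δ ^ γ :=
      (continuous_const.mul continuous_id).add
        (continuous_const.mul (Real.continuous_rpow_const h0.le))
    have ht := hc.tendsto 0
    simp only [mul_zero, Real.zero_rpow h0.ne', add_zero] at ht
    have h2 := (ht.mono_left (nhdsWithin_le_nhds (s := Set.Ioi 0))).eventually_le_const
      (show (0 : ℝ) < 1 / 2 by norm_num)
    obtain ⟨δ, h3, h4⟩ := (h2.and (self_mem_nhdsWithin (s := Set.Ioi 0))).exists
    exact ⟨δ, h4, h3⟩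
  obtain ⟨Λ, hΛ, hΛ'⟩ : ∃ Λ : ℝ, 0 < Λ ∧
      12 * velocityConst γ * (1 + 1 / (1 - γ)) * Λ ^ (γ - 1) ≤ 1 / 2 := by
    have ht := (tendsto_rpow_neg_atTop (sub_pos.2 h1)).const_mul
      (12 * velocityConst γ * (1 + 1 / (1 - γ)))
    rw [mul_zero] at ht
    obtain ⟨Λ, h3, h4⟩ := ((ht.eventually_le_const (show (0 : ℝ) < 1 / 2 by norm_num)).and
      (Filter.eventually_gt_atTop 0)).exists
    exact ⟨Λ, h4, by rwa [neg_sub] at h3⟩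
  have hC := velocityConst_pos h0 h1
  set a := Λ * (3 / δ + 12 * velocityConst γ * δ ^ (γ - 2)) with ha
  have ha0 : 0 < a := by
    have := Real.rpow_nonneg hδ.le (γ - 2)
    positivity
  refine ⟨(2 * 3 + 1) * ((2 * a + 1) * (2 * 2 + 1)), by positivity, ?_⟩
  intro d σ e y ρ N F hm hs
  have hF := hs.forcing_nonneg hm
  -- Monotone steps pass the thresholds once, so the three regimes are consecutive blocks, and the
  -- bound on one block is the initial bound `B₀` of the next. If `q ≤ p`, the middle block is
  -- empty.
  obtain ⟨p, hpN, hp1, hp2⟩ := exists_threshold hm.monotone_step δ N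
  obtain ⟨q, hqN, hq1, hq2⟩ := exists_threshold hm.monotone_step Λ N
  have b1 : ∀ k ≤ p, |e k| ≤ (2 * 2 + 1) * F := by
    refine abs_le_of_sq_le_absorb (p := 0) (by norm_num) hF ?_ ?_
    · intro k hk
      obtain rfl : k = 0 := by lia
      simpa [hs.e_zero] using hF
    · intro m hm0 hmp B hFB he
      obtain ⟨M, rfl⟩ := Nat.exists_eq_succ_of_ne_zero hm0.ne'
      have := (hs.restrict hm (show M + 1 ≤ N by lia)).sq_le_small hm h0 h1 (hp1 M (by lia)) hFB he
      have h2 := mul_le_mul_of_nonneg_right hδ' (sq_nonneg B)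
      simp only [Nat.succ_eq_add_one]
      linarith
  have b2 : ∀ k ≤ q, |e k| ≤ (2 * a + 1) * ((2 * 2 + 1) * F) := by
    refine abs_le_of_sq_le_absorb (p := p) ha0.le (by positivity) b1 ?_
    intro m hm0 hmp B hFB he
    obtain ⟨M, rfl⟩ := Nat.exists_eq_succ_of_ne_zero (show m ≠ 0 by lia)
    have := (hs.restrict hm (show M + 1 ≤ N by lia)).sq_le_middle hm h0 h1 (p := p) (by lia) hδ
      (hp2 p le_rfl (by lia)).le (hq1 M (by lia)) (by linarith) hFB b1 he
    have h2 := sq_nonneg B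
    simp only [Nat.succ_eq_add_one]
    linarith
  have b3 : ∀ k ≤ N, |e k| ≤ (2 * 3 + 1) * ((2 * a + 1) * ((2 * 2 + 1) * F)) := by
    refine abs_le_of_sq_le_absorb (p := q) (by norm_num) (by positivity) b2 ?_
    intro m hm0 hmp B hFB he
    have := (hs.restrict hm hmp).sq_le_large hm h0 h1 hm0 hΛ
      (hq2 q le_rfl (by lia)).le (by nlinarith) hFB b2 he
    have h2 := mul_le_mul_of_nonneg_right hΛ' (sq_nonneg B)
    linarith
  calc |e N| ≤ _ := b3 N le_rfl
    _ = _ := by ring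

end

/-! ### From one mode to symmetric operators, and from `lker` to `kerA`. -/

section

/-- The kernel is homogeneous of degree `γ - 1` in time. -/
theorem lker_scale {γ : ℝ} {K : ℝ} (hK : 0 < K) {σ : ℕ → ℝ} (hσ : StrictMono σ) {n k : ℕ}
    (h : k < n) : lker γ (fun m => σ m / K) n k = K ^ (1 - γ) * lker γ σ n k := by
  have a1 := hσ.monotone (show k + 1 ≤ n from h)
  have a2 := hσ (Nat.lt_succ_self k)
  have a3 : σ (k + 1) - σ k ≠ 0 := (sub_pos.2 a2).ne'
  rw [lker, lker, ← sub_div, ← sub_div, ← sub_div, Real.div_rpow (by linarith) hK.le,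
    Real.div_rpow (by linarith) hK.le, ← sub_div, Real.rpow_sub hK, Real.rpow_one]
  have := (Real.rpow_pos_of_pos hK γ).ne'
  field_simp

/-- Stability of one mode of arbitrary frequency. -/
theorem exists_frequency_stability {γ : ℝ} (h0 : 0 < γ) (h1 : γ < 1) :
    ∃ C : ℝ, 0 < C ∧ ∀ (d σ e y ρ : ℕ → ℝ) (N : ℕ) (μ : ℝ), StepMesh d σ → 0 ≤ μ →
      e 0 = 0 → y 0 = 0 → (∀ n < N, e (n + 1) - e n = d n * (y (n + 1) + ρ n)) →
      (∀ n < N, lconv γ σ y (n + 1) = -(μ * ((e (n + 1) + e n) / 2))) →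
      |e N| ≤ C * ∑ n ∈ range N, d n * |ρ n| := by
  obtain ⟨C, hC, hstab⟩ := exists_mode_stability h0 h1
  refine ⟨max C 1, lt_max_of_lt_left hC, ?_⟩
  intro d σ e y ρ N μ hm hμ he hy hstep hconv
  have hS : 0 ≤ ∑ n ∈ range N, d n * |ρ n| :=
    sum_nonneg fun n _ => mul_nonneg (hm.pos n).le (abs_nonneg _)
  rcases hμ.eq_or_lt with rfl | hμ
  · have hyz : ∀ n ≤ N, y n = 0 := by
      intro n
      induction n using Nat.strong_induction_on with
      | _ n ih =>
        intro hn
        cases n with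
        | zero => exact hy
        | succ n =>
          have := hconv n (by lia)
          rw [lconv, sum_range_succ, sum_eq_zero] at this
          · rw [ih n (by lia) (by lia)] at this
            have hp := hm.lker_pos h0 (Nat.lt_succ_self n)
            simpa [hp.ne'] using this
          · intro k hk
            rw [mem_range] at hk
            rw [ih (k + 1) (by lia) (by lia), ih k (by lia) (by lia)]
            simp
    have hsum : ∀ m ≤ N, e m = ∑ n ∈ range m, d n * ρ n := by
      intro m
      induction m with
      | zero => intro _; simpa using he
      | succ m ih =>
        intro h
        have := hstep m (by lia)
        rw [hyz (m + 1) h, ih (by lia)] at this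
        rw [sum_range_succ]; linarith
    rw [hsum N le_rfl]
    refine (abs_sum_le_sum_abs _ _).trans ?_
    simp_rw [abs_mul, abs_of_pos (hm.pos _)]
    nlinarith [le_max_right C 1]
  · set K : ℝ := μ ^ (-(1 / (2 - γ))) with hKdef
    have hK : 0 < K := Real.rpow_pos_of_pos hμ _
    have hKμ : K * K ^ (1 - γ) * μ = 1 := by
      have : K * K ^ (1 - γ) = K ^ (2 - γ) := by
        rw [show 2 - γ = 1 + (1 - γ) by ring, Real.rpow_add hK, Real.rpow_one]
      rw [this, hKdef, ← Real.rpow_mul hμ.le,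
        show -(1 / (2 - γ)) * (2 - γ) = -1 by
          have : 2 - γ ≠ 0 := by linarith
          field_simp,
        Real.rpow_neg_one, inv_mul_cancel₀ hμ.ne']
    have hm' : StepMesh (fun n => d n / K) (fun n => σ n / K) :=
      { pos := fun n => div_pos (hm.pos n) hK
        mono := fun n => div_le_div_of_nonneg_right (hm.mono n) hK.le
        zero := by simp [hm.zero]
        succ := fun n => by rw [hm.succ, ← sum_div]; ring }
    have hs : ModeScheme γ (fun n => d n / K) (fun n => σ n / K) e (fun n => K * y n)
        (fun n => K * ρ n) N (∑ n ∈ range N, d n * |ρ n|) :=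
      { e_zero := he
        y_zero := by simp [hy]
        step := fun n hn => by rw [hstep n hn]; field_simp
        conv := fun n hn => by
          have e1 : lconv γ (fun n => σ n / K) (fun n => K * y n) (n + 1) =
              K * K ^ (1 - γ) * lconv γ σ y (n + 1) := by
            rw [lconv, lconv, mul_sum]
            refine sum_congr rfl fun k hk => ?_
            rw [lker_scale hK hm.strictMono (mem_range.1 hk)]
            ring
          rw [e1, hconv n hn]
          linear_combination (-((e (n + 1) + e n) / 2)) * hKμ
        forcing := by
          refine le_of_eq (sum_congr rfl fun n _ => ?_)
          rw [abs_mul, abs_of_pos hK]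
          field_simp }
    exact (hstab _ _ _ _ _ _ _ hm' hs).trans
      (mul_le_mul_of_nonneg_right (le_max_left _ _) hS)

/-- Stability of the scheme for a symmetric nonpositive operator. -/
theorem exists_operator_stability {γ : ℝ} (h0 : 0 < γ) (h1 : γ < 1) :
    ∃ C : ℝ, 0 < C ∧ ∀ (E : Type) [NormedAddCommGroup E] [InnerProductSpace ℝ E]
      [FiniteDimensional ℝ E] (T : E →ₗ[ℝ] E), T.IsSymmetric → (∀ x, inner ℝ (T x) x ≤ 0) →
      ∀ (d σ : ℕ → ℝ) (e y ρ : ℕ → E) (N : ℕ), StepMesh d σ → e 0 = 0 → y 0 = 0 →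
      (∀ n < N, e (n + 1) - e n = d n • (y (n + 1) + ρ n)) →
      (∀ n < N, ∑ k ∈ range (n + 1), lker γ σ (n + 1) k • (y (k + 1) - y k) =
        T ((1 / 2 : ℝ) • (e (n + 1) + e n))) →
      ‖e N‖ ≤ C * ∑ n ∈ range N, d n * ‖ρ n‖ := by
  obtain ⟨C, hC, hstab⟩ := exists_frequency_stability h0 h1
  refine ⟨C, hC, ?_⟩
  intro E _ _ _ T hT hneg d σ e y ρ N hm he hy hstep hconv
  let b := hT.eigenvectorBasis rfl
  -- Vectors of absolute coefficients have the norms of the `ρ n`, so the componentwise bounds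
  -- combine by one triangle inequality, without a factor depending on the dimension.
  let x : ℕ → EuclideanSpace ℝ (Fin (Module.finrank ℝ E)) :=
    fun n => WithLp.toLp 2 fun i => |inner ℝ (b i) (ρ n)|
  have hx : ∀ n, ‖x n‖ = ‖ρ n‖ := by
    intro n
    rw [EuclideanSpace.norm_eq, ← Real.sqrt_sq (norm_nonneg (ρ n)),
      ← b.sum_sq_norm_inner_right (ρ n)]
    congr 1
    exact sum_congr rfl fun i _ => by simp [x]
  have hcomp : ∀ i, |inner ℝ (b i) (e N)| ≤ C * (∑ n ∈ range N, d n • x n) i := by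
    intro i
    have hTb : ∀ v, inner ℝ (b i) (T v) = hT.eigenvalues rfl i * inner ℝ (b i) v := by
      intro v
      rw [← hT (b i) v, hT.apply_eigenvectorBasis rfl i, inner_smul_left]
      simp [b]
    have hev : hT.eigenvalues rfl i ≤ 0 := by
      have := hneg (b i)
      rw [real_inner_comm, hTb, real_inner_self_eq_norm_sq, b.orthonormal.1 i] at this
      simpa using this
    have := hstab d σ (fun n => inner ℝ (b i) (e n)) (fun n => inner ℝ (b i) (y n))
      (fun n => inner ℝ (b i) (ρ n)) N (-(hT.eigenvalues rfl i)) hm (by linarith)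
      (by simp [he]) (by simp [hy])
      (fun n hn => by rw [← inner_sub_right, hstep n hn, inner_smul_right, inner_add_right])
      (fun n hn => by
        have h := congrArg (fun v => inner ℝ (b i) v) (hconv n hn)
        simp only [inner_sum, inner_smul_right, inner_sub_right, hTb, inner_add_right] at h
        rw [lconv, h]
        ring)
    refine this.trans (le_of_eq ?_)
    simp [x]
  have hn : ‖e N‖ ≤ ‖C • ∑ n ∈ range N, d n • x n‖ := by
    rw [EuclideanSpace.norm_eq, ← Real.sqrt_sq (norm_nonneg (e N)),
      ← b.sum_sq_norm_inner_right (e N)]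
    refine Real.sqrt_le_sqrt (sum_le_sum fun i _ => ?_)
    refine pow_le_pow_left₀ (norm_nonneg _) ?_ 2
    simp only [Real.norm_eq_abs]
    exact (hcomp i).trans (le_abs_self _)
  refine hn.trans ?_
  rw [norm_smul, Real.norm_of_nonneg hC.le]
  refine mul_le_mul_of_nonneg_left ((norm_sum_le _ _).trans (sum_le_sum fun n _ => ?_)) hC.le
  rw [norm_smul, hx, Real.norm_of_nonneg (hm.pos n).le]

/-- An infinite mesh with nondecreasing steps. -/
structure InfMesh (t : ℕ → ℝ) : Prop where
  zero : t 0 = 0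
  lt : ∀ n, t n < t (n + 1)
  step_le : ∀ n, t (n + 1) - t n ≤ t (n + 2) - t (n + 1)

theorem InfMesh.stepMesh {t : ℕ → ℝ} (ht : InfMesh t) :
    StepMesh (fun n => t (n + 1) - t n) (half t) where
  pos n := sub_pos.2 (ht.lt n)
  mono n := ht.step_le n
  zero := ht.zero
  succ n := by rw [sum_range_sub, ht.zero]; simp only [half]; ring

theorem integral_omega {α : ℝ} (h1 : α < 1) (c a b : ℝ) :
    ∫ s in a..b, omega (1 - α) (c - s) =
      ((c - a) ^ (1 - α) - (c - b) ^ (1 - α)) / Real.Gamma (2 - α) := by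
  have hG : Real.Gamma (2 - α) = (1 - α) * Real.Gamma (1 - α) := by
    rw [← Real.Gamma_add_one (by linarith)]; ring_nf
  rw [intervalIntegral.integral_comp_sub_left (fun x => omega (1 - α) x)]
  simp only [omega]
  rw [intervalIntegral.integral_div, integral_rpow (Or.inl (by linarith)), hG, div_div]
  ring_nf

/-- The cells of `kerA` are numbered from 1 and those of `lker` from 0, hence the shift. The factor
`Γ(2 - α)` is later absorbed into the operator. -/
theorem kerA_succ {α : ℝ} (h1 : α < 1) (t : ℕ → ℝ) (n k : ℕ) :
    kerA α t n (k + 1) = lker (1 - α) (half t) n k / Real.Gamma (2 - α) := by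
  rw [kerA, integral_omega h1, lker, Nat.add_sub_cancel]
  ring

theorem sum_Icc_one {E : Type*} [AddCommMonoid E] (f : ℕ → E) (n : ℕ) :
    ∑ k ∈ Icc 1 n, f k = ∑ k ∈ range n, f (k + 1) := by
  induction n with
  | zero => simp
  | succ n ih => rw [sum_Icc_succ_top (by lia), ih, sum_range_succ]

end

/-! ### The complementary kernels. -/

section

section Kernels

variable {α : ℝ} {t : ℕ → ℝ}

theorem kerA_pos (h0 : 0 < α) (h1 : α < 1) (ht : InfMesh t) {n k : ℕ} (hk : 1 ≤ k) (hkn : k ≤ n) :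
    0 < kerA α t n k := by
  obtain ⟨k, rfl⟩ := Nat.exists_eq_succ_of_ne_zero (show k ≠ 0 by lia)
  rw [Nat.succ_eq_add_one, kerA_succ h1]
  exact div_pos (ht.stepMesh.lker_pos (by linarith) hkn) (Real.Gamma_pos_of_pos (by linarith))

theorem kerA_le_succ (h0 : 0 < α) (h1 : α < 1) (ht : InfMesh t) {n k : ℕ} (hk : 1 ≤ k)
    (hkn : k < n) : kerA α t n k ≤ kerA α t n (k + 1) := by
  obtain ⟨k, rfl⟩ := Nat.exists_eq_succ_of_ne_zero (show k ≠ 0 by lia)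
  rw [Nat.succ_eq_add_one, kerA_succ h1, kerA_succ h1]
  exact div_le_div_of_nonneg_right
    (ht.stepMesh.lker_le_succ (by linarith) (by linarith) hkn)
    (Real.Gamma_pos_of_pos (by linarith)).le

theorem kerP_nonneg (h0 : 0 < α) (h1 : α < 1) (ht : InfMesh t) {n k : ℕ} (hk : 1 ≤ k)
    (hkn : k ≤ n) : 0 ≤ kerP α t n k := by
  induction hi : n - k using Nat.strong_induction_on generalizing k with
  | _ i ih =>
    rcases hkn.eq_or_lt with rfl | h
    · rw [kerP_self]
      exact one_div_nonneg.2 (kerA_pos h0 h1 ht hk le_rfl).le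
    · rw [kerP_of_lt _ _ _ _ h]
      refine mul_nonneg (one_div_nonneg.2 (kerA_pos h0 h1 ht hk le_rfl).le)
        (sum_nonneg fun j hj => ?_)
      rw [mem_Icc] at hj
      exact mul_nonneg (sub_nonneg.2 (kerA_le_succ h0 h1 ht hk hj.1))
        (ih (n - j) (by lia) (by lia) hj.2 rfl)

theorem sum_Icc_eq_add {E : Type*} [AddCommMonoid E] (f : ℕ → E) {k n : ℕ} (h : k ≤ n) :
    ∑ j ∈ Icc k n, f j = f k + ∑ j ∈ Icc (k + 1) n, f j := by
  have e : Icc k n = Ico k (n + 1) := by ext; simp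
  have e' : Icc (k + 1) n = Ico (k + 1) (n + 1) := by ext; simp
  rw [e, e', sum_eq_sum_Ico_succ_bot (by lia)]

theorem kerP_mul_kerA (h0 : 0 < α) (h1 : α < 1) (ht : InfMesh t) {n k : ℕ} (hk : 1 ≤ k)
    (hkn : k < n) : kerP α t n k * kerA α t k k =
      ∑ j ∈ Icc (k + 1) n, (kerA α t j (k + 1) - kerA α t j k) * kerP α t n j := by
  have := (kerA_pos h0 h1 ht hk (le_refl k)).ne'
  rw [kerP_of_lt _ _ _ _ hkn]
  field_simp

/-- The complementary kernels invert the kernels of the discrete derivative. -/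
theorem sum_kerP_mul_kerA (h0 : 0 < α) (h1 : α < 1) (ht : InfMesh t) {n k : ℕ} (hk : 1 ≤ k)
    (hkn : k ≤ n) : ∑ j ∈ Icc k n, kerP α t n j * kerA α t j k = 1 := by
  obtain ⟨i, rfl⟩ := Nat.exists_eq_add_of_le hkn
  clear hkn
  induction i generalizing k with
  | zero =>
    simp only [Nat.add_zero, Icc_self, sum_singleton]
    rw [kerP_self, one_div_mul_cancel (kerA_pos h0 h1 ht hk le_rfl).ne']
  | succ i ih =>
    rw [sum_Icc_eq_add _ (by lia), kerP_mul_kerA h0 h1 ht hk (by lia), ← sum_add_distrib]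
    have := ih (k := k + 1) (by lia)
    rw [show k + 1 + i = k + (i + 1) by ring] at this
    rw [← this]
    exact sum_congr rfl fun j _ => by ring

theorem sum_kerP_smul {E : Type*} [AddCommGroup E] [Module ℝ E] (h0 : 0 < α) (h1 : α < 1)
    (ht : InfMesh t) (x : ℕ → E) (n : ℕ) :
    ∑ j ∈ Icc 1 n, kerP α t n j • ∑ k ∈ Icc 1 j, kerA α t j k • x k = ∑ k ∈ Icc 1 n, x k := by
  simp_rw [smul_sum, smul_smul]
  rw [sum_comm' (t' := Icc 1 n) (s' := fun k => Icc k n) (fun j k => by simp only [mem_Icc]; lia)]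
  refine sum_congr rfl fun k hk => ?_
  rw [mem_Icc] at hk
  rw [← sum_smul, sum_kerP_mul_kerA h0 h1 ht hk.1 hk.2, one_smul]

/-- Forward substitution in a triangular system with positive diagonal. -/
theorem exists_kerA_solution {E : Type*} [AddCommGroup E] [Module ℝ E] (h0 : 0 < α) (h1 : α < 1)
    (ht : InfMesh t) (R : ℕ → E) (N : ℕ) :
    ∃ x : ℕ → E, ∀ n, 1 ≤ n → n ≤ N → ∑ k ∈ Icc 1 n, kerA α t n k • x k = R n := by
  induction N with
  | zero => exact ⟨fun _ => 0, fun n h1 h2 => by lia⟩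
  | succ N ih =>
    obtain ⟨x, hx⟩ := ih
    refine ⟨Function.update x (N + 1) ((1 / kerA α t (N + 1) (N + 1)) •
      (R (N + 1) - ∑ k ∈ Icc 1 N, kerA α t (N + 1) k • x k)), fun n hn hnN => ?_⟩
    have aux : ∀ m ≤ N, ∀ c : ℕ → ℝ, ∀ z : E,
        ∑ k ∈ Icc 1 m, c k • Function.update x (N + 1) z k = ∑ k ∈ Icc 1 m, c k • x k := by
      intro m hm c z
      refine sum_congr rfl fun k hk => ?_
      rw [mem_Icc] at hk
      rw [Function.update_of_ne (by lia)]
    rcases hnN.eq_or_lt with rfl | h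
    · rw [sum_Icc_succ_top (by lia), aux N le_rfl, Function.update_self, smul_smul,
        mul_one_div_cancel (kerA_pos h0 h1 ht hn le_rfl).ne', one_smul, add_sub_cancel]
    · rw [aux n (by lia), hx n hn (by lia)]

theorem half_pos (ht : InfMesh t) {n : ℕ} (hn : 1 ≤ n) : 0 < half t n := by
  have := ht.stepMesh.strictMono (show 0 < n from hn)
  rwa [ht.stepMesh.zero] at this

/-- The function `v` has discrete derivative at least 1 at every level, and the complementary
kernels turn this derivative back into `v n`. -/
theorem sum_kerP_le (h0 : 0 < α) (h1 : α < 1) (ht : InfMesh t) (n : ℕ) :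
    ∑ j ∈ Icc 1 n, kerP α t n j ≤ Real.Gamma (1 - α) * half t n ^ α := by
  have hG : 0 < Real.Gamma (1 - α) := Real.Gamma_pos_of_pos (by linarith)
  have hG2 : Real.Gamma (2 - α) = (1 - α) * Real.Gamma (1 - α) := by
    rw [← Real.Gamma_add_one (by linarith)]; ring_nf
  let v : ℕ → ℝ := fun k => Real.Gamma (1 - α) * half t k ^ α
  have hv0 : v 0 = 0 := by simp [v, ht.stepMesh.zero, Real.zero_rpow h0.ne']
  have tel : ∀ m, ∑ k ∈ Icc 1 m, (v k - v (k - 1)) = v m := by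
    intro m
    rw [sum_Icc_one]
    simp only [Nat.add_sub_cancel]
    rw [sum_range_sub, hv0, sub_zero]
  have key := sum_kerP_smul h0 h1 ht (fun k => v k - v (k - 1)) n
  rw [tel] at key
  simp only [smul_eq_mul] at key
  change _ ≤ v n
  rw [← key]
  refine sum_le_sum fun j hj => ?_
  rw [mem_Icc] at hj
  refine le_mul_of_one_le_right (kerP_nonneg h0 h1 ht hj.1 hj.2) ?_
  have hpos := half_pos ht hj.1
  -- The first kernel value is the smallest of its row, and `v` is increasing; so it suffices to
  -- pair that value with the total increment `v j`.
  have a1 : 1 ≤ kerA α t j 1 * v j := by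
    have := ht.stepMesh.lker_lower (γ := 1 - α) (by linarith) (by linarith)
      (show 0 < j from hj.1)
    rw [ht.stepMesh.zero, sub_zero, show 1 - α - 1 = -α by ring, Real.rpow_neg hpos.le] at this
    have e := kerA_succ h1 t j 0
    rw [zero_add] at e
    rw [e, hG2]
    have h2 : 0 < half t j ^ α := Real.rpow_pos_of_pos hpos α
    have h3 : 0 < 1 - α := by linarith
    simp only [v]
    rw [div_mul_eq_mul_div, le_div_iff₀ (by positivity), one_mul]
    rw [← div_eq_mul_inv, div_le_iff₀ h2] at this
    nlinarith
  refine a1.trans ?_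
  rw [← tel j, mul_sum]
  refine sum_le_sum fun k hk => ?_
  rw [mem_Icc] at hk
  obtain ⟨k, rfl⟩ := Nat.exists_eq_succ_of_ne_zero (show k ≠ 0 by lia)
  rw [Nat.succ_eq_add_one, Nat.add_sub_cancel]
  refine mul_le_mul_of_nonneg_right ?_ ?_
  · have e := kerA_succ h1 t j 0
    rw [zero_add] at e
    rw [e, kerA_succ h1]
    exact div_le_div_of_nonneg_right (ht.stepMesh.lker_first_le (by linarith) (by linarith) hk.2)
      (Real.Gamma_pos_of_pos (by linarith)).le
  · rw [sub_nonneg]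
    refine mul_le_mul_of_nonneg_left (Real.rpow_le_rpow ?_ (ht.stepMesh.le_level (by lia)) h0.le)
      hG.le
    rw [← ht.stepMesh.zero]
    exact ht.stepMesh.le_level (Nat.zero_le k)

/-- Convolution of the complementary kernels with a bound of the local consistency error. -/
theorem sum_kerP_mul_le (h0 : 0 < α) (h1 : α < 1) (ht : InfMesh t) {q : ℕ → ℝ}
    (hq : ∀ k, 0 ≤ q k) (N : ℕ) :
    ∑ n ∈ Icc 1 N, kerP α t N n * (kerA α t n n * q n +
        ∑ k ∈ Ico 1 n, (kerA α t n (k + 1) - kerA α t n k) * q k) ≤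
      2 * ∑ k ∈ Icc 1 N, kerP α t N k * kerA α t k k * q k := by
  -- Exchanging the sums produces the column sums of the recursion defining `kerP`; each collapses
  -- to `kerP α t N k * kerA α t k k`, which duplicates the diagonal contribution.
  have e1 : ∑ n ∈ Icc 1 N, kerP α t N n *
      ∑ k ∈ Ico 1 n, (kerA α t n (k + 1) - kerA α t n k) * q k =
      ∑ k ∈ Icc 1 N, (∑ n ∈ Icc (k + 1) N,
        (kerA α t n (k + 1) - kerA α t n k) * kerP α t N n) * q k := by
    simp_rw [mul_sum, sum_mul]
    rw [sum_comm' (t' := Icc 1 N) (s' := fun k => Icc (k + 1) N)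
      (fun j k => by simp only [mem_Icc, mem_Ico]; lia)]
    exact sum_congr rfl fun k _ => sum_congr rfl fun n _ => by ring
  simp_rw [mul_add]
  rw [sum_add_distrib, e1, two_mul]
  refine add_le_add (le_of_eq (sum_congr rfl fun k _ => by ring)) (sum_le_sum fun k hk => ?_)
  rw [mem_Icc] at hk
  refine mul_le_mul_of_nonneg_right ?_ (hq k)
  rcases hk.2.eq_or_lt with rfl | h
  · rw [Icc_eq_empty (by lia), sum_empty]
    exact mul_nonneg (kerP_nonneg h0 h1 ht hk.1 le_rfl) (kerA_pos h0 h1 ht hk.1 le_rfl).le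
  · rw [kerP_mul_kerA h0 h1 ht hk.1 h]

end Kernels

end

/-! ### Consistency of the L1 formula. -/

section

/-- `V₁` and `V₂` are the first two derivatives of `V` on `[0, T]`, and `V₂` is continuous. -/
structure TwiceDiff (T : ℝ) (V V₁ V₂ : ℝ → ℝ) : Prop where
  deriv₁ : ∀ s ∈ Set.Icc 0 T, HasDerivWithinAt V (V₁ s) (Set.Icc 0 T) s
  deriv₂ : ∀ s ∈ Set.Icc 0 T, HasDerivWithinAt V₁ (V₂ s) (Set.Icc 0 T) s
  cont₂ : ContinuousOn V₂ (Set.Icc 0 T)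

namespace TwiceDiff

variable {T : ℝ} {V V₁ V₂ : ℝ → ℝ}

theorem cont₀ (h : TwiceDiff T V V₁ V₂) : ContinuousOn V (Set.Icc 0 T) :=
  fun s hs => (h.deriv₁ s hs).continuousWithinAt

theorem cont₁ (h : TwiceDiff T V V₁ V₂) : ContinuousOn V₁ (Set.Icc 0 T) :=
  fun s hs => (h.deriv₂ s hs).continuousWithinAt

theorem sum {ι : Type*} [Fintype ι] {V V₁ V₂ : ι → ℝ → ℝ} (h : ∀ i, TwiceDiff T (V i) (V₁ i) (V₂ i))
    (c : ι → ℝ) : TwiceDiff T (fun s => ∑ i, c i * V i s) (fun s => ∑ i, c i * V₁ i s)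
      (fun s => ∑ i, c i * V₂ i s) where
  deriv₁ s hs := HasDerivWithinAt.fun_sum fun i _ => ((h i).deriv₁ s hs).const_mul (c i)
  deriv₂ s hs := HasDerivWithinAt.fun_sum fun i _ => ((h i).deriv₂ s hs).const_mul (c i)
  cont₂ := continuousOn_finsetSum _ fun i _ => continuousOn_const.mul (h i).cont₂

end TwiceDiff

theorem hasDerivWithinAt_Ioi_of_Icc {f : ℝ → ℝ} {f' a b T x : ℝ} (ha : 0 ≤ a) (hb : b ≤ T)
    (hx : x ∈ Set.Ioo a b) (h : HasDerivWithinAt f f' (Set.Icc 0 T) x) :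
    HasDerivWithinAt f f' (Set.Ioi x) x :=
  (h.hasDerivAt (Icc_mem_nhds (by linarith [hx.1]) (by linarith [hx.2]))).hasDerivWithinAt

theorem intervalIntegrable_kernel {γ : ℝ} (h0 : 0 < γ) (a b c : ℝ) :
    IntervalIntegrable (fun s => γ * (c - s) ^ (γ - 1)) MeasureTheory.volume a b := by
  have := (intervalIntegral.intervalIntegrable_rpow' (a := c - a) (b := c - b)
    (show -1 < γ - 1 by linarith)).comp_sub_left c
  simp only [sub_sub_cancel] at this
  exact this.const_mul γ

/-- Error of the linear interpolation on one interval, tested with a weakly singular kernel. -/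
theorem interval_consistency {γ T : ℝ} (h0 : 0 < γ) (h1 : γ < 1) {V V₁ V₂ : ℝ → ℝ}
    (hV : TwiceDiff T V V₁ V₂) {a b c : ℝ} (ha : 0 ≤ a) (hab : a < b) (hbc : b ≤ c) (hbT : b ≤ T) :
    |((c - a) ^ γ - (c - b) ^ γ) / (b - a) * (V b - V a) -
        ∫ s in a..b, γ * (c - s) ^ (γ - 1) * V₁ s| ≤
      (((c - a) ^ γ - (c - b) ^ γ) / (b - a) - γ * (c - a) ^ (γ - 1)) *
        ∫ s in a..b, (s - a) * |V₂ s| := by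
  have hsub : Set.Icc a b ⊆ Set.Icc 0 T := Set.Icc_subset_Icc ha hbT
  have hu : Set.uIcc a b = Set.Icc a b := Set.uIcc_of_le hab.le
  have c1 : ContinuousOn V₁ (Set.uIcc a b) := hu ▸ hV.cont₁.mono hsub
  have c2 : ContinuousOn V₂ (Set.uIcc a b) := hu ▸ hV.cont₂.mono hsub
  have c0 : ContinuousOn V (Set.uIcc a b) := hu ▸ hV.cont₀.mono hsub
  have hG : Continuous fun s : ℝ => (c - s) ^ γ :=
    (Real.continuous_rpow_const h0.le).comp (continuous_const.sub continuous_id)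
  have d1 : ∀ x ∈ Set.Ioo (min a b) (max a b), HasDerivWithinAt V₁ (V₂ x) (Set.Ioi x) x := by
    rw [min_eq_left hab.le, max_eq_right hab.le]
    exact fun x hx => hasDerivWithinAt_Ioi_of_Icc ha hbT hx
      (hV.deriv₂ x (hsub (Set.Ioo_subset_Icc_self hx)))
  have d0 : ∀ x ∈ Set.Ioo (min a b) (max a b), HasDerivWithinAt V (V₁ x) (Set.Ioi x) x := by
    rw [min_eq_left hab.le, max_eq_right hab.le]
    exact fun x hx => hasDerivWithinAt_Ioi_of_Icc ha hbT hx
      (hV.deriv₁ x (hsub (Set.Ioo_subset_Icc_self hx)))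
  have i1 : ∫ s in a..b, γ * (c - s) ^ (γ - 1) * V₁ s =
      V₁ b * -(c - b) ^ γ - V₁ a * -(c - a) ^ γ - ∫ s in a..b, V₂ s * -(c - s) ^ γ := by
    rw [← intervalIntegral.integral_mul_deriv_eq_deriv_mul_of_hasDeriv_right
      (u := V₁) (v := fun s => -(c - s) ^ γ) (u' := V₂) (v' := fun s => γ * (c - s) ^ (γ - 1))
      c1 hG.neg.continuousOn d1 ?_ c2.intervalIntegrable (intervalIntegrable_kernel h0 a b c)]
    · exact intervalIntegral.integral_congr fun s _ => mul_comm _ _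
    · rw [min_eq_left hab.le, max_eq_right hab.le]
      intro x hx
      have a3 := (hasDerivAt_rpow_pos γ (show 0 < c - x by linarith [hx.2])).comp x
        ((hasDerivAt_id x).const_sub c)
      have := a3.fun_neg
      exact (this.congr_deriv (by simp)).hasDerivWithinAt
  have i2 : V b - V a = V₁ a * (b - a) - ∫ s in a..b, V₂ s * (s - b) := by
    have e := intervalIntegral.integral_eq_sub_of_hasDeriv_right c0 d0 c1.intervalIntegrable
    have e2 := intervalIntegral.integral_mul_deriv_eq_deriv_mul_of_hasDeriv_right
      (u := V₁) (v := fun s => s - b) (u' := V₂) (v' := fun _ => 1)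
      c1 (continuous_id.sub continuous_const).continuousOn d1
      (fun x _ => ((hasDerivAt_id x).sub_const b).hasDerivWithinAt) c2.intervalIntegrable
      intervalIntegrable_const
    simp only [mul_one] at e2
    rw [← e, e2]
    ring
  have i3 : V₁ b = V₁ a + ∫ s in a..b, V₂ s := by
    rw [intervalIntegral.integral_eq_sub_of_hasDeriv_right c1 d1 c2.intervalIntegrable]
    ring
  set m := ((c - a) ^ γ - (c - b) ^ γ) / (b - a) with hm
  have hm' : m * (b - a) = (c - a) ^ γ - (c - b) ^ γ := div_mul_cancel₀ _ (by linarith)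
  -- The chord of `(c - s) ^ γ` over `[a, b]` minus the function. Integrating by parts moves the
  -- interpolation error of `V` onto this weight, which multiplies `V₂`.
  let W : ℝ → ℝ := fun s => m * (b - s) + (c - b) ^ γ - (c - s) ^ γ
  have i4 : m * (V b - V a) - ∫ s in a..b, γ * (c - s) ^ (γ - 1) * V₁ s =
      ∫ s in a..b, V₂ s * W s := by
    have s1 : IntervalIntegrable (fun s => V₂ s * (s - b)) MeasureTheory.volume a b :=
      (c2.mul (continuous_id.sub continuous_const).continuousOn).intervalIntegrable
    have s2 : IntervalIntegrable (fun s => V₂ s * -(c - s) ^ γ) MeasureTheory.volume a b :=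
      (c2.mul hG.neg.continuousOn).intervalIntegrable
    have e : ∫ s in a..b, V₂ s * W s = -m * (∫ s in a..b, V₂ s * (s - b)) +
        (c - b) ^ γ * (∫ s in a..b, V₂ s) + ∫ s in a..b, V₂ s * -(c - s) ^ γ := by
      rw [← intervalIntegral.integral_const_mul, ← intervalIntegral.integral_const_mul,
        ← intervalIntegral.integral_add (s1.const_mul _) (c2.intervalIntegrable.const_mul _),
        ← intervalIntegral.integral_add ((s1.const_mul _).add (c2.intervalIntegrable.const_mul _))
          s2]
      refine intervalIntegral.integral_congr fun s _ => ?_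
      simp only [W]
      ring
    rw [e, i1, i2, i3]
    linear_combination V₁ a * hm'
  rw [i4]
  -- Concavity puts the chord below the function and the tangent at `a` above it, so the gap is at
  -- most that between chord and tangent, linear in `s - a`.
  have hWs : ∀ s ∈ Set.Icc a b, |W s| ≤ (m - γ * (c - a) ^ (γ - 1)) * (s - a) := by
    intro s hs
    have hca : 0 < c - a := by linarith
    have up := rpow_le_tangent h0 h1 hca (show 0 ≤ c - s by linarith [hs.2])
    have lo : m * (b - s) + (c - b) ^ γ ≤ (c - s) ^ γ := by
      rcases hs.2.eq_or_lt with rfl | hsb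
      · simp
      have := slope_antitone_of_concaveOn (rpow_concave h0 h1) (a := c - b) (b := c - s)
        (c := c - b) (d := c - a) (by linarith) (by linarith) (by linarith) le_rfl
        (by linarith [hs.1])
      rw [show c - a - (c - b) = b - a by ring, show c - s - (c - b) = b - s by ring] at this
      change m ≤ _ at this
      rw [le_div_iff₀ (by linarith)] at this
      linarith
    rw [abs_of_nonpos (by simp only [W]; linarith)]
    simp only [W]
    have : (c - b) ^ γ = (c - a) ^ γ - m * (b - a) := by linarith
    rw [this]
    linarith
  rw [← intervalIntegral.integral_const_mul]
  refine (intervalIntegral.abs_integral_le_integral_abs hab.le).trans ?_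
  refine intervalIntegral.integral_mono_on hab.le ?_ ?_ ?_
  · refine ContinuousOn.intervalIntegrable (ContinuousOn.abs (c2.mul ?_))
    exact (((continuous_const.mul (continuous_const.sub continuous_id)).add
      continuous_const).sub hG).continuousOn
  · exact (continuousOn_const.mul
      ((continuous_id.sub continuous_const).continuousOn.mul c2.abs)).intervalIntegrable
  · intro s hs
    rw [abs_mul, mul_comm]
    have := mul_le_mul_of_nonneg_right (hWs s hs) (abs_nonneg (V₂ s))
    linarith

/-- Consistency of the discrete convolution for a scalar function. -/
theorem lconv_consistency {γ T : ℝ} (h0 : 0 < γ) (h1 : γ < 1) {V V₁ V₂ : ℝ → ℝ}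
    (hV : TwiceDiff T V V₁ V₂) {d σ : ℕ → ℝ} (hm : StepMesh d σ) {n : ℕ} (hn : σ (n + 1) ≤ T) :
    |lconv γ σ (fun k => V (σ k)) (n + 1) -
        ∫ s in (0 : ℝ)..σ (n + 1), γ * (σ (n + 1) - s) ^ (γ - 1) * V₁ s| ≤
      lker γ σ (n + 1) n * (∫ s in σ n..σ (n + 1), (s - σ n) * |V₂ s|) +
        ∑ k ∈ range n, lkerDiff γ σ (n + 1) k *
          ∫ s in σ k..σ (k + 1), (s - σ k) * |V₂ s| := by
  have hpos : ∀ k, 0 ≤ σ k := fun k => hm.zero ▸ hm.le_level (Nat.zero_le k)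
  have hle : ∀ k ≤ n + 1, σ k ≤ T := fun k hk => (hm.le_level hk).trans hn
  have hQ : ∀ k, 0 ≤ ∫ s in σ k..σ (k + 1), (s - σ k) * |V₂ s| := fun k =>
    intervalIntegral.integral_nonneg (hm.le_level (Nat.le_succ k)) fun s hs =>
      mul_nonneg (sub_nonneg.2 hs.1) (abs_nonneg _)
  have hint : ∀ k < n + 1, IntervalIntegrable
      (fun s => γ * (σ (n + 1) - s) ^ (γ - 1) * V₁ s) MeasureTheory.volume (σ k) (σ (k + 1)) := by
    intro k hk
    refine (intervalIntegrable_kernel h0 _ _ _).mul_continuousOn ?_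
    rw [Set.uIcc_of_le (hm.le_level (Nat.le_succ k))]
    exact hV.cont₁.mono (Set.Icc_subset_Icc (hpos k) (hle _ hk))
  have hsum := intervalIntegral.sum_integral_adjacent_intervals hint
  rw [hm.zero] at hsum
  rw [← hsum, lconv, ← sum_sub_distrib]
  refine (abs_sum_le_sum_abs _ _).trans ?_
  have hk : ∀ k ∈ range (n + 1), |lker γ σ (n + 1) k * (V (σ (k + 1)) - V (σ k)) -
      ∫ s in σ k..σ (k + 1), γ * (σ (n + 1) - s) ^ (γ - 1) * V₁ s| ≤
      (lker γ σ (n + 1) k - γ * (σ (n + 1) - σ k) ^ (γ - 1)) *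
        ∫ s in σ k..σ (k + 1), (s - σ k) * |V₂ s| := by
    intro k hk
    rw [mem_range] at hk
    exact interval_consistency h0 h1 hV (hpos k) (hm.strictMono (Nat.lt_succ_self k))
      (hm.le_level hk) (hle _ hk)
  refine (sum_le_sum hk).trans ?_
  rw [sum_range_succ, add_comm]
  refine add_le_add ?_ (sum_le_sum fun k hk => ?_)
  -- The last cell has no following kernel difference, so its whole kernel value is kept.
  · refine mul_le_mul_of_nonneg_right ?_ (hQ n)
    have := hm.le_level (Nat.le_succ n)
    have := Real.rpow_nonneg (sub_nonneg.2 this) (γ - 1)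
    nlinarith
  · rw [mem_range] at hk
    exact mul_le_mul_of_nonneg_right (hm.lker_sub_le_lkerDiff h0 h1 (by lia)) (hQ k)

theorem kernel_eq_omega {α : ℝ} (h1 : α < 1) (x : ℝ) :
    omega (1 - α) x = (1 - α) * x ^ (1 - α - 1) / Real.Gamma (2 - α) := by
  have hG : Real.Gamma (2 - α) = (1 - α) * Real.Gamma (1 - α) := by
    rw [← Real.Gamma_add_one (by linarith)]; ring_nf
  have : 1 - α ≠ 0 := by linarith
  rw [omega, hG, mul_div_mul_left _ _ this]

theorem kerA_consistency {α T : ℝ} (h0 : 0 < α) (h1 : α < 1) {V V₁ V₂ : ℝ → ℝ}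
    (hV : TwiceDiff T V V₁ V₂) {t : ℕ → ℝ} (ht : InfMesh t) {n : ℕ} (hn1 : 1 ≤ n)
    (hn : half t n ≤ T) :
    |∑ k ∈ Icc 1 n, kerA α t n k * (V (half t k) - V (half t (k - 1))) -
        ∫ s in (0 : ℝ)..half t n, omega (1 - α) (half t n - s) * V₁ s| ≤
      kerA α t n n * (∫ s in half t (n - 1)..half t n, (s - half t (n - 1)) * |V₂ s|) +
        ∑ k ∈ Ico 1 n, (kerA α t n (k + 1) - kerA α t n k) *
          ∫ s in half t (k - 1)..half t k, (s - half t (k - 1)) * |V₂ s| := by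
  obtain ⟨n, rfl⟩ := Nat.exists_eq_succ_of_ne_zero (show n ≠ 0 by lia)
  rw [Nat.succ_eq_add_one] at *
  have key := lconv_consistency (γ := 1 - α) (by linarith) (by linarith) hV ht.stepMesh hn
  have hG : 0 < Real.Gamma (2 - α) := Real.Gamma_pos_of_pos (by linarith)
  have e1 : ∑ k ∈ Icc 1 (n + 1), kerA α t (n + 1) k * (V (half t k) - V (half t (k - 1))) -
        ∫ s in (0 : ℝ)..half t (n + 1), omega (1 - α) (half t (n + 1) - s) * V₁ s =
      (lconv (1 - α) (half t) (fun k => V (half t k)) (n + 1) -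
        ∫ s in (0 : ℝ)..half t (n + 1),
          (1 - α) * (half t (n + 1) - s) ^ (1 - α - 1) * V₁ s) / Real.Gamma (2 - α) := by
    rw [sub_div, sum_Icc_one, lconv, sum_div, ← intervalIntegral.integral_div]
    congr 1
    · refine sum_congr rfl fun k _ => ?_
      rw [kerA_succ h1, Nat.add_sub_cancel]
      ring
    · refine intervalIntegral.integral_congr fun s _ => ?_
      simp only [kernel_eq_omega h1]
      ring
  have e2 : ∀ f : ℕ → ℝ, ∑ k ∈ Ico 1 (n + 1), f k = ∑ k ∈ range n, f (k + 1) := by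
    intro f
    rw [← sum_Icc_one]
    rfl
  rw [e1, abs_div, abs_of_pos hG, div_le_iff₀ hG, e2]
  refine key.trans (le_of_eq ?_)
  rw [add_mul, sum_mul, kerA_succ h1]
  simp only [Nat.add_sub_cancel]
  congr 1
  · field_simp
  · refine sum_congr rfl fun k _ => ?_
    rw [kerA_succ h1, kerA_succ h1, lkerDiff]
    field_simp

/-- Consistency for vector-valued functions in the Euclidean norm. -/
theorem kerA_consistency_norm {α T : ℝ} (h0 : 0 < α) (h1 : α < 1) {ι : Type*} [Fintype ι]
    {V V₁ V₂ : ι → ℝ → ℝ} (hV : ∀ i, TwiceDiff T (V i) (V₁ i) (V₂ i)) {t : ℕ → ℝ}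
    (ht : InfMesh t) {n : ℕ} (hn1 : 1 ≤ n) (hn : half t n ≤ T) :
    ‖(WithLp.toLp 2 fun i => ∑ k ∈ Icc 1 n, kerA α t n k *
          (V i (half t k) - V i (half t (k - 1))) -
        ∫ s in (0 : ℝ)..half t n, omega (1 - α) (half t n - s) * V₁ i s : EuclideanSpace ℝ ι)‖ ≤
      kerA α t n n * (∫ s in half t (n - 1)..half t n, (s - half t (n - 1)) *
          ‖(WithLp.toLp 2 fun i => V₂ i s : EuclideanSpace ℝ ι)‖) +
        ∑ k ∈ Ico 1 n, (kerA α t n (k + 1) - kerA α t n k) *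
          ∫ s in half t (k - 1)..half t k, (s - half t (k - 1)) *
            ‖(WithLp.toLp 2 fun i => V₂ i s : EuclideanSpace ℝ ι)‖ := by
  -- Duality: the scalar estimate is applied to the combination of the components with coefficients
  -- `Z i`, whose error is `‖Z‖ ^ 2`. Cauchy–Schwarz on `V₂` yields one factor `‖Z‖`, which cancels.
  set Z : EuclideanSpace ℝ ι := WithLp.toLp 2 fun i => ∑ k ∈ Icc 1 n, kerA α t n k *
          (V i (half t k) - V i (half t (k - 1))) -
        ∫ s in (0 : ℝ)..half t n, omega (1 - α) (half t n - s) * V₁ i s with hZ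
  have hm := ht.stepMesh
  have hpos : ∀ k, 0 ≤ half t k := fun k => hm.zero ▸ hm.le_level (Nat.zero_le k)
  have key := kerA_consistency h0 h1 (TwiceDiff.sum hV fun i => Z i) ht hn1 hn
  have hkerint : IntervalIntegrable (fun s => omega (1 - α) (half t n - s)) MeasureTheory.volume 0
      (half t n) := by
    simp only [kernel_eq_omega h1]
    exact (intervalIntegrable_kernel (show 0 < 1 - α by linarith) _ _ _).div_const _
  have e1 : ∑ k ∈ Icc 1 n, kerA α t n k *
        ((∑ i, Z i * V i (half t k)) - ∑ i, Z i * V i (half t (k - 1))) -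
      ∫ s in (0 : ℝ)..half t n, omega (1 - α) (half t n - s) * ∑ i, Z i * V₁ i s = ‖Z‖ ^ 2 := by
    rw [EuclideanSpace.real_norm_sq_eq]
    have e2 : ∫ s in (0 : ℝ)..half t n, omega (1 - α) (half t n - s) * ∑ i, Z i * V₁ i s =
        ∑ i, Z i * ∫ s in (0 : ℝ)..half t n, omega (1 - α) (half t n - s) * V₁ i s := by
      simp_rw [← intervalIntegral.integral_const_mul]
      rw [← intervalIntegral.integral_finsetSum]
      · refine intervalIntegral.integral_congr fun s _ => ?_
        simp only [mul_sum]
        exact sum_congr rfl fun i _ => by ring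
      · intro i _
        refine (hkerint.mul_continuousOn ?_).const_mul _
        rw [Set.uIcc_of_le (hpos n)]
        exact (hV i).cont₁.mono (Set.Icc_subset_Icc le_rfl hn)
    have e3 : ∑ k ∈ Icc 1 n, kerA α t n k *
        ((∑ i, Z i * V i (half t k)) - ∑ i, Z i * V i (half t (k - 1))) =
        ∑ i, Z i * ∑ k ∈ Icc 1 n, kerA α t n k * (V i (half t k) - V i (half t (k - 1))) := by
      simp_rw [← sum_sub_distrib, mul_sum]
      rw [sum_comm]
      exact sum_congr rfl fun i _ => sum_congr rfl fun k _ => by ring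
    rw [e2, e3, ← sum_sub_distrib]
    refine sum_congr rfl fun i _ => ?_
    rw [← mul_sub, sq]
  have hcs : ∀ s, |∑ i, Z i * V₂ i s| ≤
      ‖Z‖ * ‖(WithLp.toLp 2 fun i => V₂ i s : EuclideanSpace ℝ ι)‖ := by
    intro s
    have := abs_real_inner_le_norm (WithLp.toLp 2 fun i => V₂ i s : EuclideanSpace ℝ ι) Z
    rw [mul_comm ‖Z‖]
    simpa [PiLp.inner_apply] using this
  have hnormcont : ContinuousOn
      (fun s => ‖(WithLp.toLp 2 fun i => V₂ i s : EuclideanSpace ℝ ι)‖) (Set.Icc 0 T) := by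
    refine ContinuousOn.norm ?_
    exact (PiLp.continuous_toLp 2 _).comp_continuousOn
      (continuousOn_pi.2 fun i => (hV i).cont₂)
  have hint : ∀ k, 1 ≤ k → k ≤ n →
      ∫ s in half t (k - 1)..half t k, (s - half t (k - 1)) * |∑ i, Z i * V₂ i s| ≤
        ‖Z‖ * ∫ s in half t (k - 1)..half t k, (s - half t (k - 1)) *
            ‖(WithLp.toLp 2 fun i => V₂ i s : EuclideanSpace ℝ ι)‖ := by
    intro k hk hkn
    have hle := hm.le_level (show k - 1 ≤ k by lia)
    have hsub : Set.Icc (half t (k - 1)) (half t k) ⊆ Set.Icc 0 T :=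
      Set.Icc_subset_Icc (hpos _) ((hm.le_level hkn).trans hn)
    rw [← intervalIntegral.integral_const_mul]
    refine intervalIntegral.integral_mono_on hle ?_ ?_ ?_
    · refine ContinuousOn.intervalIntegrable ?_
      rw [Set.uIcc_of_le hle]
      exact (continuous_id.sub continuous_const).continuousOn.mul
        ((TwiceDiff.sum hV fun i => Z i).cont₂.mono hsub).abs
    · refine ContinuousOn.intervalIntegrable ?_
      rw [Set.uIcc_of_le hle]
      exact continuousOn_const.mul ((continuous_id.sub continuous_const).continuousOn.mul
        (hnormcont.mono hsub))
    · intro s hs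
      have := mul_le_mul_of_nonneg_left (hcs s) (sub_nonneg.2 hs.1)
      linarith
  rw [e1, abs_of_nonneg (sq_nonneg _)] at key
  by_cases hZ0 : ‖Z‖ = 0
  · rw [hZ0]
    refine add_nonneg (mul_nonneg (kerA_pos h0 h1 ht hn1 le_rfl).le ?_) (sum_nonneg fun k hk => ?_)
    · exact intervalIntegral.integral_nonneg (hm.le_level (by lia)) fun s hs =>
        mul_nonneg (sub_nonneg.2 hs.1) (norm_nonneg _)
    · rw [mem_Ico] at hk
      refine mul_nonneg (sub_nonneg.2 (kerA_le_succ h0 h1 ht hk.1 hk.2)) ?_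
      exact intervalIntegral.integral_nonneg (hm.le_level (by lia)) fun s hs =>
        mul_nonneg (sub_nonneg.2 hs.1) (norm_nonneg _)
  · have hZp : 0 < ‖Z‖ := lt_of_le_of_ne (norm_nonneg _) (Ne.symm hZ0)
    refine le_of_mul_le_mul_left ?_ hZp
    rw [← sq]
    refine key.trans ?_
    rw [mul_add, mul_sum]
    refine add_le_add ?_ (sum_le_sum fun k hk => ?_)
    · have := mul_le_mul_of_nonneg_left (hint n hn1 le_rfl) (kerA_pos h0 h1 ht hn1 le_rfl).le
      linarith
    · rw [mem_Ico] at hk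
      have := mul_le_mul_of_nonneg_left (hint k hk.1 hk.2.le)
        (sub_nonneg.2 (kerA_le_succ h0 h1 ht hk.1 hk.2))
      linarith

end

/-! ### Finite difference errors and derivatives on the closed space-time domain. -/

section

/-! ### Symmetric differences -/

/-- The difference estimates below come from this mean value bound, applied to the error as a
function of the half-width of the stencil. -/
theorem abs_le_of_deriv_bound {q q' : ℝ → ℝ} {r K : ℝ} (hr : 0 ≤ r) (h0 : q 0 = 0)
    (hd : ∀ s ∈ Set.Icc 0 r, HasDerivWithinAt q (q' s) (Set.Icc 0 r) s)
    (hb : ∀ s ∈ Set.Icc 0 r, |q' s| ≤ K) : |q r| ≤ K * r := by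
  have := (convex_Icc (0 : ℝ) r).norm_image_sub_le_of_norm_hasDerivWithin_le (C := K) hd
    (fun s hs => by simpa using hb s hs) (Set.left_mem_Icc.2 hr) (Set.right_mem_Icc.2 hr)
  simpa [h0, abs_of_nonneg hr] using this

section Symmetric

variable {S : Set ℝ} {W W₁ : ℝ → ℝ} {x r : ℝ}

theorem hasDerivWithinAt_add (hd : ∀ z ∈ S, HasDerivWithinAt W (W₁ z) S z)
    (hS : Set.Icc (x - r) (x + r) ⊆ S) {s : ℝ} (hs : s ∈ Set.Icc 0 r) :
    HasDerivWithinAt (fun s => W (x + s)) (W₁ (x + s)) (Set.Icc 0 r) s := by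
  have h1 := hd (x + s) (hS ⟨by linarith [hs.1, hs.2], by linarith [hs.2]⟩)
  have := h1.scomp s ((hasDerivWithinAt_id s (Set.Icc 0 r)).const_add x)
    (fun z hz => hS ⟨by simp; linarith [hz.1, hz.2], by simp; linarith [hz.2]⟩)
  simpa [Function.comp_def] using this

theorem hasDerivWithinAt_sub (hd : ∀ z ∈ S, HasDerivWithinAt W (W₁ z) S z)
    (hS : Set.Icc (x - r) (x + r) ⊆ S) {s : ℝ} (hs : s ∈ Set.Icc 0 r) :
    HasDerivWithinAt (fun s => W (x - s)) (-W₁ (x - s)) (Set.Icc 0 r) s := by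
  have h1 := hd (x - s) (hS ⟨by linarith [hs.2], by linarith [hs.1, hs.2]⟩)
  have := h1.scomp s ((hasDerivWithinAt_id s (Set.Icc 0 r)).const_sub x)
    (fun z hz => hS ⟨by simp; linarith [hz.2], by simp; linarith [hz.1, hz.2]⟩)
  simpa [Function.comp_def] using this

variable {W₂ : ℝ → ℝ} {M : ℝ}

theorem abs_sub_sub_le (hr : 0 ≤ r) (hS : Set.Icc (x - r) (x + r) ⊆ S)
    (hd : ∀ z ∈ S, HasDerivWithinAt W (W₁ z) S z) (hb : ∀ z ∈ S, |W₁ z| ≤ M) :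
    |W (x + r) - W (x - r)| ≤ 2 * M * r := by
  refine abs_le_of_deriv_bound (q := fun s => W (x + s) - W (x - s))
    (q' := fun s => W₁ (x + s) - -W₁ (x - s)) hr (by simp)
    (fun s hs => (hasDerivWithinAt_add hd hS hs).fun_sub (hasDerivWithinAt_sub hd hS hs)) ?_
  intro s hs
  have a1 := hb (x + s) (hS ⟨by linarith [hs.1, hs.2], by linarith [hs.2]⟩)
  have a2 := hb (x - s) (hS ⟨by linarith [hs.2], by linarith [hs.1, hs.2]⟩)
  rw [abs_le] at *
  constructor <;> linarith [a1.1, a1.2, a2.1, a2.2]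

/-- The second difference, compared with a multiple of `r ^ 2`. -/
theorem abs_second_difference_sub_le (hr : 0 ≤ r) (hS : Set.Icc (x - r) (x + r) ⊆ S)
    (hd : ∀ z ∈ S, HasDerivWithinAt W (W₁ z) S z)
    (hd₂ : ∀ z ∈ S, HasDerivWithinAt W₁ (W₂ z) S z) {c : ℝ}
    (hb : ∀ s ∈ Set.Icc 0 r, |W₂ (x + s) + W₂ (x - s) - 2 * c| ≤ M) :
    |W (x + r) + W (x - r) - 2 * W x - r ^ 2 * c| ≤ M * r ^ 2 := by
  have step1 : ∀ s ∈ Set.Icc 0 r, |W₁ (x + s) - W₁ (x - s) - 2 * s * c| ≤ M * r := by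
    intro s hs
    have hS' : Set.Icc (x - s) (x + s) ⊆ S :=
      (Set.Icc_subset_Icc (by linarith [hs.2]) (by linarith [hs.2])).trans hS
    have := abs_le_of_deriv_bound (q := fun s => W₁ (x + s) - W₁ (x - s) - 2 * s * c)
      (q' := fun s => W₂ (x + s) - -W₂ (x - s) - 2 * c) (r := s) (K := M) hs.1 (by simp)
      (fun z hz => by
        have a := (((hasDerivWithinAt_id z (Set.Icc 0 s)).const_mul 2).mul_const c)
        have := ((hasDerivWithinAt_add hd₂ hS' hz).fun_sub
          (hasDerivWithinAt_sub hd₂ hS' hz)).fun_sub a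
        simpa using this)
      (fun z hz => by
        have := hb z ⟨hz.1, hz.2.trans hs.2⟩
        rwa [sub_neg_eq_add])
    refine this.trans ?_
    have hM : 0 ≤ M := (abs_nonneg _).trans (hb s hs)
    exact mul_le_mul_of_nonneg_left hs.2 hM
  have := abs_le_of_deriv_bound (q := fun s => W (x + s) + W (x - s) - 2 * W x - s ^ 2 * c)
    (q' := fun s => W₁ (x + s) + -W₁ (x - s) - 2 * s * c) (r := r) (K := M * r) hr
    (by simp; ring)
    (fun z hz => by
      have a := (((hasDerivWithinAt_id z (Set.Icc 0 r)).fun_pow 2).mul_const c)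
      have := (((hasDerivWithinAt_add hd hS hz).fun_add
        (hasDerivWithinAt_sub hd hS hz)).sub_const (2 * W x)).fun_sub a
      simpa using this)
    (fun z hz => by rw [← sub_eq_add_neg]; exact step1 z hz)
  refine this.trans (le_of_eq (by ring))

theorem abs_second_difference_le (hr : 0 ≤ r) (hS : Set.Icc (x - r) (x + r) ⊆ S)
    (hd : ∀ z ∈ S, HasDerivWithinAt W (W₁ z) S z)
    (hd₂ : ∀ z ∈ S, HasDerivWithinAt W₁ (W₂ z) S z)
    (hb : ∀ z ∈ Set.Icc (x - r) (x + r), |W₂ z| ≤ M) :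
    |W (x + r) + W (x - r) - 2 * W x| ≤ 2 * M * r ^ 2 := by
  have := abs_second_difference_sub_le (c := 0) (M := 2 * M) hr hS hd hd₂ (fun s hs => by
    have a1 := hb (x + s) ⟨by linarith [hs.1, hs.2], by linarith [hs.2]⟩
    have a2 := hb (x - s) ⟨by linarith [hs.2], by linarith [hs.1, hs.2]⟩
    rw [abs_le] at *
    constructor <;> linarith [a1.1, a1.2, a2.1, a2.2])
  simpa using this

/-- Fourth order derivatives control the error of the second difference quotient. -/
theorem abs_second_difference_quotient_le {W₃ W₄ : ℝ → ℝ} (hr : 0 ≤ r)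
    (hS : Set.Icc (x - r) (x + r) ⊆ S)
    (hd : ∀ z ∈ S, HasDerivWithinAt W (W₁ z) S z)
    (hd₂ : ∀ z ∈ S, HasDerivWithinAt W₁ (W₂ z) S z)
    (hd₃ : ∀ z ∈ S, HasDerivWithinAt W₂ (W₃ z) S z)
    (hd₄ : ∀ z ∈ S, HasDerivWithinAt W₃ (W₄ z) S z)
    (hb : ∀ z ∈ Set.Icc (x - r) (x + r), |W₄ z| ≤ M) :
    |W (x + r) + W (x - r) - 2 * W x - r ^ 2 * W₂ x| ≤ 2 * M * r ^ 2 * r ^ 2 := by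
  have hM : 0 ≤ M := (abs_nonneg _).trans (hb x ⟨by linarith, by linarith⟩)
  refine abs_second_difference_sub_le hr hS hd hd₂ fun s hs => ?_
  have hI : Set.Icc (x - s) (x + s) ⊆ Set.Icc (x - r) (x + r) :=
    Set.Icc_subset_Icc (by linarith [hs.2]) (by linarith [hs.2])
  refine (abs_second_difference_le hs.1 (hI.trans hS) hd₃ hd₄ fun z hz => hb z (hI hz)).trans ?_
  have := pow_le_pow_left₀ hs.1 hs.2 2
  nlinarith

/-- Error of the trapezoidal rule for `W₁ = W'`. -/
theorem abs_trapezoid_le {W₃ : ℝ → ℝ} (hr : 0 ≤ r) (hS : Set.Icc (x - r) (x + r) ⊆ S)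
    (hd : ∀ z ∈ S, HasDerivWithinAt W (W₁ z) S z)
    (hd₂ : ∀ z ∈ S, HasDerivWithinAt W₁ (W₂ z) S z)
    (hd₃ : ∀ z ∈ S, HasDerivWithinAt W₂ (W₃ z) S z) (hb : ∀ z ∈ S, |W₃ z| ≤ M) :
    |r * (W₁ (x + r) + W₁ (x - r)) - (W (x + r) - W (x - r))| ≤ 2 * M * r ^ 2 * r := by
  refine abs_le_of_deriv_bound
    (q := fun s => s * (W₁ (x + s) + W₁ (x - s)) - (W (x + s) - W (x - s)))
    (q' := fun s => s * (W₂ (x + s) - W₂ (x - s))) hr (by simp) (fun s hs => ?_) (fun s hs => ?_)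
  · have a := (hasDerivWithinAt_id s (Set.Icc 0 r)).fun_mul
      ((hasDerivWithinAt_add hd₂ hS hs).fun_add (hasDerivWithinAt_sub hd₂ hS hs))
    have b := (hasDerivWithinAt_add hd hS hs).fun_sub (hasDerivWithinAt_sub hd hS hs)
    exact (a.fun_sub b).congr_deriv (by simp only [id]; ring)
  · have hI : Set.Icc (x - s) (x + s) ⊆ S :=
      (Set.Icc_subset_Icc (by linarith [hs.2]) (by linarith [hs.2])).trans hS
    have := abs_sub_sub_le hs.1 hI hd₃ hb
    have hM : 0 ≤ M := (abs_nonneg _).trans (hb x (hS ⟨by linarith, by linarith⟩))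
    rw [abs_mul, abs_of_nonneg hs.1]
    have h2 := pow_le_pow_left₀ hs.1 hs.2 2
    have h3 := mul_le_mul_of_nonneg_left this hs.1
    nlinarith

end Symmetric

/-! ### Directional derivatives on the space-time domain -/

/-- The closed space-time domain. -/
def spaceTime (T : ℝ) : Set (ℝ × ℝ × ℝ) := Set.univ ×ˢ (Set.univ ×ˢ Set.Icc 0 T)

/-- The derivative in direction `v` on the closed space-time domain. -/
noncomputable def dirDeriv (T : ℝ) (v : ℝ × ℝ × ℝ) (F : ℝ × ℝ × ℝ → ℝ) (p : ℝ × ℝ × ℝ) : ℝ :=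
  fderivWithin ℝ F (spaceTime T) p v

theorem mem_spaceTime {T x y s : ℝ} : (x, y, s) ∈ spaceTime T ↔ s ∈ Set.Icc 0 T := by
  simp [spaceTime]

theorem uniqueDiffOn_spaceTime {T : ℝ} (hT : 0 < T) : UniqueDiffOn ℝ (spaceTime T) :=
  uniqueDiffOn_univ.prod (uniqueDiffOn_univ.prod (uniqueDiffOn_Icc hT))

theorem contDiffOn_dirDeriv {T : ℝ} (hT : 0 < T) {F : ℝ × ℝ × ℝ → ℝ} {n : ℕ}
    (hF : ContDiffOn ℝ (n + 1 : ℕ) F (spaceTime T)) (v : ℝ × ℝ × ℝ) :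
    ContDiffOn ℝ n (dirDeriv T v F) (spaceTime T) :=
  (hF.fderivWithin (uniqueDiffOn_spaceTime hT) (by norm_cast)).clm_apply contDiffOn_const

theorem hasDerivWithinAt_curve {T : ℝ} {F : ℝ × ℝ × ℝ → ℝ} {n : ℕ}
    (hF : ContDiffOn ℝ (n + 1 : ℕ) F (spaceTime T)) {c : ℝ → ℝ × ℝ × ℝ} {v : ℝ × ℝ × ℝ}
    {S : Set ℝ} {r : ℝ} (hr : r ∈ S) (hc : HasDerivWithinAt c v S r)
    (hmap : Set.MapsTo c S (spaceTime T)) :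
    HasDerivWithinAt (fun r => F (c r)) (dirDeriv T v F (c r)) S r :=
  ((hF.differentiableOn (by norm_cast)) (c r) (hmap hr)).hasFDerivWithinAt.comp_hasDerivWithinAt
    r hc hmap

theorem hasDerivWithinAt_time {T : ℝ} {F : ℝ × ℝ × ℝ → ℝ} {n : ℕ}
    (hF : ContDiffOn ℝ (n + 1 : ℕ) F (spaceTime T)) (x y : ℝ) {s : ℝ} (hs : s ∈ Set.Icc 0 T) :
    HasDerivWithinAt (fun s => F (x, y, s)) (dirDeriv T (0, 0, 1) F (x, y, s)) (Set.Icc 0 T) s :=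
  hasDerivWithinAt_curve hF hs
    ((hasDerivWithinAt_const s _ x).prodMk ((hasDerivWithinAt_const s _ y).prodMk
      (hasDerivWithinAt_id s _))) fun _ hz => mem_spaceTime.2 hz

theorem hasDerivAt_x {T : ℝ} {F : ℝ × ℝ × ℝ → ℝ} {n : ℕ}
    (hF : ContDiffOn ℝ (n + 1 : ℕ) F (spaceTime T)) (x y : ℝ) {s : ℝ} (hs : s ∈ Set.Icc 0 T) :
    HasDerivAt (fun x => F (x, y, s)) (dirDeriv T (1, 0, 0) F (x, y, s)) x := by
  rw [← hasDerivWithinAt_univ]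
  exact hasDerivWithinAt_curve hF (Set.mem_univ x)
    ((hasDerivWithinAt_id x _).prodMk ((hasDerivWithinAt_const x _ y).prodMk
      (hasDerivWithinAt_const x _ s))) fun _ _ => mem_spaceTime.2 hs

theorem hasDerivAt_y {T : ℝ} {F : ℝ × ℝ × ℝ → ℝ} {n : ℕ}
    (hF : ContDiffOn ℝ (n + 1 : ℕ) F (spaceTime T)) (x y : ℝ) {s : ℝ} (hs : s ∈ Set.Icc 0 T) :
    HasDerivAt (fun y => F (x, y, s)) (dirDeriv T (0, 1, 0) F (x, y, s)) y := by
  rw [← hasDerivWithinAt_univ]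
  exact hasDerivWithinAt_curve hF (Set.mem_univ y)
    ((hasDerivWithinAt_const y _ x).prodMk ((hasDerivWithinAt_id y _).prodMk
      (hasDerivWithinAt_const y _ s))) fun _ _ => mem_spaceTime.2 hs

/-- Iterated one-sided derivatives along a time line are identified with iterated directional
derivatives on the domain. Their joint continuity yields bounds uniform in the node. -/
theorem timeDeriv_eq_iterate {T : ℝ} (hT : 0 < T) {U : ℝ → ℝ → ℝ → ℝ} {N : ℕ}
    (hU : ContDiffOn ℝ N (fun p : ℝ × ℝ × ℝ => U p.1 p.2.1 p.2.2) (spaceTime T)) {m : ℕ}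
    (hm : m ≤ N) :
    ContDiffOn ℝ (N - m : ℕ)
      ((dirDeriv T (0, 0, 1))^[m] fun p : ℝ × ℝ × ℝ => U p.1 p.2.1 p.2.2) (spaceTime T) ∧
    ∀ x y, ∀ s ∈ Set.Icc 0 T, timeDeriv T m U x y s =
      (dirDeriv T (0, 0, 1))^[m] (fun p : ℝ × ℝ × ℝ => U p.1 p.2.1 p.2.2) (x, y, s) := by
  induction m with
  | zero => exact ⟨hU, fun x y s _ => by simp [timeDeriv]⟩
  | succ m ih =>
    obtain ⟨h1, h2⟩ := ih (by lia)
    have h1' : ContDiffOn ℝ (N - (m + 1) + 1 : ℕ)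
      ((dirDeriv T (0, 0, 1))^[m] fun p : ℝ × ℝ × ℝ => U p.1 p.2.1 p.2.2) (spaceTime T) := by
      rwa [show N - (m + 1) + 1 = N - m by lia]
    rw [Function.iterate_succ_apply']
    refine ⟨contDiffOn_dirDeriv hT h1' _, fun x y s hs => ?_⟩
    rw [timeDeriv, iteratedDerivWithin_succ]
    have e : derivWithin (iteratedDerivWithin m (fun s => U x y s) (Set.Icc 0 T)) (Set.Icc 0 T) s =
        derivWithin (fun s => (dirDeriv T (0, 0, 1))^[m]
          (fun p : ℝ × ℝ × ℝ => U p.1 p.2.1 p.2.2) (x, y, s)) (Set.Icc 0 T) s :=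
      derivWithin_congr (fun z hz => h2 x y z hz) (h2 x y s hs)
    rw [e]
    exact (hasDerivWithinAt_time h1' x y hs).derivWithin (uniqueDiffOn_Icc hT s hs)

/-- Nodes of one period lie in `[0, L]` and the stencil reaches `h ≤ L` further, whence the sides
`[-L, 2 * L]`. -/
theorem exists_bound_box {T L : ℝ} {F : ℝ × ℝ × ℝ → ℝ} (hF : ContinuousOn F (spaceTime T)) :
    ∃ C : ℝ, ∀ x ∈ Set.Icc (-L) (2 * L), ∀ y ∈ Set.Icc (-L) (2 * L), ∀ s ∈ Set.Icc 0 T,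
      |F (x, y, s)| ≤ C := by
  have hc : IsCompact (Set.Icc (-L) (2 * L) ×ˢ (Set.Icc (-L) (2 * L) ×ˢ Set.Icc 0 T)) :=
    isCompact_Icc.prod (isCompact_Icc.prod isCompact_Icc)
  obtain ⟨C, hC⟩ := hc.exists_bound_of_continuousOn
    (hF.mono fun p hp => ⟨trivial, trivial, hp.2.2⟩)
  exact ⟨C, fun x hx y hy s hs => hC (x, y, s) ⟨hx, hy, hs⟩⟩

/-- The second difference quotient in one space direction of a time average, for a function
given on the line through the node in that direction. -/
theorem abs_averaged_quotient_le {T : ℝ} {A A₁ A₂ A₃ A₄ B₁ B₂ : ℝ → ℝ → ℝ} {x h M s₁ s₂ : ℝ}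
    (hh : 0 < h) (hs : s₁ ≤ s₂) (hs₁ : 0 ≤ s₁) (hs₂ : s₂ ≤ T)
    (hd₁ : ∀ s ∈ Set.Icc 0 T, ∀ z, HasDerivAt (fun z => A z s) (A₁ z s) z)
    (hd₂ : ∀ s ∈ Set.Icc 0 T, ∀ z, HasDerivAt (fun z => A₁ z s) (A₂ z s) z)
    (hd₃ : ∀ s ∈ Set.Icc 0 T, ∀ z, HasDerivAt (fun z => A₂ z s) (A₃ z s) z)
    (hd₄ : ∀ s ∈ Set.Icc 0 T, ∀ z, HasDerivAt (fun z => A₃ z s) (A₄ z s) z)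
    (ht₁ : ∀ z, ∀ s ∈ Set.Icc 0 T, HasDerivWithinAt (fun s => A₂ z s) (B₁ z s) (Set.Icc 0 T) s)
    (ht₂ : ∀ z, ∀ s ∈ Set.Icc 0 T, HasDerivWithinAt (fun s => B₁ z s) (B₂ z s) (Set.Icc 0 T) s)
    (hA : ∀ z ∈ Set.Icc (x - h) (x + h), ∀ s ∈ Set.Icc 0 T, |A₄ z s| ≤ M)
    (hB : ∀ z ∈ Set.Icc (x - h) (x + h), ∀ s ∈ Set.Icc 0 T, |B₂ z s| ≤ M) :
    |(((A (x + h) s₂ + A (x + h) s₁) / 2 - (A x s₂ + A x s₁) / 2) / h -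
        ((A x s₂ + A x s₁) / 2 - (A (x - h) s₂ + A (x - h) s₁) / 2) / h) / h -
      A₂ x ((s₂ + s₁) / 2)| ≤ 2 * M * (h ^ 2 + (s₂ - s₁) ^ 2) := by
  set σ := (s₂ + s₁) / 2 with hσ
  set δ := (s₂ - s₁) / 2 with hδ
  have m1 : s₁ ∈ Set.Icc 0 T := ⟨hs₁, hs.trans hs₂⟩
  have m2 : s₂ ∈ Set.Icc 0 T := ⟨hs₁.trans hs, hs₂⟩
  have m3 : σ ∈ Set.Icc 0 T := ⟨by linarith, by linarith⟩
  have hM : 0 ≤ M := (abs_nonneg _).trans (hA x ⟨by linarith, by linarith⟩ σ m3)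
  have e1 : s₂ = σ + δ := by rw [hσ, hδ]; ring
  have e2 : s₁ = σ - δ := by rw [hσ, hδ]; ring
  have hsub : Set.Icc (σ - δ) (σ + δ) ⊆ Set.Icc 0 T :=
    Set.Icc_subset_Icc (by linarith) (by linarith)
  -- Spatial error at the mean time `σ`.
  have p1 := abs_second_difference_quotient_le (S := Set.univ) (W := fun z => A z σ) (x := x)
    (r := h) (M := M) hh.le (Set.subset_univ _)
    (fun z _ => (hd₁ σ m3 z).hasDerivWithinAt) (fun z _ => (hd₂ σ m3 z).hasDerivWithinAt)
    (fun z _ => (hd₃ σ m3 z).hasDerivWithinAt) (fun z _ => (hd₄ σ m3 z).hasDerivWithinAt)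
    (fun z hz => hA z hz σ m3)
  -- Error of the time average. Its second space derivative is a second time difference of `A₂`,
  -- hence of order `δ ^ 2`; only mixed derivatives of order four enter.
  have p2 := abs_second_difference_le (S := Set.univ)
    (W := fun z => (A z s₂ + A z s₁) / 2 - A z σ) (W₁ := fun z => (A₁ z s₂ + A₁ z s₁) / 2 - A₁ z σ)
    (W₂ := fun z => (A₂ z s₂ + A₂ z s₁) / 2 - A₂ z σ) (x := x) (r := h) (M := M * δ ^ 2) hh.le
    (Set.subset_univ _)
    (fun z _ => ((((hd₁ s₂ m2 z).fun_add (hd₁ s₁ m1 z)).div_const 2).fun_sub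
      (hd₁ σ m3 z)).hasDerivWithinAt)
    (fun z _ => ((((hd₂ s₂ m2 z).fun_add (hd₂ s₁ m1 z)).div_const 2).fun_sub
      (hd₂ σ m3 z)).hasDerivWithinAt)
    (fun z hz => by
      have := abs_second_difference_le (x := σ) (r := δ) (M := M) (by linarith) hsub (ht₁ z)
        (ht₂ z) (fun s hs => hB z hz s (hsub hs))
      rw [← e1, ← e2] at this
      rw [show (A₂ z s₂ + A₂ z s₁) / 2 - A₂ z σ = (A₂ z s₂ + A₂ z s₁ - 2 * A₂ z σ) / 2 by ring,
        abs_div, abs_two, div_le_iff₀ two_pos]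
      linarith)
  have hh2 : 0 < h ^ 2 := by positivity
  have e3 : (((A (x + h) s₂ + A (x + h) s₁) / 2 - (A x s₂ + A x s₁) / 2) / h -
        ((A x s₂ + A x s₁) / 2 - (A (x - h) s₂ + A (x - h) s₁) / 2) / h) / h - A₂ x σ =
      ((A (x + h) σ + A (x - h) σ - 2 * A x σ - h ^ 2 * A₂ x σ) +
        (((A (x + h) s₂ + A (x + h) s₁) / 2 - A (x + h) σ) +
          ((A (x - h) s₂ + A (x - h) s₁) / 2 - A (x - h) σ) -
          2 * ((A x s₂ + A x s₁) / 2 - A x σ))) / h ^ 2 := by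
    field_simp
    ring
  rw [e3, abs_div, abs_of_pos hh2, div_le_iff₀ hh2]
  refine (abs_add_le _ _).trans ((add_le_add p1 p2).trans ?_)
  have : δ ^ 2 ≤ (s₂ - s₁) ^ 2 := by rw [hδ]; nlinarith [sq_nonneg (s₂ - s₁)]
  have := mul_le_mul_of_nonneg_left this (mul_nonneg hM hh2.le)
  linarith

end

/-! ### Consistency estimates for the smooth solution. -/

section

section Smooth

variable {L T : ℝ} {U : ℝ → ℝ → ℝ → ℝ}

/-- The function of one space-time variable given by a function of three real variables. -/
def joint (U : ℝ → ℝ → ℝ → ℝ) (p : ℝ × ℝ × ℝ) : ℝ := U p.1 p.2.1 p.2.2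

theorem contDiffOn_timeDeriv_iterate (hT : 0 < T) (hU : ContDiffOn ℝ 4 (joint U) (spaceTime T))
    {m : ℕ} (hm : m ≤ 4) :
    ContDiffOn ℝ (4 - m : ℕ) ((dirDeriv T (0, 0, 1))^[m] (joint U)) (spaceTime T) :=
  (timeDeriv_eq_iterate hT (N := 4) hU hm).1

theorem timeDeriv_eq (hT : 0 < T) (hU : ContDiffOn ℝ 4 (joint U) (spaceTime T)) {m : ℕ}
    (hm : m ≤ 4) (x y : ℝ) {s : ℝ} (hs : s ∈ Set.Icc 0 T) :
    timeDeriv T m U x y s = (dirDeriv T (0, 0, 1))^[m] (joint U) (x, y, s) :=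
  (timeDeriv_eq_iterate hT (N := 4) hU hm).2 x y s hs

theorem hasDerivWithinAt_timeDeriv (hT : 0 < T) (hU : ContDiffOn ℝ 4 (joint U) (spaceTime T))
    {m : ℕ} (hm : m < 4) (x y : ℝ) {s : ℝ} (hs : s ∈ Set.Icc 0 T) :
    HasDerivWithinAt (timeDeriv T m U x y) (timeDeriv T (m + 1) U x y s) (Set.Icc 0 T) s := by
  have h1 := contDiffOn_timeDeriv_iterate hT hU hm.le
  rw [show 4 - m = (3 - m) + 1 by lia] at h1
  have := hasDerivWithinAt_time h1 x y hs
  rw [← Function.iterate_succ_apply' (dirDeriv T (0, 0, 1)),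
    ← timeDeriv_eq hT hU (show m + 1 ≤ 4 from hm) x y hs] at this
  exact this.congr (fun z hz => timeDeriv_eq hT hU hm.le x y hz) (timeDeriv_eq hT hU hm.le x y hs)

theorem continuousOn_timeDeriv (hT : 0 < T) (hU : ContDiffOn ℝ 4 (joint U) (spaceTime T))
    {m : ℕ} (hm : m < 4) (x y : ℝ) : ContinuousOn (timeDeriv T m U x y) (Set.Icc 0 T) :=
  fun _ hs => (hasDerivWithinAt_timeDeriv hT hU hm x y hs).continuousWithinAt

theorem hasDerivWithinAt_solution (hT : 0 < T) (hU : ContDiffOn ℝ 4 (joint U) (spaceTime T))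
    (x y : ℝ) {s : ℝ} (hs : s ∈ Set.Icc 0 T) :
    HasDerivWithinAt (U x y) (timeDeriv T 1 U x y s) (Set.Icc 0 T) s := by
  have := hasDerivWithinAt_timeDeriv hT hU (m := 0) (by norm_num) x y hs
  have e : timeDeriv T 0 U x y = U x y := by
    funext s; simp [timeDeriv]
  rwa [e] at this

theorem twiceDiff_timeDeriv (hT : 0 < T) (hU : ContDiffOn ℝ 4 (joint U) (spaceTime T))
    (x y : ℝ) : TwiceDiff T (timeDeriv T 1 U x y) (timeDeriv T 2 U x y) (timeDeriv T 3 U x y) where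
  deriv₁ _ hs := hasDerivWithinAt_timeDeriv hT hU (by norm_num) x y hs
  deriv₂ _ hs := hasDerivWithinAt_timeDeriv hT hU (by norm_num) x y hs
  cont₂ := continuousOn_timeDeriv hT hU (by norm_num) x y

theorem exists_timeDeriv_bound (hT : 0 < T) (hU : ContDiffOn ℝ 4 (joint U) (spaceTime T))
    (L : ℝ) {m : ℕ} (hm : m ≤ 4) :
    ∃ C : ℝ, ∀ x ∈ Set.Icc (-L) (2 * L), ∀ y ∈ Set.Icc (-L) (2 * L), ∀ s ∈ Set.Icc 0 T,
      |timeDeriv T m U x y s| ≤ C := by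
  obtain ⟨C, hC⟩ := exists_bound_box (L := L) (contDiffOn_timeDeriv_iterate hT hU hm).continuousOn
  exact ⟨C, fun x hx y hy s hs => timeDeriv_eq hT hU hm x y hs ▸ hC x hx y hy s hs⟩

theorem spaceLaplacian_eq (hT : 0 < T) (hU : ContDiffOn ℝ 4 (joint U) (spaceTime T)) (x y : ℝ)
    {s : ℝ} (hs : s ∈ Set.Icc 0 T) :
    spaceLaplacian U x y s = dirDeriv T (1, 0, 0) (dirDeriv T (1, 0, 0) (joint U)) (x, y, s) +
      dirDeriv T (0, 1, 0) (dirDeriv T (0, 1, 0) (joint U)) (x, y, s) := by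
  have h4 : ContDiffOn ℝ (3 + 1 : ℕ) (joint U) (spaceTime T) := hU
  have ex : deriv (fun x' => U x' y s) = fun x' => dirDeriv T (1, 0, 0) (joint U) (x', y, s) :=
    funext fun z => (hasDerivAt_x h4 z y hs).deriv
  have ey : deriv (fun y' => U x y' s) = fun y' => dirDeriv T (0, 1, 0) (joint U) (x, y', s) :=
    funext fun z => (hasDerivAt_y h4 x z hs).deriv
  rw [spaceLaplacian, iteratedDeriv_succ, iteratedDeriv_one, ex, iteratedDeriv_succ,
    iteratedDeriv_one, ey, (hasDerivAt_x (n := 2) (contDiffOn_dirDeriv hT h4 _) x y hs).deriv,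
    (hasDerivAt_y (n := 2) (contDiffOn_dirDeriv hT h4 _) x y hs).deriv]

/-- The five-point Laplacian of the time average, compared with the Laplacian at the mean time. -/
theorem exists_averaged_laplacian_bound (hT : 0 < T)
    (hU : ContDiffOn ℝ 4 (joint U) (spaceTime T)) (L : ℝ) :
    ∃ C : ℝ, ∀ h s₁ s₂, 0 < h → h ≤ L → 0 ≤ s₁ → s₁ ≤ s₂ → s₂ ≤ T →
      ∀ x ∈ Set.Icc 0 L, ∀ y ∈ Set.Icc 0 L,
      |((((U (x + h) y s₂ + U (x + h) y s₁) / 2 - (U x y s₂ + U x y s₁) / 2) / h -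
        ((U x y s₂ + U x y s₁) / 2 - (U (x - h) y s₂ + U (x - h) y s₁) / 2) / h) / h +
      (((U x (y + h) s₂ + U x (y + h) s₁) / 2 - (U x y s₂ + U x y s₁) / 2) / h -
        ((U x y s₂ + U x y s₁) / 2 - (U x (y - h) s₂ + U x (y - h) s₁) / 2) / h) / h) -
      spaceLaplacian U x y ((s₂ + s₁) / 2)| ≤ C * (h ^ 2 + (s₂ - s₁) ^ 2) := by
  have h4 : ContDiffOn ℝ (3 + 1 : ℕ) (joint U) (spaceTime T) := hU
  -- The two fourth-order derivatives that occur: four in the space direction, and two in space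
  -- followed by two in time.
  have key : ∀ v, ∃ C : ℝ, ∀ x ∈ Set.Icc (-L) (2 * L), ∀ y ∈ Set.Icc (-L) (2 * L),
      ∀ s ∈ Set.Icc 0 T,
      |(dirDeriv T v)^[4] (joint U) (x, y, s)| ≤ C ∧
      |(dirDeriv T (0, 0, 1))^[2] ((dirDeriv T v)^[2] (joint U)) (x, y, s)| ≤ C := by
    intro v
    have k1 : ContDiffOn ℝ (2 + 1 : ℕ) (dirDeriv T v (joint U)) (spaceTime T) :=
      contDiffOn_dirDeriv hT h4 v
    have k2 : ContDiffOn ℝ (1 + 1 : ℕ) (dirDeriv T v (dirDeriv T v (joint U))) (spaceTime T) :=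
      contDiffOn_dirDeriv hT k1 v
    obtain ⟨C₁, h1⟩ := exists_bound_box (L := L) (contDiffOn_dirDeriv hT (n := 0)
      (contDiffOn_dirDeriv hT k2 v) v).continuousOn
    obtain ⟨C₂, h2⟩ := exists_bound_box (L := L) (contDiffOn_dirDeriv hT (n := 0)
      (contDiffOn_dirDeriv hT k2 (0, 0, 1)) (0, 0, 1)).continuousOn
    exact ⟨max C₁ C₂, fun x hx y hy s hs => ⟨(h1 x hx y hy s hs).trans (le_max_left _ _),
      (h2 x hx y hy s hs).trans (le_max_right _ _)⟩⟩
  obtain ⟨C₁, hC₁⟩ := key (1, 0, 0)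
  obtain ⟨C₂, hC₂⟩ := key (0, 1, 0)
  refine ⟨2 * C₁ + 2 * C₂, fun h s₁ s₂ hh hhL hs₁ hs hs₂ x hx y hy => ?_⟩
  have mx : ∀ z ∈ Set.Icc (x - h) (x + h), z ∈ Set.Icc (-L) (2 * L) := fun z hz =>
    ⟨by linarith [hz.1, hx.1], by linarith [hz.2, hx.2]⟩
  have my : ∀ z ∈ Set.Icc (y - h) (y + h), z ∈ Set.Icc (-L) (2 * L) := fun z hz =>
    ⟨by linarith [hz.1, hy.1], by linarith [hz.2, hy.2]⟩
  have hx' := mx x ⟨by linarith, by linarith⟩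
  have hy' := my y ⟨by linarith, by linarith⟩
  have k1 : ∀ v, ContDiffOn ℝ (2 + 1 : ℕ) (dirDeriv T v (joint U)) (spaceTime T) :=
    fun v => contDiffOn_dirDeriv hT h4 v
  have k2 : ∀ v, ContDiffOn ℝ (1 + 1 : ℕ) (dirDeriv T v (dirDeriv T v (joint U))) (spaceTime T) :=
    fun v => contDiffOn_dirDeriv hT (k1 v) v
  have k3 : ∀ v w, ContDiffOn ℝ (0 + 1 : ℕ) (dirDeriv T w (dirDeriv T v (dirDeriv T v (joint U))))
      (spaceTime T) := fun v w => contDiffOn_dirDeriv hT (k2 v) w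
  have b1 := abs_averaged_quotient_le (x := x) hh hs hs₁ hs₂
    (fun s hs z => hasDerivAt_x h4 z y hs) (fun s hs z => hasDerivAt_x (k1 _) z y hs)
    (fun s hs z => hasDerivAt_x (k2 _) z y hs) (fun s hs z => hasDerivAt_x (k3 _ _) z y hs)
    (fun z s hs => hasDerivWithinAt_time (k2 _) z y hs)
    (fun z s hs => hasDerivWithinAt_time (k3 _ _) z y hs)
    (fun z hz s hs => (hC₁ z (mx z hz) y hy' s hs).1)
    (fun z hz s hs => (hC₁ z (mx z hz) y hy' s hs).2)
  have b2 := abs_averaged_quotient_le (x := y) hh hs hs₁ hs₂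
    (fun s hs z => hasDerivAt_y h4 x z hs) (fun s hs z => hasDerivAt_y (k1 _) x z hs)
    (fun s hs z => hasDerivAt_y (k2 _) x z hs) (fun s hs z => hasDerivAt_y (k3 _ _) x z hs)
    (fun z s hs => hasDerivWithinAt_time (k2 _) x z hs)
    (fun z s hs => hasDerivWithinAt_time (k3 _ _) x z hs)
    (fun z hz s hs => (hC₂ x hx' z (my z hz) s hs).1)
    (fun z hz s hs => (hC₂ x hx' z (my z hz) s hs).2)
  have m3 : (s₂ + s₁) / 2 ∈ Set.Icc 0 T := ⟨by linarith, by linarith⟩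
  rw [spaceLaplacian_eq hT hU x y m3, add_sub_add_comm, add_mul]
  exact (abs_add_le _ _).trans (add_le_add b1 b2)

/-- Errors of the two averages that replace the velocity at the mean time. -/
theorem abs_average_sub_le (hT : 0 < T) (hU : ContDiffOn ℝ 4 (joint U) (spaceTime T)) {x y C : ℝ}
    (hC : ∀ s ∈ Set.Icc 0 T, |timeDeriv T 3 U x y s| ≤ C) {s₁ s₂ : ℝ} (h0 : 0 ≤ s₁)
    (hs : s₁ < s₂) (hs₂ : s₂ ≤ T) :
    |(timeDeriv T 1 U x y s₂ + timeDeriv T 1 U x y s₁) / 2 -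
        timeDeriv T 1 U x y ((s₂ + s₁) / 2)| ≤ C * (s₂ - s₁) ^ 2 ∧
      |(timeDeriv T 1 U x y s₂ + timeDeriv T 1 U x y s₁) / 2 - (U x y s₂ - U x y s₁) / (s₂ - s₁)| ≤
        C * (s₂ - s₁) ^ 2 := by
  set σ := (s₂ + s₁) / 2 with hσ
  set δ := (s₂ - s₁) / 2 with hδ
  have e1 : s₂ = σ + δ := by rw [hσ, hδ]; ring
  have e2 : s₁ = σ - δ := by rw [hσ, hδ]; ring
  have hd : 0 < δ := by rw [hδ]; linarith
  have hsub : Set.Icc (σ - δ) (σ + δ) ⊆ Set.Icc 0 T :=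
    Set.Icc_subset_Icc (by linarith) (by linarith)
  have hC0 : 0 ≤ C := (abs_nonneg _).trans (hC s₂ ⟨by linarith, hs₂⟩)
  have t2 := (twiceDiff_timeDeriv hT hU x y)
  have p1 := abs_second_difference_le (x := σ) (r := δ) hd.le hsub t2.deriv₁ t2.deriv₂
    (fun z hz => hC z (hsub hz))
  have p2 := abs_trapezoid_le (x := σ) (r := δ) hd.le hsub
    (fun z hz => hasDerivWithinAt_solution hT hU x y hz) t2.deriv₁ t2.deriv₂ hC
  rw [← e1, ← e2] at p1 p2
  have e3 : s₂ - s₁ = 2 * δ := by rw [hδ]; ring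
  have hCd : 0 ≤ C * δ ^ 2 := by positivity
  constructor
  · rw [show ∀ a b c : ℝ, (a + b) / 2 - c = (a + b - 2 * c) / 2 by intros; ring, abs_div, abs_two,
      div_le_iff₀ two_pos, e3]
    nlinarith
  · rw [e3, show (timeDeriv T 1 U x y s₂ + timeDeriv T 1 U x y s₁) / 2 -
        (U x y s₂ - U x y s₁) / (2 * δ) = (δ * (timeDeriv T 1 U x y s₂ + timeDeriv T 1 U x y s₁) -
        (U x y s₂ - U x y s₁)) / (2 * δ) by field_simp, abs_div, abs_of_pos (by linarith : 0 < 2 * δ),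
      div_le_iff₀ (by linarith)]
    nlinarith

theorem continuousOn_timeDerivNorm (hT : 0 < T) (hU : ContDiffOn ℝ 4 (joint U) (spaceTime T))
    {m : ℕ} (hm : m < 4) (M : ℕ) : ContinuousOn (timeDerivNorm L T M m U) (Set.Icc 0 T) := by
  unfold timeDerivNorm gridNorm onGrid
  refine Real.continuous_sqrt.comp_continuousOn (continuousOn_const.mul ?_)
  exact continuousOn_finsetSum _ fun i _ => continuousOn_finsetSum _ fun j _ =>
    (continuousOn_timeDeriv hT hU hm _ _).pow 2

end Smooth

end

/-! ### Periodic grid functions as a Euclidean space, and the five-point Laplacian. -/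

section

section Grid

/-- The negative semidefinite second difference along the orbits of a permutation. -/
noncomputable def secondDiff {ι : Type} [Fintype ι] (τ : Equiv.Perm ι) :
    EuclideanSpace ℝ ι →ₗ[ℝ] EuclideanSpace ℝ ι where
  toFun x := WithLp.toLp 2 fun i => x (τ i) + x (τ.symm i) - 2 * x i
  map_add' x y := by ext i; simp; ring
  map_smul' c x := by ext i; simp; ring

/-- Summation by parts without boundary terms, since a permutation leaves sums over the index set
unchanged. Symmetry and nonpositivity can be read off. -/
theorem inner_secondDiff {ι : Type} [Fintype ι] (τ : Equiv.Perm ι) (x y : EuclideanSpace ℝ ι) :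
    inner ℝ (secondDiff τ x) y = -∑ i, (x (τ i) - x i) * (y (τ i) - y i) := by
  have e1 : ∑ i, x (τ i) * y (τ i) = ∑ i, x i * y i := Equiv.sum_comp τ fun i => x i * y i
  have e2 : ∑ i, x (τ.symm i) * y i = ∑ i, x i * y (τ i) := by
    rw [← Equiv.sum_comp τ]; simp
  simp only [PiLp.inner_apply, secondDiff, LinearMap.coe_mk, AddHom.coe_mk, RCLike.inner_apply,
    conj_trivial]
  have e3 : ∑ i, y i * (x (τ i) + x (τ.symm i) - 2 * x i) =
      ∑ i, x (τ i) * y i + ∑ i, x (τ.symm i) * y i - 2 * ∑ i, x i * y i := by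
    rw [← sum_add_distrib, mul_sum, ← sum_sub_distrib]
    exact sum_congr rfl fun i _ => by ring
  have e4 : ∑ i, (x (τ i) - x i) * (y (τ i) - y i) = ∑ i, x (τ i) * y (τ i) -
      ∑ i, x (τ i) * y i - ∑ i, x i * y (τ i) + ∑ i, x i * y i := by
    rw [← sum_sub_distrib, ← sum_sub_distrib, ← sum_add_distrib]
    exact sum_congr rfl fun i _ => by ring
  rw [e3, e4, e1, e2]; ring

theorem secondDiff_isSymmetric {ι : Type} [Fintype ι] (τ : Equiv.Perm ι) :
    (secondDiff τ).IsSymmetric := fun x y => by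
  rw [inner_secondDiff, real_inner_comm, inner_secondDiff]
  exact congrArg _ (sum_congr rfl fun i _ => mul_comm _ _)

theorem inner_secondDiff_self_le {ι : Type} [Fintype ι] (τ : Equiv.Perm ι)
    (x : EuclideanSpace ℝ ι) : inner ℝ (secondDiff τ x) x ≤ 0 := by
  rw [inner_secondDiff]
  exact neg_nonpos.2 (sum_nonneg fun i _ => mul_self_nonneg _)

variable (M : ℕ)

/-- The representative in `{1, …, M}` of a residue class. -/
def node (a : ZMod M) : ℤ := (a - 1).val + 1

variable {M}

theorem node_cast [NeZero M] (a : ZMod M) : ((node M a : ℤ) : ZMod M) = a := by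
  simp [node]

theorem node_mem [NeZero M] (a : ZMod M) : node M a ∈ Icc (1 : ℤ) M := by
  have := ZMod.val_lt (a - 1)
  rw [mem_Icc, node]
  constructor <;> lia

theorem cast_node [NeZero M] {i : ℤ} (hi : i ∈ Icc (1 : ℤ) M) : node M (i : ZMod M) = i := by
  rw [mem_Icc] at hi
  have : ((i : ZMod M) - 1) = ((i - 1 : ℤ) : ZMod M) := by push_cast; rfl
  rw [node, this, ZMod.val_intCast, Int.emod_eq_of_lt (by lia) (by lia)]
  ring

theorem sum_node [NeZero M] (f : ℤ → ℝ) : ∑ a : ZMod M, f (node M a) = ∑ i ∈ Icc (1 : ℤ) M, f i :=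
  sum_nbij' (node M) (fun i => (i : ZMod M)) (fun a _ => node_mem a) (fun _ _ => mem_univ _)
    (fun a _ => node_cast a) (fun _ hi => cast_node hi) fun _ _ => rfl

variable (M)

/-- The values of a grid function over one period, as a Euclidean vector. -/
noncomputable def gridVec (w : ℤ → ℤ → ℝ) : EuclideanSpace ℝ (ZMod M × ZMod M) :=
  WithLp.toLp 2 fun p => w (node M p.1) (node M p.2)

variable {M}

theorem gridVec_apply (w : ℤ → ℤ → ℝ) (p : ZMod M × ZMod M) :
    gridVec M w p = w (node M p.1) (node M p.2) := rfl

theorem gridNorm_eq [NeZero M] {h : ℝ} (hh : 0 ≤ h) (w : ℤ → ℤ → ℝ) :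
    gridNorm M h w = h * ‖gridVec M w‖ := by
  rw [gridNorm, Real.sqrt_mul (sq_nonneg h), Real.sqrt_sq hh, EuclideanSpace.norm_eq]
  congr 2
  rw [Fintype.sum_prod_type, ← sum_node]
  refine sum_congr rfl fun a _ => ?_
  rw [← sum_node]
  exact sum_congr rfl fun b _ => by simp [gridVec_apply]

theorem IsPeriodicGrid.congr {w : ℤ → ℤ → ℝ} (hw : IsPeriodicGrid M w) {i i' j j' : ℤ}
    (hi : (i : ZMod M) = i') (hj : (j : ZMod M) = j') : w i j = w i' j' := by
  have p1 : ∀ j, Function.Periodic (fun i => w i j) (M : ℤ) := fun j i => hw.1 i j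
  have p2 : ∀ i, Function.Periodic (fun j => w i j) (M : ℤ) := fun i j => hw.2 i j
  obtain ⟨c, hc⟩ := (ZMod.intCast_eq_intCast_iff_dvd_sub i i' M).1 hi
  obtain ⟨c', hc'⟩ := (ZMod.intCast_eq_intCast_iff_dvd_sub j j' M).1 hj
  have q1 := (p1 j).int_mul c i
  have q2 := (p2 i').int_mul c' j
  simp only [mul_comm _ (M : ℤ)] at q1 q2
  simp only [Int.cast_id] at q1 q2
  rw [← q1, show i + M * c = i' by lia, ← q2, show j + M * c' = j' by lia]

variable (M)

/-- The five-point Laplacian on periodic grid functions. -/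
noncomputable def gridOp [NeZero M] (h : ℝ) :
    EuclideanSpace ℝ (ZMod M × ZMod M) →ₗ[ℝ] EuclideanSpace ℝ (ZMod M × ZMod M) :=
  (h ^ 2)⁻¹ • (secondDiff (Equiv.addRight ((1, 0) : ZMod M × ZMod M)) +
    secondDiff (Equiv.addRight ((0, 1) : ZMod M × ZMod M)))

variable {M}

theorem gridOp_isSymmetric [NeZero M] (h : ℝ) : (gridOp M h).IsSymmetric :=
  ((secondDiff_isSymmetric _).add (secondDiff_isSymmetric _)).smul (by simp)

theorem inner_gridOp_self_le [NeZero M] (h : ℝ) (x : EuclideanSpace ℝ (ZMod M × ZMod M)) :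
    inner ℝ (gridOp M h x) x ≤ 0 := by
  rw [gridOp, LinearMap.smul_apply, LinearMap.add_apply, real_inner_smul_left, inner_add_left]
  exact mul_nonpos_of_nonneg_of_nonpos (by positivity)
    (add_nonpos (inner_secondDiff_self_le _ x) (inner_secondDiff_self_le _ x))

theorem gridOp_gridVec [NeZero M] (h : ℝ) {w : ℤ → ℤ → ℝ} (hw : IsPeriodicGrid M w) :
    gridOp M h (gridVec M w) = gridVec M (gridLaplacian h w) := by
  ext ⟨a, b⟩
  have c1 : w (node M (a + 1)) (node M b) = w (node M a + 1) (node M b) :=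
    hw.congr (by simp [node_cast]) rfl
  have c2 : w (node M (a - 1)) (node M b) = w (node M a - 1) (node M b) :=
    hw.congr (by simp [node_cast]) rfl
  have c3 : w (node M a) (node M (b + 1)) = w (node M a) (node M b + 1) :=
    hw.congr rfl (by simp [node_cast])
  have c4 : w (node M a) (node M (b - 1)) = w (node M a) (node M b - 1) :=
    hw.congr rfl (by simp [node_cast])
  simp only [gridOp, secondDiff, LinearMap.smul_apply, LinearMap.add_apply, LinearMap.coe_mk,
    AddHom.coe_mk, PiLp.smul_apply, PiLp.add_apply, smul_eq_mul, gridVec_apply,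
    Equiv.coe_addRight, Equiv.addRight_symm, Prod.mk_add_mk, add_zero, Prod.neg_mk, neg_zero,
    ← sub_eq_add_neg, c1, c2, c3, c4, gridLaplacian]
  simp only [div_eq_mul_inv, sq, mul_inv]
  ring

theorem IsPeriodicGrid.sub {w w' : ℤ → ℤ → ℝ} (h : IsPeriodicGrid M w)
    (h' : IsPeriodicGrid M w') : IsPeriodicGrid M fun i j => w i j - w' i j :=
  ⟨fun i j => by simp only [h.1, h'.1], fun i j => by simp only [h.2, h'.2]⟩

theorem norm_gridVec_le [NeZero M] {w : ℤ → ℤ → ℝ} {C : ℝ} (hC : 0 ≤ C)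
    (hw : ∀ i ∈ Icc (1 : ℤ) M, ∀ j ∈ Icc (1 : ℤ) M, |w i j| ≤ C) : ‖gridVec M w‖ ≤ M * C := by
  rw [EuclideanSpace.norm_eq]
  refine Real.sqrt_le_iff.2 ⟨by positivity, ?_⟩
  have : ∀ p ∈ (univ : Finset (ZMod M × ZMod M)), ‖gridVec M w p‖ ^ 2 ≤ C ^ 2 := fun p _ =>
    pow_le_pow_left₀ (norm_nonneg _) (hw _ (node_mem p.1) _ (node_mem p.2)) 2
  refine (sum_le_card_nsmul _ _ _ this).trans (le_of_eq ?_)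
  simp [ZMod.card]; ring

end Grid

end

/-! ### Stability of the perturbed error system. -/

section

theorem step_succ (t : ℕ → ℝ) (n : ℕ) : step t (n + 1) = t (n + 1) - t n := rfl

/-- The velocity error is corrected by `η` and by the sequence `X` whose discrete derivative is `R`.
The second equation then has no source, and all perturbations appear as forcing in the first. -/
theorem exists_error_stability {α : ℝ} (h0 : 0 < α) (h1 : α < 1) :
    ∃ C : ℝ, 0 < C ∧ ∀ (E : Type) [NormedAddCommGroup E] [InnerProductSpace ℝ E]
      [FiniteDimensional ℝ E] (A : E →ₗ[ℝ] E), A.IsSymmetric → (∀ x, inner ℝ (A x) x ≤ 0) →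
      ∀ (t : ℕ → ℝ), InfMesh t → ∀ (e w η r R : ℕ → E) (N : ℕ), e 0 = 0 → w 0 = 0 → η 0 = 0 →
      (∀ k < N, e (k + 1) - e k = step t (k + 1) • (w (k + 1) - r (k + 1))) →
      (∀ n, 1 ≤ n → n ≤ N →
        ∑ k ∈ Icc 1 n, kerA α t n k • ((w k - η k) - (w (k - 1) - η (k - 1))) =
          R n + A ((1 / 2 : ℝ) • (e n + e (n - 1)))) →
      ‖e N‖ ≤ C * ∑ k ∈ range N, step t (k + 1) * (‖η (k + 1)‖ + ‖r (k + 1)‖ +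
        ∑ j ∈ Icc 1 (k + 1), kerP α t (k + 1) j * ‖R j‖) := by
  obtain ⟨C, hC, H⟩ := exists_operator_stability (γ := 1 - α) (by linarith) (by linarith)
  refine ⟨C, hC, fun E _ _ _ A hA hA' t ht e w η r R N he hw hη hev hca => ?_⟩
  obtain ⟨x, hx⟩ := exists_kerA_solution h0 h1 ht R N
  have hG : 0 < Real.Gamma (2 - α) := Real.Gamma_pos_of_pos (by linarith)
  set X : ℕ → E := fun n => ∑ k ∈ Icc 1 n, x k with hX
  have hXs : ∀ n, X (n + 1) - X n = x (n + 1) := fun n => by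
    rw [hX]; simp only [sum_Icc_one, sum_range_succ]; abel
  -- The complementary kernels recover `X n` from its discrete derivatives `R j`.
  have hXb : ∀ n, n ≤ N → ‖X n‖ ≤ ∑ j ∈ Icc 1 n, kerP α t n j * ‖R j‖ := fun n hn => by
    rw [hX]
    simp only
    rw [← sum_kerP_smul h0 h1 ht x n]
    refine (norm_sum_le _ _).trans (sum_le_sum fun j hj => ?_)
    obtain ⟨j1, j2⟩ := mem_Icc.1 hj
    rw [hx j j1 (j2.trans hn), norm_smul, Real.norm_of_nonneg (kerP_nonneg h0 h1 ht j1 j2)]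
  -- Multiplying the second equation by `Γ(2 - α)` turns `kerA` into `lker`; the factor is positive,
  -- so the operator stays symmetric and nonpositive.
  refine (H E (Real.Gamma (2 - α) • A) (hA.smul (by simp)) (fun x => ?_) _ _ e
    (fun n => w n - η n - X n) (fun n => η (n + 1) - r (n + 1) + X (n + 1)) N ht.stepMesh he
    (by simp [hw, hη, hX]) (fun n hn => ?_) (fun n hn => ?_)).trans
    (mul_le_mul_of_nonneg_left (sum_le_sum fun n hn => ?_) hC.le)
  · rw [LinearMap.smul_apply, real_inner_smul_left]
    exact mul_nonpos_of_nonneg_of_nonpos hG.le (hA' x)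
  · rw [hev n hn, step_succ]
    congr 1; abel
  · have e1 := hca (n + 1) (by lia) hn
    have e2 := hx (n + 1) (by lia) hn
    rw [sum_Icc_one] at e1 e2
    simp only [kerA_succ h1, Nat.add_sub_cancel] at e1 e2
    have e3 : ∑ k ∈ range (n + 1), (lker (1 - α) (half t) (n + 1) k / Real.Gamma (2 - α)) •
        ((w (k + 1) - η (k + 1) - X (k + 1)) - (w k - η k - X k)) =
        A ((1 / 2 : ℝ) • (e (n + 1) + e n)) := by
      have : R (n + 1) + A ((1 / 2 : ℝ) • (e (n + 1) + e n)) - R (n + 1) =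
        A ((1 / 2 : ℝ) • (e (n + 1) + e n)) := by abel
      rw [← this, ← e1]
      nth_rewrite 1 [← e2]
      rw [← sum_sub_distrib]
      refine sum_congr rfl fun k _ => ?_
      rw [← smul_sub, ← hXs]
      congr 1; abel
    rw [LinearMap.smul_apply, ← e3, smul_sum]
    refine sum_congr rfl fun k _ => ?_
    rw [smul_smul, mul_div_cancel₀ _ hG.ne']
  · rw [step_succ]
    refine mul_le_mul_of_nonneg_left ?_ (by linarith [ht.lt n])
    refine (norm_add_le _ _).trans (add_le_add (norm_sub_le _ _) (hXb _ ?_))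
    exact mem_range.1 hn

end

/-! ### Local errors of the scheme and the error equations. -/

section

section Consistency

/-- Time average of the exact velocity at a node. -/
noncomputable def velocityAverage (T h : ℝ) (t : ℕ → ℝ) (U : ℝ → ℝ → ℝ → ℝ) (n : ℕ) (i j : ℤ) : ℝ :=
  half (fun k => timeDeriv T 1 U (i * h) (j * h) (t k)) n

/-- Error of the averaged velocity as an approximation of the velocity at the half level. -/
noncomputable def averageError (T h : ℝ) (t : ℕ → ℝ) (U : ℝ → ℝ → ℝ → ℝ) (n : ℕ) (i j : ℤ) : ℝ :=
  velocityAverage T h t U n i j - timeDeriv T 1 U (i * h) (j * h) (half t n)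

/-- Error of the difference quotient as an approximation of the averaged velocity. -/
noncomputable def quotientError (T h : ℝ) (t : ℕ → ℝ) (U : ℝ → ℝ → ℝ → ℝ) (n : ℕ) (i j : ℤ) : ℝ :=
  velocityAverage T h t U n i j -
    (U (i * h) (j * h) (t n) - U (i * h) (j * h) (t (n - 1))) / step t n

/-- Error of the L1-type formula applied to the exact velocity. -/
noncomputable def caputoError (α T h : ℝ) (t : ℕ → ℝ) (U : ℝ → ℝ → ℝ → ℝ) (n : ℕ)
    (i j : ℤ) : ℝ :=
  ∑ k ∈ Icc 1 n, kerA α t n k * (timeDeriv T 1 U (i * h) (j * h) (half t k) -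
      timeDeriv T 1 U (i * h) (j * h) (half t (k - 1))) -
    ∫ s in (0 : ℝ)..half t n, omega (1 - α) (half t n - s) * timeDeriv T 2 U (i * h) (j * h) s

/-- Error of the five-point Laplacian of the averaged solution. -/
noncomputable def laplacianError (h : ℝ) (t : ℕ → ℝ) (U : ℝ → ℝ → ℝ → ℝ) (n : ℕ) (i j : ℤ) : ℝ :=
  spaceLaplacian U (i * h) (j * h) (half t n) -
    gridLaplacian h (fun i j => half (fun k => U (i * h) (j * h) (t k)) n) i j

variable {L T : ℝ} {U : ℝ → ℝ → ℝ → ℝ} {M : ℕ} {t : ℕ → ℝ}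

theorem InfMesh.step_pos (ht : InfMesh t) {n : ℕ} (hn : 1 ≤ n) : 0 < step t n := by
  obtain ⟨n, rfl⟩ := Nat.exists_eq_succ_of_ne_zero (show n ≠ 0 by lia)
  exact sub_pos.2 (ht.lt n)

theorem InfMesh.monotone (ht : InfMesh t) : Monotone t :=
  monotone_nat_of_le_succ fun n => (ht.lt n).le

theorem InfMesh.nonneg (ht : InfMesh t) (n : ℕ) : 0 ≤ t n := ht.zero ▸ ht.monotone (Nat.zero_le n)

theorem InfMesh.half_le (ht : InfMesh t) (n : ℕ) : half t n ≤ t n := by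
  cases n with
  | zero => exact le_refl _
  | succ n => simp only [half]; linarith [ht.lt n]

theorem InfMesh.half_nonneg (ht : InfMesh t) (n : ℕ) : 0 ≤ half t n := by
  cases n with
  | zero => exact ht.nonneg 0
  | succ n => simp only [half]; linarith [ht.nonneg n, ht.nonneg (n + 1)]

theorem node_mul_mem (hL : 0 < L) (hM : 1 ≤ M) {i : ℤ} (hi : i ∈ Icc (1 : ℤ) M) :
    i * (L / M) ∈ Set.Icc 0 L := by
  rw [mem_Icc] at hi
  have hM' : (0 : ℝ) < M := by exact_mod_cast hM
  have h1 : (1 : ℝ) ≤ i := by exact_mod_cast hi.1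
  have h2 : (i : ℝ) ≤ M := by exact_mod_cast hi.2
  refine ⟨by positivity, ?_⟩
  calc i * (L / M) ≤ M * (L / M) := mul_le_mul_of_nonneg_right h2 (by positivity)
    _ = L := by field_simp

theorem exists_average_error_bound (hL : 0 < L) (hT : 0 < T)
    (hU : ContDiffOn ℝ 4 (joint U) (spaceTime T)) :
    ∃ C : ℝ, 0 ≤ C ∧ ∀ (M : ℕ) [NeZero M] (t : ℕ → ℝ) (n : ℕ), 1 ≤ M → InfMesh t → 1 ≤ n →
      t n ≤ T →
      ‖gridVec M (averageError T (L / M) t U n)‖ ≤ M * (C * step t n ^ 2) ∧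
      ‖gridVec M (quotientError T (L / M) t U n)‖ ≤ M * (C * step t n ^ 2) := by
  obtain ⟨C, hC⟩ := exists_timeDeriv_bound hT hU L (m := 3) (by norm_num)
  have hC' : ∀ x ∈ Set.Icc 0 L, ∀ y ∈ Set.Icc 0 L, ∀ s ∈ Set.Icc 0 T,
      |timeDeriv T 3 U x y s| ≤ C := fun x hx y hy s hs =>
    hC x ⟨by linarith [hx.1], by linarith [hx.2]⟩ y ⟨by linarith [hy.1], by linarith [hy.2]⟩ s hs
  have hC0 : 0 ≤ C := (abs_nonneg _).trans
    (hC' 0 ⟨le_rfl, hL.le⟩ 0 ⟨le_rfl, hL.le⟩ 0 ⟨le_rfl, hT.le⟩)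
  refine ⟨C, hC0, fun M _ t n hM ht hn htT => ?_⟩
  obtain ⟨n, rfl⟩ := Nat.exists_eq_succ_of_ne_zero (show n ≠ 0 by lia)
  have key : ∀ i ∈ Icc (1 : ℤ) M, ∀ j ∈ Icc (1 : ℤ) M, _ := fun i hi j hj =>
    abs_average_sub_le hT hU (C := C) (x := i * (L / M)) (y := j * (L / M))
      (fun s hs => hC' _ (node_mul_mem hL hM hi) _ (node_mul_mem hL hM hj) s hs)
      (ht.nonneg n) (ht.lt n) htT
  exact ⟨norm_gridVec_le (by positivity) fun i hi j hj => (key i hi j hj).1,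
    norm_gridVec_le (by positivity) fun i hi j hj => (key i hi j hj).2⟩

theorem exists_laplacian_error_bound (hL : 0 < L) (hT : 0 < T)
    (hU : ContDiffOn ℝ 4 (joint U) (spaceTime T)) :
    ∃ C : ℝ, 0 ≤ C ∧ ∀ (M : ℕ) [NeZero M] (t : ℕ → ℝ) (n : ℕ), 1 ≤ M → InfMesh t → 1 ≤ n →
      t n ≤ T →
      ‖gridVec M (laplacianError (L / M) t U n)‖ ≤ M * (C * ((L / M) ^ 2 + step t n ^ 2)) := by
  obtain ⟨C, hC⟩ := exists_averaged_laplacian_bound hT hU L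
  refine ⟨max C 0, le_max_right _ _, fun M _ t n hM ht hn htT => ?_⟩
  obtain ⟨n, rfl⟩ := Nat.exists_eq_succ_of_ne_zero (show n ≠ 0 by lia)
  have hM' : (1 : ℝ) ≤ M := by exact_mod_cast hM
  have hh : 0 < L / M := by positivity
  refine norm_gridVec_le (by positivity) fun i hi j hj => ?_
  have := hC (L / M) (t n) (t (n + 1)) hh (div_le_self hL.le hM') (ht.nonneg n) (ht.lt n).le htT
    _ (node_mul_mem hL hM hi) _ (node_mul_mem hL hM hj)
  rw [laplacianError, abs_sub_comm]
  refine le_trans (le_of_eq ?_) (this.trans (mul_le_mul_of_nonneg_right (le_max_left _ _)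
    (by positivity)))
  simp only [gridLaplacian, half, Int.cast_add, Int.cast_sub, Int.cast_one, add_mul, sub_mul,
    one_mul]

/-- Applied to the velocity, consistency involves the third time derivative of the solution. Its
bound has the shape required by `sum_kerP_mul_le`. -/
theorem sum_kerP_mul_norm_caputoError_le {α : ℝ} (h0 : 0 < α) (h1 : α < 1) (hT : 0 < T)
    (hU : ContDiffOn ℝ 4 (joint U) (spaceTime T)) [NeZero M] (ht : InfMesh t) (h : ℝ) {n : ℕ}
    (hn : t n ≤ T) :
    ∑ j ∈ Icc 1 n, kerP α t n j * ‖gridVec M (caputoError α T h t U j)‖ ≤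
      2 * ∑ j ∈ Icc 1 n, kerP α t n j * kerA α t j j *
        ∫ s in half t (j - 1)..half t j, (s - half t (j - 1)) *
          ‖gridVec M (onGrid h fun x y => timeDeriv T 3 U x y s)‖ := by
  refine (sum_le_sum fun j hj => ?_).trans (sum_kerP_mul_le h0 h1 ht (fun k =>
    intervalIntegral.integral_nonneg ?_ fun s hs => mul_nonneg (sub_nonneg.2 hs.1)
      (norm_nonneg _)) n)
  · obtain ⟨j1, j2⟩ := mem_Icc.1 hj
    refine mul_le_mul_of_nonneg_left ?_ (kerP_nonneg h0 h1 ht j1 j2)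
    exact kerA_consistency_norm h0 h1 (ι := ZMod M × ZMod M)
      (fun p => twiceDiff_timeDeriv hT hU (node M p.1 * h) (node M p.2 * h)) ht j1
      ((ht.half_le j).trans ((ht.monotone j2).trans hn))
  · exact ht.stepMesh.le_level (Nat.sub_le k 1)

end Consistency

section ErrorEquations

variable {β L T : ℝ} {U f : ℝ → ℝ → ℝ → ℝ} {φ₁ φ₂ : ℝ → ℝ → ℝ} {M N : ℕ} {t : ℕ → ℝ}
  {u v : ℕ → ℤ → ℤ → ℝ}

/-- Error of the averaged velocity at a node. -/
noncomputable def velocityError (T h : ℝ) (t : ℕ → ℝ) (U : ℝ → ℝ → ℝ → ℝ) (v : ℕ → ℤ → ℤ → ℝ)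
    (n : ℕ) (i j : ℤ) : ℝ :=
  velocityAverage T h t U n i j - half (fun k => v k i j) n

theorem gridError_sub (ht : InfMesh t) (hS : IsSchemeSolution β L f φ₁ φ₂ M N t u v) {n : ℕ}
    (hn : n < N) (i j : ℤ) :
    gridError L M t U u (n + 1) i j - gridError L M t U u n i j = step t (n + 1) *
      (velocityError T (L / M) t U v (n + 1) i j - quotientError T (L / M) t U (n + 1) i j) := by
  have hs := ht.step_pos (show 1 ≤ n + 1 by lia)
  rw [velocityError, hS.velocity (n + 1) (by lia) hn, quotientError, gridError, gridError]
  simp only [onGrid, Nat.add_sub_cancel]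
  field_simp
  ring

theorem isPeriodicGrid_gridError (hU : IsSmoothSolution β L T f φ₁ φ₂ U) (hM : 1 ≤ M)
    (hS : IsSchemeSolution β L f φ₁ φ₂ M N t u v) {n : ℕ} (hn : n ≤ N) (htn : t n ∈ Set.Icc 0 T) :
    IsPeriodicGrid M (gridError L M t U u n) := by
  have hM' : (M : ℝ) ≠ 0 := by
    have : (1 : ℝ) ≤ M := by exact_mod_cast hM
    positivity
  have e : ∀ i : ℤ, ((i + M : ℤ) : ℝ) * (L / M) = i * (L / M) + L := fun i => by
    push_cast; field_simp
  refine IsPeriodicGrid.sub ⟨fun i j => ?_, fun i j => ?_⟩ (hS.periodic_u n hn)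
  · rw [onGrid, e, hU.periodic_x _ _ _ htn, onGrid]
  · rw [onGrid, e, hU.periodic_y _ _ _ htn, onGrid]

theorem caputo_error_equation (hU : IsSmoothSolution β L T f φ₁ φ₂ U)
    (hS : IsSchemeSolution β L f φ₁ φ₂ M N t u v) {n : ℕ} (hn : 1 ≤ n) (hnN : n ≤ N)
    (htn : half t n ∈ Set.Ioc 0 T) (i j : ℤ) :
    ∑ k ∈ Icc 1 n, kerA (β - 1) t n k *
      ((velocityError T (L / M) t U v k i j - averageError T (L / M) t U k i j) -
        (velocityError T (L / M) t U v (k - 1) i j - averageError T (L / M) t U (k - 1) i j)) =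
      caputoError (β - 1) T (L / M) t U n i j + laplacianError (L / M) t U n i j +
        gridLaplacian (L / M) (fun i j => (1 / 2) *
          (gridError L M t U u n i j + gridError L M t U u (n - 1) i j)) i j := by
  have e1 := hS.scheme n hn hnN i j
  have e2 := hU.equation (i * (L / M)) (j * (L / M)) _ htn
  rw [caputo] at e2
  -- Subtracting the averaging error replaces the averaged exact velocity by its value at the half
  -- level, the argument for which the L1 formula is consistent.
  have e3 : ∀ k, velocityError T (L / M) t U v k i j - averageError T (L / M) t U k i j =
      timeDeriv T 1 U (i * (L / M)) (j * (L / M)) (half t k) - half (fun k => v k i j) k :=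
    fun k => by rw [velocityError, averageError]; ring
  have e4 : ∑ k ∈ Icc 1 n, kerA (β - 1) t n k *
      ((velocityError T (L / M) t U v k i j - averageError T (L / M) t U k i j) -
        (velocityError T (L / M) t U v (k - 1) i j - averageError T (L / M) t U (k - 1) i j)) =
      (∑ k ∈ Icc 1 n, kerA (β - 1) t n k *
        (timeDeriv T 1 U (i * (L / M)) (j * (L / M)) (half t k) -
          timeDeriv T 1 U (i * (L / M)) (j * (L / M)) (half t (k - 1)))) -
        discreteCaputo (β - 1) t (fun k => v k i j) n := by
    rw [discreteCaputo, ← sum_sub_distrib]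
    exact sum_congr rfl fun k _ => by rw [e3, e3]; ring
  have e5 : gridLaplacian (L / M) (fun i j => (1 / 2) *
        (gridError L M t U u n i j + gridError L M t U u (n - 1) i j)) i j =
      gridLaplacian (L / M)
          (fun i j => half (fun k => U (i * (L / M)) (j * (L / M)) (t k)) n) i j -
        gridLaplacian (L / M) (fun i' j' => half (fun k => u k i' j') n) i j := by
    obtain ⟨n, rfl⟩ := Nat.exists_eq_succ_of_ne_zero (show n ≠ 0 by lia)
    simp only [gridLaplacian, gridError, onGrid, half, Nat.succ_eq_add_one, Nat.add_sub_cancel]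
    ring
  rw [e4, e1, e5, caputoError, laplacianError, show 1 - (β - 1) = 2 - β by ring, e2, onGrid]
  ring

end ErrorEquations

end

/-! ### The error bound on infinite meshes. -/

section

variable {β L T : ℝ} {U f : ℝ → ℝ → ℝ → ℝ} {φ₁ φ₂ : ℝ → ℝ → ℝ}

theorem consistencySum_eq {M : ℕ} [NeZero M] {h : ℝ} (hh : h = L / M) (h0 : 0 ≤ h) (m : ℕ) (t : ℕ → ℝ)
    (n : ℕ) : consistencySum β L T M m t U n = h * ∑ j ∈ Icc 1 n, kerP (β - 1) t n j *
      kerA (β - 1) t j j * ∫ s in half t (j - 1)..half t j, (s - half t (j - 1)) *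
        ‖gridVec M (onGrid h fun x y => timeDeriv T m U x y s)‖ := by
  subst hh
  rw [consistencySum, mul_sum]
  refine sum_congr rfl fun j _ => ?_
  rw [mul_left_comm]
  congr 1
  rw [← intervalIntegral.integral_const_mul]
  refine intervalIntegral.integral_congr fun s _ => ?_
  simp only [timeDerivNorm, gridNorm_eq h0]
  ring

theorem consistencySum_nonneg (h0 : 0 < β - 1) (h1 : β - 1 < 1) {t : ℕ → ℝ}
    (ht : InfMesh t) (M m n : ℕ) : 0 ≤ consistencySum β L T M m t U n :=
  sum_nonneg fun j hj => by
    obtain ⟨j1, j2⟩ := mem_Icc.1 hj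
    refine mul_nonneg (mul_nonneg (kerP_nonneg h0 h1 ht j1 j2) (kerA_pos h0 h1 ht j1 le_rfl).le) ?_
    exact intervalIntegral.integral_nonneg (ht.stepMesh.le_level (Nat.sub_le j 1))
      fun s hs => mul_nonneg (sub_nonneg.2 hs.1) (Real.sqrt_nonneg _)

theorem consistencySum_le_max (M m : ℕ) (t : ℕ → ℝ) {k n : ℕ} (hk : 1 ≤ k) (hkn : k ≤ n)
    (hn : 1 ≤ n) : consistencySum β L T M m t U k ≤ consistencyMax β L T M m t U n hn :=
  le_sup' (consistencySum β L T M m t U) (mem_Icc.2 ⟨hk, hkn⟩)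

theorem step_le_step {t : ℕ → ℝ} (ht : InfMesh t) {k n : ℕ} (hk : k < n) :
    step t (k + 1) ≤ step t n := by
  obtain ⟨n, rfl⟩ := Nat.exists_eq_succ_of_ne_zero (show n ≠ 0 by lia)
  exact ht.stepMesh.monotone_step (show k ≤ n by lia)

/-- The error bound on infinite meshes, before the terms are collected. -/
theorem exists_norm_error_bound (hβ₁ : 1 < β) (hβ₂ : β < 2) (hL : 0 < L) (hT : 0 < T)
    (hU : IsSmoothSolution β L T f φ₁ φ₂ U) :
    ∃ C D : ℝ, 0 < C ∧ 0 ≤ D ∧ ∀ (M N : ℕ) [NeZero M] (t : ℕ → ℝ) (u v : ℕ → ℤ → ℤ → ℝ),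
      1 ≤ M → InfMesh t → t N ≤ T → IsSchemeSolution β L f φ₁ φ₂ M N t u v →
      gridNorm M (L / M) (gridError L M t U u N) ≤ C * ∑ k ∈ range N, step t (k + 1) *
        (D * step t (k + 1) ^ 2 + 2 * consistencySum β L T M 3 t U (k + 1) +
          ∑ j ∈ Icc 1 (k + 1), kerP (β - 1) t (k + 1) j *
            (D * ((L / M) ^ 2 + step t j ^ 2))) := by
  have h0 : 0 < β - 1 := by linarith
  have h1 : β - 1 < 1 := by linarith
  have hs : ContDiffOn ℝ 4 (joint U) (spaceTime T) := hU.smooth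
  obtain ⟨C, hC, H⟩ := exists_error_stability h0 h1
  obtain ⟨D₁, hD₁, H₁⟩ := exists_average_error_bound hL hT hs
  obtain ⟨D₂, hD₂, H₂⟩ := exists_laplacian_error_bound hL hT hs
  -- Two averaging errors cost `D₁` each and the Laplacian costs `D₂`; the factor `L` is `h * M`,
  -- from passing between maximum and discrete norm.
  refine ⟨C, 2 * L * D₁ + L * D₂, hC, by positivity, fun M N _ t u v hM ht htN hS => ?_⟩
  have hM' : (1 : ℝ) ≤ M := by exact_mod_cast hM
  have hh : 0 < L / M := by positivity
  have hhM : L / M * M = L := by field_simp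
  have hmem : ∀ n, n ≤ N → t n ∈ Set.Icc 0 T := fun n hn =>
    ⟨ht.nonneg n, (ht.monotone hn).trans htN⟩
  have hmem' : ∀ n, 1 ≤ n → n ≤ N → half t n ∈ Set.Ioc 0 T := fun n hn hnN =>
    ⟨half_pos ht hn, (ht.half_le n).trans (hmem n hnN).2⟩
  have key := H _ (gridOp M (L / M)) (gridOp_isSymmetric _) (inner_gridOp_self_le _) t ht
    (fun n => gridVec M (gridError L M t U u n))
    (fun n => gridVec M (velocityError T (L / M) t U v n))
    (fun n => gridVec M (averageError T (L / M) t U n))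
    (fun n => gridVec M (quotientError T (L / M) t U n))
    (fun n => gridVec M (caputoError (β - 1) T (L / M) t U n) +
      gridVec M (laplacianError (L / M) t U n)) N
    (by
      ext p
      simp [gridVec_apply, gridError, hS.initial_u, onGrid, ht.zero, hU.initial])
    (by
      ext p
      simp [gridVec_apply, velocityError, velocityAverage, half, hS.initial_v, onGrid, ht.zero,
        hU.initial_velocity])
    -- The convention `w^{-1/2} = w^0` makes the averaging error vanish at level 0.
    (by
      ext p
      simp [gridVec_apply, averageError, velocityAverage, half])
    (fun k hk => by
      ext p
      exact gridError_sub ht hS hk _ _)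
    (fun n hn hnN => by
      have hp := (isPeriodicGrid_gridError hU hM hS hnN (hmem n hnN))
      have hp' := (isPeriodicGrid_gridError hU hM hS (show n - 1 ≤ N by lia)
        (hmem (n - 1) (by lia)))
      have e : (1 / 2 : ℝ) • (gridVec M (gridError L M t U u n) +
          gridVec M (gridError L M t U u (n - 1))) = gridVec M fun i j => (1 / 2) *
          (gridError L M t U u n i j + gridError L M t U u (n - 1) i j) := by
        ext p; simp [gridVec_apply, mul_add]
      rw [e, gridOp_gridVec _ ⟨fun i j => by rw [hp.1, hp'.1], fun i j => by rw [hp.2, hp'.2]⟩]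
      ext p
      have := caputo_error_equation hU hS hn hnN (hmem' n hn hnN) (node M p.1) (node M p.2)
      simpa [gridVec_apply] using this)
  rw [gridNorm_eq hh.le]
  refine (mul_le_mul_of_nonneg_left key hh.le).trans ?_
  rw [mul_left_comm]
  refine mul_le_mul_of_nonneg_left ?_ hC.le
  rw [mul_sum]
  refine sum_le_sum fun k hk => ?_
  have hkN : k + 1 ≤ N := mem_range.1 hk
  have htk := (hmem (k + 1) hkN).2
  rw [mul_left_comm]
  refine mul_le_mul_of_nonneg_left ?_ (ht.step_pos (by lia)).le
  obtain ⟨b1, b2⟩ := H₁ M t (k + 1) hM ht (by lia) htk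
  have b3 := sum_kerP_mul_norm_caputoError_le h0 h1 hT hs (M := M) ht (L / M) htk
  have b4 : ∑ j ∈ Icc 1 (k + 1), kerP (β - 1) t (k + 1) j *
      ‖gridVec M (laplacianError (L / M) t U j)‖ ≤ ∑ j ∈ Icc 1 (k + 1),
        kerP (β - 1) t (k + 1) j * (M * (D₂ * ((L / M) ^ 2 + step t j ^ 2))) :=
    sum_le_sum fun j hj => by
      obtain ⟨j1, j2⟩ := mem_Icc.1 hj
      exact mul_le_mul_of_nonneg_left (H₂ M t j hM ht j1 (hmem j (j2.trans hkN)).2)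
        (kerP_nonneg h0 h1 ht j1 j2)
  have b5 : ∑ j ∈ Icc 1 (k + 1), kerP (β - 1) t (k + 1) j *
      ‖gridVec M (caputoError (β - 1) T (L / M) t U j) +
        gridVec M (laplacianError (L / M) t U j)‖ ≤
      ∑ j ∈ Icc 1 (k + 1), kerP (β - 1) t (k + 1) j *
        ‖gridVec M (caputoError (β - 1) T (L / M) t U j)‖ +
      ∑ j ∈ Icc 1 (k + 1), kerP (β - 1) t (k + 1) j *
        ‖gridVec M (laplacianError (L / M) t U j)‖ := by
    rw [← sum_add_distrib]
    refine sum_le_sum fun j hj => ?_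
    obtain ⟨j1, j2⟩ := mem_Icc.1 hj
    rw [← mul_add]
    exact mul_le_mul_of_nonneg_left (norm_add_le _ _) (kerP_nonneg h0 h1 ht j1 j2)
  rw [consistencySum_eq rfl hh.le]
  refine (mul_le_mul_of_nonneg_left (add_le_add (add_le_add b1 b2)
    (b5.trans (add_le_add b3 b4))) hh.le).trans ?_
  have e6 : L / M * ∑ j ∈ Icc 1 (k + 1), kerP (β - 1) t (k + 1) j *
      (M * (D₂ * ((L / M) ^ 2 + step t j ^ 2))) ≤ ∑ j ∈ Icc 1 (k + 1), kerP (β - 1) t (k + 1) j *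
        ((2 * L * D₁ + L * D₂) * ((L / M) ^ 2 + step t j ^ 2)) := by
    rw [mul_sum]
    refine sum_le_sum fun j hj => ?_
    obtain ⟨j1, j2⟩ := mem_Icc.1 hj
    rw [mul_left_comm]
    refine mul_le_mul_of_nonneg_left ?_ (kerP_nonneg h0 h1 ht j1 j2)
    rw [← mul_assoc, hhM, ← mul_assoc]
    exact mul_le_mul_of_nonneg_right (le_add_of_nonneg_left (by positivity)) (by positivity)
  have e7 : L / M * (M * (D₁ * step t (k + 1) ^ 2) + M * (D₁ * step t (k + 1) ^ 2)) ≤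
      (2 * L * D₁ + L * D₂) * step t (k + 1) ^ 2 := by
    rw [show L / M * (M * (D₁ * step t (k + 1) ^ 2) + M * (D₁ * step t (k + 1) ^ 2)) =
      2 * (L / M * M) * D₁ * step t (k + 1) ^ 2 by ring, hhM]
    exact mul_le_mul_of_nonneg_right (le_add_of_nonneg_right (by positivity)) (by positivity)
  rw [mul_add, mul_add (L / M) (2 * _)]
  linarith

theorem exists_infMesh_error_bound (hβ₁ : 1 < β) (hβ₂ : β < 2) (hL : 0 < L) (hT : 0 < T)
    (hU : IsSmoothSolution β L T f φ₁ φ₂ U) :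
    ∃ c : ℝ, 0 < c ∧ ∀ (M N : ℕ) (t : ℕ → ℝ) (u v : ℕ → ℤ → ℤ → ℝ) (hN : 1 ≤ N),
      1 ≤ M → InfMesh t → t N ≤ T → IsSchemeSolution β L f φ₁ φ₂ M N t u v →
      gridNorm M (L / M) (gridError L M t U u N) ≤
        c * (consistencyMax β L T M 3 t U N hN + half t N ^ (β - 1) * (L / M) ^ 2 +
          t N * step t N ^ 2) := by
  have h0 : 0 < β - 1 := by linarith
  have h1 : β - 1 < 1 := by linarith
  obtain ⟨C, D, hC, hD, H⟩ := exists_norm_error_bound hβ₁ hβ₂ hL hT hU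
  set g := Real.Gamma (1 - (β - 1)) with hg
  have hg0 : 0 < g := Real.Gamma_pos_of_pos (by linarith)
  have hTα : 0 < T ^ (β - 1) := Real.rpow_pos_of_pos hT _
  set c₁ := C * (D + g * T ^ (β - 1) * D) with hc₁
  set c₂ := C * 2 * T with hc₂
  set c₃ := C * T * g * D with hc₃
  have p1 : 0 ≤ c₁ := by positivity
  have p2 : 0 < c₂ := by positivity
  have p3 : 0 ≤ c₃ := by positivity
  refine ⟨c₁ + c₂ + c₃, by positivity, fun M N t u v hN hM ht htN hS => ?_⟩
  have : NeZero M := ⟨by lia⟩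
  have hM' : (1 : ℝ) ≤ M := by exact_mod_cast hM
  set S := consistencyMax β L T M 3 t U N hN with hSdef
  set h := L / (M : ℝ) with hh
  set d := step t N with hd
  have hd0 : 0 < d := ht.step_pos hN
  have hS0 : 0 ≤ S := (consistencySum_nonneg h0 h1 ht M 3 N).trans
    (consistencySum_le_max M 3 t hN le_rfl hN)
  have hσ : 0 < half t N := half_pos ht hN
  have hσα : 0 < half t N ^ (β - 1) := Real.rpow_pos_of_pos hσ _
  have hσT : half t N ^ (β - 1) ≤ T ^ (β - 1) :=
    Real.rpow_le_rpow hσ.le ((ht.half_le N).trans htN) h0.le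
  refine (H M N t u v hM ht htN hS).trans ?_
  have hsum : ∑ k ∈ range N, step t (k + 1) = t N := by
    simp only [step_succ]
    rw [sum_range_sub, ht.zero, sub_zero]
  -- The last step is the largest and `half t` is increasing, so each bracket is bounded by its
  -- final-time version; the remaining steps sum to `t N`.
  have hterm : ∀ k ∈ range N, step t (k + 1) *
      (D * step t (k + 1) ^ 2 + 2 * consistencySum β L T M 3 t U (k + 1) +
          ∑ j ∈ Icc 1 (k + 1), kerP (β - 1) t (k + 1) j * (D * (h ^ 2 + step t j ^ 2))) ≤
      step t (k + 1) * (D * d ^ 2 + 2 * S + g * half t N ^ (β - 1) * (D * (h ^ 2 + d ^ 2))) := by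
    intro k hk
    have hkN := mem_range.1 hk
    have s1 := step_le_step ht hkN
    have s0 := ht.step_pos (show 1 ≤ k + 1 by lia)
    refine mul_le_mul_of_nonneg_left (add_le_add (add_le_add ?_ ?_) ?_) s0.le
    · exact mul_le_mul_of_nonneg_left (pow_le_pow_left₀ s0.le s1 2) hD
    · exact mul_le_mul_of_nonneg_left (consistencySum_le_max M 3 t (by lia) hkN hN) two_pos.le
    · have a : ∑ j ∈ Icc 1 (k + 1), kerP (β - 1) t (k + 1) j * (D * (h ^ 2 + step t j ^ 2)) ≤
          ∑ j ∈ Icc 1 (k + 1), kerP (β - 1) t (k + 1) j * (D * (h ^ 2 + d ^ 2)) := by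
        refine sum_le_sum fun j hj => ?_
        obtain ⟨j1, j2⟩ := mem_Icc.1 hj
        refine mul_le_mul_of_nonneg_left (mul_le_mul_of_nonneg_left (add_le_add_right ?_ _) hD)
          (kerP_nonneg h0 h1 ht j1 j2)
        obtain ⟨i, rfl⟩ := Nat.exists_eq_succ_of_ne_zero (show j ≠ 0 by lia)
        exact pow_le_pow_left₀ (ht.step_pos j1).le (step_le_step ht (by lia)) 2
      refine a.trans ?_
      rw [← sum_mul]
      refine mul_le_mul_of_nonneg_right ((sum_kerP_le h0 h1 ht (k + 1)).trans ?_) (by positivity)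
      exact mul_le_mul_of_nonneg_left (Real.rpow_le_rpow (ht.half_nonneg _)
        (ht.stepMesh.le_level hkN) h0.le) hg0.le
  refine (mul_le_mul_of_nonneg_left (sum_le_sum hterm) hC.le).trans ?_
  rw [← sum_mul, hsum]
  have tN0 : 0 ≤ t N := ht.nonneg N
  have q1 : C * (t N * (D * d ^ 2 + 2 * S + g * half t N ^ (β - 1) * (D * (h ^ 2 + d ^ 2)))) =
      C * (D + g * half t N ^ (β - 1) * D) * (t N * d ^ 2) + C * 2 * t N * S +
        C * t N * g * D * (half t N ^ (β - 1) * h ^ 2) := by ring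
  have q2 : C * (D + g * half t N ^ (β - 1) * D) ≤ c₁ := by
    rw [hc₁]; gcongr
  have q3 : C * 2 * t N ≤ c₂ := by rw [hc₂]; gcongr
  have q4 : C * t N * g * D ≤ c₃ := by rw [hc₃]; gcongr
  rw [q1]
  have r1 : 0 ≤ t N * d ^ 2 := by positivity
  have r3 : 0 ≤ half t N ^ (β - 1) * h ^ 2 := by positivity
  have w1 := mul_le_mul_of_nonneg_right q2 r1
  have w2 := mul_le_mul_of_nonneg_right q3 hS0
  have w3 := mul_le_mul_of_nonneg_right q4 r3
  have z1 := mul_nonneg p1 hS0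
  have z2 := mul_nonneg p1 r3
  have z3 := mul_nonneg p2.le r1
  have z4 := mul_nonneg p2.le r3
  have z5 := mul_nonneg p3 r1
  have z6 := mul_nonneg p3 hS0
  linarith

end

/-! ### The dominated case, and the passage to finite meshes. -/

section

variable {β L T : ℝ} {U f : ℝ → ℝ → ℝ → ℝ} {φ₁ φ₂ : ℝ → ℝ → ℝ}

theorem exists_infMesh_dominated_bound (hβ₁ : 1 < β) (hβ₂ : β < 2) (hL : 0 < L) (hT : 0 < T)
    (hU : IsSmoothSolution β L T f φ₁ φ₂ U) {m : ℕ} (hm : m < 4) {κ : ℝ} (hκ : 0 < κ) :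
    ∃ c : ℝ, 0 < c ∧ ∀ (M N : ℕ) (t : ℕ → ℝ) (hN : 1 ≤ N), 1 ≤ M → InfMesh t → t N ≤ T →
      (∀ s ∈ Set.Icc 0 T, κ ≤ timeDerivNorm L T M m U s) →
      consistencyMax β L T M 3 t U N hN + t N * step t N ^ 2 ≤
        c * consistencyMax β L T M m t U N hN := by
  have h0 : 0 < β - 1 := by linarith
  have h1 : β - 1 < 1 := by linarith
  have hs : ContDiffOn ℝ 4 (joint U) (spaceTime T) := hU.smooth
  obtain ⟨C, hC⟩ := exists_timeDeriv_bound hT hs L (m := 3) (by norm_num)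
  have hC0 : 0 ≤ C := (abs_nonneg _).trans
    (hC 0 ⟨by linarith, by linarith⟩ 0 ⟨by linarith, by linarith⟩ 0 ⟨le_rfl, hT.le⟩)
  refine ⟨L * C / κ + T * (8 / κ), by positivity, fun M N t hN hM ht htN hκs => ?_⟩
  have : NeZero M := ⟨by lia⟩
  have hM' : (1 : ℝ) ≤ M := by exact_mod_cast hM
  have hh : 0 < L / M := by positivity
  -- The third derivative is bounded by `L * C` in the discrete norm, and the lower bound `κ` turns
  -- this constant into a multiple of the `m`-th derivative.
  have hB : ∀ s ∈ Set.Icc 0 T, timeDerivNorm L T M 3 U s ≤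
      L * C / κ * timeDerivNorm L T M m U s := fun s hsT => by
    have e : timeDerivNorm L T M 3 U s ≤ L * C := by
      rw [timeDerivNorm, gridNorm_eq hh.le]
      calc L / M * _ ≤ L / M * (M * C) :=
            mul_le_mul_of_nonneg_left (norm_gridVec_le hC0 fun i hi j hj => by
              have hi' := node_mul_mem hL hM hi
              have hj' := node_mul_mem hL hM hj
              exact hC _ ⟨by linarith [hi'.1], by linarith [hi'.2]⟩ _
                ⟨by linarith [hj'.1], by linarith [hj'.2]⟩ s hsT) hh.le
        _ = L * C := by field_simp
    calc _ ≤ L * C / κ * κ := e.trans (le_of_eq (by field_simp))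
      _ ≤ _ := mul_le_mul_of_nonneg_left (hκs s hsT) (by positivity)
  have hsub : ∀ j, j ≤ N → Set.Icc (half t (j - 1)) (half t j) ⊆ Set.Icc 0 T := fun j hj =>
    Set.Icc_subset_Icc (ht.half_nonneg _) ((ht.half_le j).trans ((ht.monotone hj).trans htN))
  have hle : ∀ j, half t (j - 1) ≤ half t j := fun j => ht.stepMesh.le_level (Nat.sub_le j 1)
  have hint : ∀ l, l < 4 → ∀ j, j ≤ N → IntervalIntegrable
      (fun s => (s - half t (j - 1)) * timeDerivNorm L T M l U s) MeasureTheory.volume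
      (half t (j - 1)) (half t j) := fun l hl j hj => by
    refine ContinuousOn.intervalIntegrable ?_
    rw [Set.uIcc_of_le (hle j)]
    exact (continuousOn_id.sub continuousOn_const).mul
      ((continuousOn_timeDerivNorm hT hs hl M).mono (hsub j hj))
  have hmax : consistencyMax β L T M 3 t U N hN ≤
      L * C / κ * consistencyMax β L T M m t U N hN := by
    refine sup'_le _ _ fun k hk => ?_
    obtain ⟨k1, k2⟩ := mem_Icc.1 hk
    refine le_trans ?_ (mul_le_mul_of_nonneg_left (consistencySum_le_max M m t k1 k2 hN)
      (by positivity))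
    rw [consistencySum, consistencySum, mul_sum]
    refine sum_le_sum fun j hj => ?_
    obtain ⟨j1, j2⟩ := mem_Icc.1 hj
    rw [mul_left_comm]
    refine mul_le_mul_of_nonneg_left ?_ (mul_nonneg (kerP_nonneg h0 h1 ht j1 j2)
      (kerA_pos h0 h1 ht j1 le_rfl).le)
    rw [← intervalIntegral.integral_const_mul]
    refine intervalIntegral.integral_mono_on (hle j) (hint 3 (by norm_num) j (j2.trans k2))
      ((hint m hm j (j2.trans k2)).const_mul _) fun s hs => ?_
    rw [mul_left_comm]
    exact mul_le_mul_of_nonneg_left (hB s (hsub j (j2.trans k2) hs)) (sub_nonneg.2 hs.1)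
  -- Only the summand `j = k = N` is kept. There the kernel product is 1, and the integral is at
  -- least `κ` times half the squared width, the width being at least half a step.
  have hlow : κ * step t N ^ 2 / 8 ≤ consistencyMax β L T M m t U N hN := by
    refine le_trans ?_ (consistencySum_le_max M m t hN le_rfl hN)
    have hnn : ∀ j ∈ Icc 1 N, 0 ≤ kerP (β - 1) t N j * kerA (β - 1) t j j *
        ∫ s in half t (j - 1)..half t j, (s - half t (j - 1)) * timeDerivNorm L T M m U s := by
      intro j hj
      obtain ⟨j1, j2⟩ := mem_Icc.1 hj
      refine mul_nonneg (mul_nonneg (kerP_nonneg h0 h1 ht j1 j2)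
        (kerA_pos h0 h1 ht j1 le_rfl).le) ?_
      exact intervalIntegral.integral_nonneg (hle j)
        fun s hs => mul_nonneg (sub_nonneg.2 hs.1) (Real.sqrt_nonneg _)
    refine le_trans ?_ (single_le_sum hnn (mem_Icc.2 ⟨hN, le_rfl⟩))
    rw [kerP_self, one_div, inv_mul_cancel₀ (kerA_pos h0 h1 ht hN le_rfl).ne', one_mul]
    have i1 : ∫ s in half t (N - 1)..half t N, (s - half t (N - 1)) * κ =
        κ * (half t N - half t (N - 1)) ^ 2 / 2 := by
      rw [intervalIntegral.integral_mul_const, intervalIntegral.integral_comp_sub_right (fun s => s),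
        integral_id]
      ring
    have i2 : ∫ s in half t (N - 1)..half t N, (s - half t (N - 1)) * κ ≤
        ∫ s in half t (N - 1)..half t N, (s - half t (N - 1)) * timeDerivNorm L T M m U s :=
      intervalIntegral.integral_mono_on (hle N)
        (Continuous.intervalIntegrable (by fun_prop) _ _) (hint m hm N le_rfl) fun s hs =>
        mul_le_mul_of_nonneg_left (hκs s (hsub N le_rfl hs)) (sub_nonneg.2 hs.1)
    refine le_trans ?_ (i1 ▸ i2)
    obtain ⟨n, rfl⟩ := Nat.exists_eq_succ_of_ne_zero (show N ≠ 0 by lia)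
    have w := ht.stepMesh.le_two_width n
    have hd := sub_pos.2 (ht.lt n)
    rw [Nat.succ_eq_add_one, step_succ, Nat.add_sub_cancel]
    have := mul_le_mul_of_nonneg_left (pow_le_pow_left₀ hd.le w 2) hκ.le
    linarith
  have hS := (div_nonneg (by positivity) (by norm_num)).trans hlow
  have htail : t N * step t N ^ 2 ≤ T * (8 / κ) * consistencyMax β L T M m t U N hN := by
    rw [mul_assoc]
    refine mul_le_mul htN ?_ (sq_nonneg _) hT.le
    rw [div_mul_eq_mul_div, le_div_iff₀ hκ]
    linarith
  linarith

section Extension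

variable {t t' : ℕ → ℝ} {N : ℕ}

/-- A finite mesh is the beginning of an infinite one. -/
theorem exists_infMesh (hm : IsTimeMesh T N t) (hN : 1 ≤ N) :
    ∃ t', InfMesh t' ∧ ∀ k ≤ N, t' k = t k := by
  obtain ⟨p, rfl⟩ := Nat.exists_eq_succ_of_ne_zero (show N ≠ 0 by lia)
  have hs : 0 < t (p + 1) - t p := sub_pos.2 (hm.lt p (by lia))
  set s := t (p + 1) - t p with hsdef
  -- Repeating the last step forever keeps the steps nondecreasing. The quantities of the scheme up
  -- to level `N` see only the original levels.
  set t' : ℕ → ℝ := fun k => if k ≤ p + 1 then t k else t (p + 1) + (k - (p + 1 : ℕ)) * s with ht'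
  have a1 : ∀ k, k ≤ p + 1 → t' k = t k := fun k hk => if_pos hk
  have a2 : ∀ k, p + 1 ≤ k → t' k = t (p + 1) + (k - (p + 1 : ℕ)) * s := fun k hk => by
    rcases hk.eq_or_lt with rfl | h
    · rw [a1 _ le_rfl]; simp
    · exact if_neg (by lia)
  have a3 : ∀ k, p ≤ k → t' (k + 1) - t' k = s := fun k hk => by
    rcases hk.eq_or_lt with rfl | h
    · rw [a1 _ le_rfl, a1 _ (by lia)]
    · rw [a2 _ (by lia), a2 _ (by lia)]; push_cast; ring
  refine ⟨t', ⟨?_, fun k => ?_, fun k => ?_⟩, a1⟩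
  · rw [a1 _ (by lia), hm.zero]
  · rcases lt_or_ge k p with h | h
    · rw [a1 _ (by lia), a1 _ (by lia)]; exact hm.lt k (by lia)
    · exact sub_pos.1 (by rw [a3 k h]; exact hs)
  · rcases lt_or_ge k p with h | h
    · rw [a1 _ (by lia), a1 _ (by lia), a1 _ (by lia)]
      exact hm.step_le (k + 2) (by lia) (by lia)
    · rw [a3 k h, show t' (k + 2) - t' (k + 1) = s from a3 (k + 1) (by lia)]

theorem half_congr (h : ∀ k ≤ N, t' k = t k) {k : ℕ} (hk : k ≤ N) : half t' k = half t k := by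
  cases k with
  | zero => exact h 0 hk
  | succ k => simp only [half]; rw [h _ hk, h k (by lia)]

theorem kerA_congr (h : ∀ k ≤ N, t' k = t k) (α : ℝ) {n k : ℕ} (hn : n ≤ N) (hk : k ≤ N) :
    kerA α t' n k = kerA α t n k := by
  simp only [kerA]
  rw [half_congr h hk, half_congr h (show k - 1 ≤ N by lia), half_congr h hn]

theorem kerP_congr (h : ∀ k ≤ N, t' k = t k) (α : ℝ) {n k : ℕ} (hn : n ≤ N) (hk : k ≤ n) :
    kerP α t' n k = kerP α t n k := by
  induction hi : n - k using Nat.strong_induction_on generalizing k with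
  | _ i ih =>
    rcases hk.eq_or_lt with rfl | hlt
    · rw [kerP_self, kerP_self, kerA_congr h α hn hn]
    · rw [kerP_of_lt _ _ _ _ hlt, kerP_of_lt _ _ _ _ hlt, kerA_congr h α (by lia) (by lia)]
      congr 1
      refine sum_congr rfl fun j hj => ?_
      obtain ⟨j1, j2⟩ := mem_Icc.1 hj
      rw [kerA_congr h α (by lia) (by lia), kerA_congr h α (by lia) (by lia),
        ih (n - j) (by lia) j2 rfl]

theorem consistencyMax_congr (h : ∀ k ≤ N, t' k = t k) (M m : ℕ) {n : ℕ} (hn : 1 ≤ n)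
    (hnN : n ≤ N) :
    consistencyMax β L T M m t' U n hn = consistencyMax β L T M m t U n hn := by
  refine sup'_congr _ rfl fun k hk => ?_
  obtain ⟨k1, k2⟩ := mem_Icc.1 hk
  refine sum_congr rfl fun j hj => ?_
  obtain ⟨j1, j2⟩ := mem_Icc.1 hj
  rw [kerP_congr h _ (by lia) j2, kerA_congr h _ (by lia) (by lia), half_congr h (by lia),
    half_congr h (by lia)]

theorem IsSchemeSolution.congr {M : ℕ} {u v : ℕ → ℤ → ℤ → ℝ}
    (hS : IsSchemeSolution β L f φ₁ φ₂ M N t u v) (h : ∀ k ≤ N, t' k = t k) {n : ℕ} (hn : n ≤ N) :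
    IsSchemeSolution β L f φ₁ φ₂ M n t' u v where
  periodic_u k hk := hS.periodic_u k (hk.trans hn)
  periodic_v k hk := hS.periodic_v k (hk.trans hn)
  scheme k k1 kn i j := by
    rw [half_congr h (kn.trans hn), ← hS.scheme k k1 (kn.trans hn), discreteCaputo, discreteCaputo]
    refine sum_congr rfl fun l hl => ?_
    obtain ⟨l1, l2⟩ := mem_Icc.1 hl
    rw [kerA_congr h _ (by lia) (by lia)]
  velocity k k1 kn i j := by
    rw [hS.velocity k k1 (kn.trans hn), step, step, h k (by lia), h (k - 1) (by lia)]
  initial_u := hS.initial_u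
  initial_v := hS.initial_v

end Extension

theorem exists_error_bound (hβ₁ : 1 < β) (hβ₂ : β < 2) (hL : 0 < L) (hT : 0 < T)
    (hU : IsSmoothSolution β L T f φ₁ φ₂ U) :
    ∃ c : ℝ, 0 < c ∧ ∀ (M N : ℕ) (t : ℕ → ℝ) (u v : ℕ → ℤ → ℤ → ℝ),
      1 ≤ M → IsTimeMesh T N t → IsSchemeSolution β L f φ₁ φ₂ M N t u v →
      ∀ (n : ℕ) (hn : 1 ≤ n), n ≤ N →
        gridNorm M (L / M) (gridError L M t U u n) ≤
          c * (consistencyMax β L T M 3 t U n hn + half t n ^ (β - 1) * (L / M) ^ 2 +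
            t n * step t n ^ 2) := by
  obtain ⟨c, hc, H⟩ := exists_infMesh_error_bound hβ₁ hβ₂ hL hT hU
  refine ⟨c, hc, fun M N t u v hM hm hS n hn hnN => ?_⟩
  obtain ⟨t', ht', h⟩ := exists_infMesh hm (hn.trans hnN)
  -- The whole mesh is extended but the scheme is truncated at level `n`, so a bound at the final
  -- level gives the bound at every level with one constant.
  have := H M n t' u v hn hM ht' ((ht'.monotone hnN).trans_eq ((h N le_rfl).trans hm.final))
    (hS.congr h hnN)
  rwa [consistencyMax_congr h M 3 hn hnN, half_congr h hnN, step, h n hnN, h (n - 1) (by lia),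
    show gridError L M t' U u n = gridError L M t U u n by unfold gridError; rw [h n hnN]] at this

theorem exists_dominated_error_bound (hβ₁ : 1 < β) (hβ₂ : β < 2) (hL : 0 < L) (hT : 0 < T)
    (hU : IsSmoothSolution β L T f φ₁ φ₂ U) {m : ℕ} (hm : m < 4) {κ : ℝ} (hκ : 0 < κ) :
    ∃ c : ℝ, 0 < c ∧ ∀ (M N : ℕ) (t : ℕ → ℝ) (u v : ℕ → ℤ → ℤ → ℝ),
      1 ≤ M → IsTimeMesh T N t → IsSchemeSolution β L f φ₁ φ₂ M N t u v →
      (∀ s ∈ Set.Icc 0 T, κ ≤ timeDerivNorm L T M m U s) →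
      ∀ (n : ℕ) (hn : 1 ≤ n), n ≤ N →
        gridNorm M (L / M) (gridError L M t U u n) ≤
          c * (consistencyMax β L T M m t U n hn + half t n ^ (β - 1) * (L / M) ^ 2) := by
  obtain ⟨c, hc, H⟩ := exists_error_bound hβ₁ hβ₂ hL hT hU
  obtain ⟨c', hc', H'⟩ := exists_infMesh_dominated_bound hβ₁ hβ₂ hL hT hU hm hκ
  refine ⟨c * (c' + 1), by positivity, fun M N t u v hM hmesh hS hκs n hn hnN => ?_⟩
  obtain ⟨t', ht', h⟩ := exists_infMesh hmesh (hn.trans hnN)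
  have d := H' M n t' hn hM ht' ((ht'.monotone hnN).trans_eq ((h N le_rfl).trans hmesh.final)) hκs
  have hS0 := (consistencySum_nonneg (L := L) (T := T) (U := U) (by linarith : 0 < β - 1)
    (by linarith) ht' M m n).trans (consistencySum_le_max M m t' hn le_rfl hn)
  have hσ := Real.rpow_nonneg (ht'.half_nonneg n) (β - 1)
  rw [half_congr h hnN] at hσ
  rw [consistencyMax_congr h M m hn hnN] at d hS0
  rw [consistencyMax_congr h M 3 hn hnN, step, h n hnN, h (n - 1) (by lia), ← step] at d
  refine (H M N t u v hM hmesh hS n hn hnN).trans ?_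
  rw [mul_assoc]
  refine mul_le_mul_of_nonneg_left ?_ hc.le
  have := mul_nonneg hc'.le (mul_nonneg hσ (sq_nonneg (L / (M : ℝ))))
  linarith

end

end DiffusionWave


open DiffusionWave in
theorem theorem4p1 (β L T : ℝ) (hβ₁ : 1 < β) (hβ₂ : β < 2) (hL : 0 < L) (hT : 0 < T)
    (f : ℝ → ℝ → ℝ → ℝ) (φ₁ φ₂ : ℝ → ℝ → ℝ) (U : ℝ → ℝ → ℝ → ℝ)
    (hU : IsSmoothSolution β L T f φ₁ φ₂ U) :
    (∃ c : ℝ, 0 < c ∧ ∀ (M N : ℕ) (t : ℕ → ℝ) (u v : ℕ → ℤ → ℤ → ℝ),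
      1 ≤ M → IsTimeMesh T N t → IsSchemeSolution β L f φ₁ φ₂ M N t u v →
      ∀ (n : ℕ) (hn : 1 ≤ n), n ≤ N →
        gridNorm M (L / M) (gridError L M t U u n) ≤
          c * (consistencyMax β L T M 3 t U n hn + half t n ^ (β - 1) * (L / M) ^ 2 +
            t n * step t n ^ 2)) ∧
    (∀ m : ℕ, m = 2 ∨ m = 3 → ∀ κ : ℝ, 0 < κ →
      ∃ c : ℝ, 0 < c ∧ ∀ (M N : ℕ) (t : ℕ → ℝ) (u v : ℕ → ℤ → ℤ → ℝ),
        1 ≤ M → IsTimeMesh T N t → IsSchemeSolution β L f φ₁ φ₂ M N t u v →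
        (∀ s ∈ Set.Icc 0 T, κ ≤ timeDerivNorm L T M m U s) →
        ∀ (n : ℕ) (hn : 1 ≤ n), n ≤ N →
          gridNorm M (L / M) (gridError L M t U u n) ≤
            c * (consistencyMax β L T M m t U n hn + half t n ^ (β - 1) * (L / M) ^ 2)) :=
  ⟨exists_error_bound hβ₁ hβ₂ hL hT hU,
    fun _ hm _ hκ => exists_dominated_error_bound hβ₁ hβ₂ hL hT hU (by lia) hκ⟩
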